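/- **Setting.** Let $\mathbb K\in\{\mathbb R,\mathbb C\}$. Let $\{V_k\}_{k\ge1}$ be Banach spaces over $\mathbb K$ with $V_{k+1}\subset V_k$ boundedly, such that $V_\infty=\bigcap_k V_k$ is dense in every $V_k$ and for every $l$ there is a $k\ge l$ with $V_k\subset V_l$ compact. Let $V_1$ be a Hilbert space. Let $A\colon V_\infty\to V_\infty$ be linear and such that for every $l$ there is a $k$ for which $A$ extends to a bounded operator $V_k\to V_l$. Let $\{e_j\}_{j\ge1}\subset V_\infty$ be a Hilbert basis of $V_1$ with $Ae_j=\alpha_je_j$. Suppose that $\{V_k\}$ is comparable to a nested sequence $\{W_k\}$ of Hilbert spaces (every $W_k$ lies boundedly between two of the $V_l$, and every $V_k$ between two of the $W_l$) in each of which the $e_j$ are orthogonal with dense span. Let $I\subset\mathbb R$ be an open interval containing $0$. A map $\varphi\colon I\times V_\infty\to V_\infty$ is *infinitely differentiable* if for all $n,l$ there is a $k$ such that $\varphi$ extends to an $n$ times differentiable map $I\times V_k\to V_l$ (derivatives in the space variable being $\mathbb K$-linear). It is $\mathcal O(n)$ if for every $l$ there is a $k$ with $\|\varphi(t,v)\|_{V_l}=O(\|v\|_{V_k}^n)$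 as $v\to0$ in $V_k$, uniformly for $t$ in compact subsets of $I$. A function $g$ on $I$ *grows at most polynomially* if $|g(t)|\le C(1+|t|^r)$ on $I$ for some $C,r>0$. The map $\varphi$ *has polynomial growth* if for all $v,h\in V_\infty$, $k\ge1$ and $l,n\ge0$ the function $t\mapsto\|\partial_t^l D_v^n\varphi(t,v)(h,\dots,h)\|_{V_k}$ grows at most polynomially. Let $f\colon I\times V_\infty\to V_\infty$ be infinitely differentiable, with polynomial growth, $f=\mathcal O(2)$, and such that for every $l$ there is a $k$ for which $f(t,\cdot)\colon V_k\to V_l$ is differentiable with $\|D_vf(t,v)\|_{\mathcal B(V_k,V_l)}=O(\|v\|_{V_k})$ as $v\to 0$, uniformly for $t$ in compact subsets of $I$. Let $0\le\alpha<\tilde\mu<\min(\beta,\gamma)$ (where $\beta$, $\gamma$ may be $\infty$) be such that no $\operatorname{Re}\alpha_j$ lies in $(-\beta,-\alpha)\cup(\alpha,\gamma)$. Put $J_c=\{j:|\operatorname{Re}\alpha_j|\le\alpha\}$, $J_s=\{j:\operatorname{Re}\alpha_j\le-\beta\}$, $J_u=\{j:\operatorname{Re}\alpha_j\ge\gamma\}$,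 and let $V_a$ be the closure in $V_1$ of the span of $\{e_j\}_{j\in J_a}$, for $a=c,s,u$. For a finitely supported multi-index $q$ put $v^q=\prod_j(e_j,v)_{V_1}^{q_j}$, let $q^c,q^s,q^u$ be the parts of $q$ supported in $J_c,J_s,J_u$, and put $\mu^q_j=\sum_iq_i\alpha_i-\alpha_j$. A homogeneous polynomial of degree $n$ on $V_\infty$ is *compact* if for every $l$ there is a $k$ such that it is the restriction of $v\mapsto\lambda(v,\dots,v)$ for a bounded $n$-linear $\lambda\colon V_k^n\to V_l$ belonging to $\mathcal K(V_k,\mathcal K(V_k,\dots,\mathcal K(V_k,V_l)))$; a compact polynomial is a finite sum of these, of degrees $\geq 1$. Infinite series $\sum_q$, $\sum_{q,j}$ of polynomials are limits as $N\to\infty$ of the sums over the $q$ supported in $\{1,\dots,N\}$ (and $j\le N$). Such a series, of polynomials of bounded degree, *converges in $\mathrm{Pol}(V_\infty)$ differentiably in $t$* if for every $m,l$ there is a $k$ such that its $m$-th $t$-derivative converges in the norm of polynomials $V_k\to V_l$, uniformly for $t$ in compact subsets of $I$. **Theorem.** Let $p\ge2$ be an integer with $\beta-(p+1)\alpha>\tilde\mu$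 and $\gamma-(p+1)\alpha>\tilde\mu$. Then there are infinitely differentiable maps $F_p,\xi_p,R_p\colon I\times V_\infty\to V_\infty$ such that: 1. $R_p=\mathcal O(p)$ and $F_p=\mathcal O(2)$. 2. For every $t\in I$, $F_p(t,\cdot)$ and $\xi_p(t,\cdot)-\mathrm{id}$ are compact polynomials of degree at most $p-1$, and $\xi_p(t,\cdot)$ is a near-identity at $0$: for every $l$ there is a $k\geq l$ such that it extends to a map $V_k\to V_l$ that is differentiable near $0$, with derivative continuous near $0$ and equal at $0$ to the inclusion. 3. $F_p$ separates invariant subspaces: $F_p=F_c+F_s+F_u$, where $F_a$ takes values in $V_a$ and is a series $\sum_{|q|\le p}F_a^q(t)v^q$ with smooth $F_a^q\colon I\to V_\infty$, convergent in $\mathrm{Pol}(V_\infty)$ differentiably in $t$, and the sum is over the $q$ for which: $q^s,q^u$ are both zero or both nonzero (if $a=c$); $q^s\ne0$ (if $a=s$); $q^u\neq0$ (if $a=u$). 4. If $X\colon I\to V_\infty$ is smooth with $\dot X(t)=AX(t)+F_p(t,X(t))$ on $I$, then $x(t)=\xi_p(t,X(t))$ is smooth and satisfies $\dot x(t)=Ax(t)+f(t,x(t))+R_p(t,X(t))$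 on $I$. 5. $(\xi_p,F_p,R_p)$ can be constructed using only $\tilde\mu$-regular integrals over $I$, i.e. integrals of an exponential with decay rate larger than $\tilde\mu$ times a function of at most polynomial growth. Precisely, $(\xi_p,F_p,R_p)$ is the last term of a sequence $(\xi_n,F_n,R_n)_{2\le n\le p}$ with $\xi_2(t,v)=v$, $F_2=0$, and $R_n=\partial_t\xi_n+D_v\xi_n(A+F_n)-A\xi_n-f(t,\xi_n)$, where for $2\le n<p$ $$R_n(t,v)=-\sum_{|q|=n}\sum_ja^q_j(t)v^qe_j+\mathcal O(n+1),\qquad \xi_{n+1}=\xi_n+\sum_{|q|=n}\sum_j\hat\xi^q_j(t)v^qe_j,\qquad F_{n+1}=F_n+\sum_{|q|=n}\sum_j\hat F^q_j(t)v^qe_j.$$ Here all series converge in $\mathrm{Pol}(V_\infty)$ differentiably in $t$, and the functions $a^q_j$ are smooth and, with all their derivatives, grow at most polynomially. Let $J^q$ be the set of $j$ such that $j\in J_c$ and exactly one of $q^s,q^u$ is zero, or $j\in J_s$ and $q^s=0$, or $j\in J_u$ and $q^u=0$. If $j\notin J^q$, then $\hat\xi^q_j=0$ and $\hat F^q_j=a^q_j$.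 If $j\in J^q$, then $|\operatorname{Re}\mu^q_j|>\tilde\mu$, $\hat F^q_j=0$, and $\hat\xi^q_j(t)=\int_{\inf I}^te^{-\mu^q_j(t-\tau)}a^q_j(\tau)\,d\tau$ if $\operatorname{Re}\mu^q_j>0$, while $\hat\xi^q_j(t)=-\int_t^{\sup I}e^{-\mu^q_j(t-\tau)}a^q_j(\tau)\,d\tau$ if $\operatorname{Re}\mu^q_j<0$. -/

import Mathlib

open Set Filter Topology
open scoped ContDiff

universe u w

/-- A sequence of Banach spaces, each with an injective bounded map to the previous one
(`X (k+1) ⊂ X k` with bounded inclusion). The index starts at `0`: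
`X 0` is the largest space, usually written `V₁`. -/
structure BanachTower (𝕜 : Type u) [RCLike 𝕜] where
  X : ℕ → Type w
  [normedAddCommGroup : ∀ k, NormedAddCommGroup (X k)]
  [normedSpace : ∀ k, NormedSpace 𝕜 (X k)]
  [completeSpace : ∀ k, CompleteSpace (X k)]
  incl : ∀ k, X (k + 1) →L[𝕜] X k
  incl_injective : ∀ k, Function.Injective (incl k)

attribute [instance] BanachTower.normedAddCommGroup BanachTower.normedSpace
  BanachTower.completeSpace

namespace BanachTower

variable {𝕜 : Type u} [RCLike 𝕜]

/-- Each space is also a real normed space, so that one can differentiate in real time. -/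
noncomputable instance realNormedSpace (V : BanachTower.{u, w} 𝕜) (k : ℕ) :
    NormedSpace ℝ (V.X k) :=
  NormedSpace.restrictScalars ℝ 𝕜 (V.X k)

/-- The intersection `V_∞` of all the spaces: an element is given by its
(mutually compatible) images in all the `X k`. -/
def Limit (V : BanachTower.{u, w} 𝕜) : Submodule 𝕜 (∀ k, V.X k) where
  carrier := {x | ∀ k, V.incl k (x (k + 1)) = x k}
  add_mem' := by
    intro x y hx hy k
    simp only [Pi.add_apply, map_add, hx k, hy k]
  zero_mem' := by
    intro k
    simp
  smul_mem' := by
    intro c x hx k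
    simp only [Pi.smul_apply, map_smul, hx k]

/-- The inclusion `V_∞ ⊂ X k`; the norms `‖V.proj k v‖` are the norms on `V_∞`. -/
def proj (V : BanachTower.{u, w} 𝕜) (k : ℕ) : V.Limit →ₗ[𝕜] V.X k :=
  (LinearMap.proj k).comp V.Limit.subtype

/-- The composed inclusion `X (k + m) ⊂ X k`. -/
noncomputable def inclAdd (V : BanachTower.{u, w} 𝕜) (k : ℕ) : ∀ m, V.X (k + m) →L[𝕜] V.X k
  | 0 => ContinuousLinearMap.id 𝕜 (V.X k)
  | m + 1 => (inclAdd V k m).comp (V.incl (k + m))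

end BanachTower

/-- A nested sequence of Banach spaces: the intersection is dense in every space. -/
structure NestedBanach (𝕜 : Type u) [RCLike 𝕜] extends BanachTower.{u, w} 𝕜 where
  dense : ∀ k, DenseRange (toBanachTower.proj k)

/-- Iterated compactness of a bounded multilinear map: `lam` lies in the image of
`K(E, K(E, ⋯ K(E, F)))` in the space of bounded `n`-linear maps. -/
def IsCompactMultilinear {𝕜 : Type u} [RCLike 𝕜] {E F : Type w}
    [NormedAddCommGroup E] [NormedSpace 𝕜 E] [NormedAddCommGroup F] [NormedSpace 𝕜 F] :
    ∀ n : ℕ, ContinuousMultilinearMap 𝕜 (fun _ : Fin n => E) F → Prop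
  | 0, _ => True
  | n + 1, lam => IsCompactOperator (fun x : E => lam.curryLeft x) ∧
      ∀ x : E, IsCompactMultilinear n (lam.curryLeft x)

/-- A real function on `I` grows at most polynomially. -/
def GrowsAtMostPolynomially (I : Set ℝ) (φ : ℝ → ℝ) : Prop :=
  ∃ C r : ℝ, 0 < C ∧ 0 < r ∧ ∀ t ∈ I, |φ t| ≤ C * (1 + |t| ^ r)

namespace NestedBanach

variable {𝕜 : Type u} [RCLike 𝕜]

/-- Every space of the sequence is included by a compact map of a later one. -/
def CompactlyNested (V : NestedBanach.{u, w} 𝕜) : Prop :=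
  ∀ l, ∃ m, IsCompactOperator (V.inclAdd l m)

/-- Two nested sequences are comparable, where `Φ` is the identification of the two
intersections: `V_{l₁} ⊂ W_k ⊂ V_{l₂}` and `W_{l₃} ⊂ V_k ⊂ W_{l₄}` with bounded inclusions. -/
def Comparable (V W : NestedBanach.{u, w} 𝕜) (Φ : V.Limit ≃ₗ[𝕜] W.Limit) : Prop :=
  ∀ k,
    (∃ l, ∃ T : V.X l →L[𝕜] W.X k, Function.Injective T ∧
      ∀ v, T (V.proj l v) = W.proj k (Φ v)) ∧
    (∃ l, ∃ T : W.X k →L[𝕜] V.X l, Function.Injective T ∧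
      ∀ v, T (W.proj k (Φ v)) = V.proj l v) ∧
    (∃ l, ∃ T : W.X l →L[𝕜] V.X k, Function.Injective T ∧
      ∀ v, T (W.proj l (Φ v)) = V.proj k v) ∧
    (∃ l, ∃ T : V.X k →L[𝕜] W.X l, Function.Injective T ∧
      ∀ v, T (V.proj k v) = W.proj l (Φ v))

variable (V : NestedBanach.{u, w} 𝕜)

/-- Bounded operators on `V_∞`. -/
def IsBoundedOp (A : V.Limit →ₗ[𝕜] V.Limit) : Prop :=
  ∀ l, ∃ k, ∃ T : V.X k →L[𝕜] V.X l, ∀ v, T (V.proj k v) = V.proj l (A v)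

/-- Infinitely differentiable maps `I × V_∞ → V_∞`: for all `n` and `l` there is a `k` such that
the map extends to an `n` times differentiable map `I × V_k → V_l`; derivatives in the space
variable are derivatives over `𝕜`. -/
def SmoothMap (I : Set ℝ) (φ : ℝ → V.Limit → V.Limit) : Prop :=
  ∀ n l : ℕ, ∃ k, ∃ g : ℝ → V.X k → V.X l,
    (∀ t ∈ I, ∀ v, g t (V.proj k v) = V.proj l (φ t v)) ∧
    ContDiffOn ℝ n (fun z : ℝ × V.X k => g z.1 z.2) (I ×ˢ univ) ∧
    ∀ t ∈ I, ContDiff 𝕜 n (g t)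

/-- Smooth curves `I → V_∞`. -/
def SmoothCurve (I : Set ℝ) (x : ℝ → V.Limit) : Prop :=
  ∀ k, ContDiffOn ℝ ∞ (fun t => V.proj k (x t)) I

/-- `φ = O(n)`, for maps `I × V_∞ → V_∞`. -/
def IsOrder (I : Set ℝ) (n : ℕ) (φ : ℝ → V.Limit → V.Limit) : Prop :=
  ∀ l, ∃ k, ∀ K ⊆ I, IsCompact K → ∃ C δ : ℝ, 0 < δ ∧ ∀ t ∈ K, ∀ v,
    ‖V.proj k v‖ < δ → ‖V.proj l (φ t v)‖ ≤ C * ‖V.proj k v‖ ^ n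

/-- For every `l` there is a `k` such that `φ` is differentiable in the space variable as a map
from `V_k` to `V_l`, with derivative at `v` of size `O(‖v‖)` in `B(V_k, V_l)`, uniformly in
time on compact subsets of `I`. -/
def DerivIsOrderOne (I : Set ℝ) (φ : ℝ → V.Limit → V.Limit) : Prop :=
  ∀ l, ∃ k, ∃ g : ℝ → V.X k → V.X l,
    (∀ t ∈ I, ∀ v, g t (V.proj k v) = V.proj l (φ t v)) ∧
    (∀ t ∈ I, Differentiable 𝕜 (g t)) ∧
    ∀ K ⊆ I, IsCompact K → ∃ C δ : ℝ, 0 < δ ∧ ∀ t ∈ K, ∀ x,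
      ‖x‖ < δ → ‖fderiv 𝕜 (g t) x‖ ≤ C * ‖x‖

/-- Polynomial growth: at every `v`, all derivatives of `φ` in the time and space directions
grow at most polynomially in time, in every norm. The inner derivative is the `n`-th
derivative of `φ τ` at `v`, evaluated on `(h, …, h)`. -/
def HasPolynomialGrowth (I : Set ℝ) (φ : ℝ → V.Limit → V.Limit) : Prop :=
  ∀ (v h : V.Limit) (k l n : ℕ), GrowsAtMostPolynomially I fun t =>
    ‖iteratedDeriv l
      (fun τ : ℝ => iteratedDeriv n (fun s : 𝕜 => V.proj k (φ τ (v + s • h))) 0) t‖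

/-- Compact homogeneous polynomials of degree `n` on `V_∞`. -/
def IsCompactHomPoly (n : ℕ) (P : V.Limit → V.Limit) : Prop :=
  ∀ l, ∃ k, ∃ lam : ContinuousMultilinearMap 𝕜 (fun _ : Fin n => V.X k) (V.X l),
    IsCompactMultilinear n lam ∧ ∀ v, lam (fun _ => V.proj k v) = V.proj l (P v)

/-- Compact polynomials on `V_∞` of degree at most `d` (and without constant term). -/
def IsCompactPoly (d : ℕ) (P : V.Limit → V.Limit) : Prop :=
  ∃ Q : ℕ → V.Limit → V.Limit,
    (∀ n ∈ Finset.Icc 1 d, V.IsCompactHomPoly n (Q n)) ∧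
    ∀ v, P v = ∑ n ∈ Finset.Icc 1 d, Q n v

/-- `ψ` is a near-identity at `0`: extended to maps `V_{l+m} → V_l`, it has a continuous
derivative near `0`, and `ψ'(0) h = h + o(h)`. -/
def IsNearIdentity (ψ : V.Limit → V.Limit) : Prop :=
  ∀ l, ∃ m, ∃ g : V.X (l + m) → V.X l,
    (∀ v, g (V.proj (l + m) v) = V.proj l (ψ v)) ∧
    (∃ U ∈ 𝓝 (0 : V.X (l + m)), (∀ x ∈ U, DifferentiableAt 𝕜 g x) ∧
      ContinuousOn (fderiv 𝕜 g) U) ∧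
    (fun h => fderiv 𝕜 g 0 h - V.inclAdd l m h) =o[𝓝 0] fun h : V.X (l + m) => h

/-- `x` is a smooth solution on `I` of `x'(t) = A x(t) + G(t)`. -/
def IsSolution (I : Set ℝ) (A : V.Limit →ₗ[𝕜] V.Limit) (G x : ℝ → V.Limit) : Prop :=
  V.SmoothCurve I x ∧
    ∀ t ∈ I, ∀ k, HasDerivAt (fun s => V.proj k (x s)) (V.proj k (A (x t) + G t)) t

/-- Convergence of `S N` to `F` in `Pol(V_∞)`, differentiably in time, for polynomials of
bounded degree: for every time derivative and every `l` there is a `k` with convergence in the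
(equivalent) norm `sup_{‖v‖_k ≤ 1} ‖p(v)‖_l` of `Pol(V_k, V_l)`, uniformly in time on compact
subsets of `I`. -/
def PolTendsto (I : Set ℝ) (S : ℕ → ℝ → V.Limit → V.Limit) (F : ℝ → V.Limit → V.Limit) :
    Prop :=
  (∀ N v, V.SmoothCurve I fun t => S N t v) ∧ (∀ v, V.SmoothCurve I fun t => F t v) ∧
  ∀ m l : ℕ, ∃ k, ∀ K ⊆ I, IsCompact K → ∀ ε : ℝ, 0 < ε → ∃ N₀, ∀ N ≥ N₀,
    ∀ t ∈ K, ∀ v, ‖V.proj k v‖ ≤ 1 →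
      ‖iteratedDeriv m (fun τ => V.proj l (S N τ v - F τ v)) t‖ ≤ ε

section Coordinates

variable {H : Type w} [NormedAddCommGroup H] [InnerProductSpace 𝕜 H]
  (iso : V.X 0 ≃ₗᵢ[𝕜] H) (e : ℕ → V.Limit)

/-- The monomial `v ^ q = ∏ⱼ (eⱼ, v) ^ qⱼ`, with the inner product of the first space. -/
noncomputable def monomial (q : ℕ →₀ ℕ) (v : V.Limit) : 𝕜 :=
  q.prod fun j m => inner 𝕜 (iso (V.proj 0 (e j))) (iso (V.proj 0 v)) ^ m

/-- The closure in the first space of the span of the `eⱼ`, for `j ∈ J`. -/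
noncomputable def spanClosure (J : Set ℕ) : Submodule 𝕜 (V.X 0) :=
  (Submodule.span 𝕜 ((fun j => V.proj 0 (e j)) '' J)).topologicalClosure

open Classical in
/-- `Fa` takes values in `V_J`, and is the sum of a series `∑ G^q(t) v^q` over all
multi-indices `q` with `|q| ≤ p` and `cond q`, with smooth coefficients `G^q : I → V_∞`,
which converges in `Pol(V_∞)`, differentiably in time. The partial sums are those over the `q`
that involve only the first `N` coordinates. -/
def IsComponentSeries (I : Set ℝ) (p : ℕ) (J : Set ℕ) (cond : (ℕ →₀ ℕ) → Prop)
    (Fa : ℝ → V.Limit → V.Limit) : Prop :=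
  (∀ t ∈ I, ∀ v, V.proj 0 (Fa t v) ∈ V.spanClosure e J) ∧
  ∃ G : (ℕ →₀ ℕ) → ℝ → V.Limit, (∀ q, V.SmoothCurve I (G q)) ∧
    V.PolTendsto I
      (fun N t v => ∑ n ∈ Finset.range (p + 1),
        ∑ q ∈ ((Finset.range N).finsuppAntidiag n).filter cond, V.monomial iso e q v • G q t)
      Fa

end Coordinates

end NestedBanach

section Spectrum

variable {𝕜 : Type u} [RCLike 𝕜]

/-- Indices of central eigenvalues. -/
def centralIdx (ev : ℕ → 𝕜) (α : ℝ) : Set ℕ := {j | |RCLike.re (ev j)| ≤ α}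

/-- Indices of stable eigenvalues (there are none if `β = ∞`). -/
def stableIdx (ev : ℕ → 𝕜) (β : EReal) : Set ℕ := {j | ((RCLike.re (ev j) : ℝ) : EReal) ≤ -β}

/-- Indices of unstable eigenvalues (there are none if `γ = ∞`). -/
def unstableIdx (ev : ℕ → 𝕜) (γ : EReal) : Set ℕ := {j | γ ≤ ((RCLike.re (ev j) : ℝ) : EReal)}

/-- The part of the multi-index `q` supported in `J` is nonzero. -/
def Meets (q : ℕ →₀ ℕ) (J : Set ℕ) : Prop := ∃ j ∈ J, q j ≠ 0

/-- The exponent `μ^q_j = ∑ᵢ qᵢ αᵢ - αⱼ`. -/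
noncomputable def muExp (ev : ℕ → 𝕜) (q : ℕ →₀ ℕ) (j : ℕ) : 𝕜 :=
  (q.sum fun i m => (m : 𝕜) * ev i) - ev j

/-- The set `J^q` of the indices `j` such that the `j`-th component of the `q`-th coefficient
is to be removed from the normal form. -/
def removedIdx (ev : ℕ → 𝕜) (α : ℝ) (β γ : EReal) (q : ℕ →₀ ℕ) : Set ℕ :=
  {j | (j ∈ centralIdx ev α ∧
          ((¬ Meets q (stableIdx ev β) ∧ Meets q (unstableIdx ev γ)) ∨
           (¬ Meets q (unstableIdx ev γ) ∧ Meets q (stableIdx ev β)))) ∨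
       (j ∈ stableIdx ev β ∧ ¬ Meets q (stableIdx ev β)) ∨
       (j ∈ unstableIdx ev γ ∧ ¬ Meets q (unstableIdx ev γ))}

/-- The integral `∫_{inf I}^t e^{-μ(t-τ)} u(τ) dτ` if `Re μ > 0`, and
`-∫_t^{sup I} e^{-μ(t-τ)} u(τ) dτ` otherwise. After the substitution `s = |t - τ|` the exponential
becomes `e^{-μ s}`, respectively `e^{μ s}`. -/
noncomputable def muIntegral (I : Set ℝ) (μ : 𝕜) (u : ℝ → 𝕜) (t : ℝ) : 𝕜 :=
  open Classical in
  if 0 < RCLike.re μ then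
    ∫ τ in I ∩ Iic t, NormedSpace.exp (-(μ * ((t - τ : ℝ) : 𝕜))) * u τ
  else
    -∫ τ in I ∩ Ici t, NormedSpace.exp (-(μ * ((t - τ : ℝ) : 𝕜))) * u τ

/-- The integrals `muIntegral I μ u t` are `μt`-regular: the decay rate `|Re μ|` of the exponential
is larger than `μt`, and the function `u` grows at most polynomially. -/
def IsRegularIntegral (I : Set ℝ) (μt : ℝ) (μ : 𝕜) (u : ℝ → 𝕜) : Prop :=
  μt < |RCLike.re μ| ∧ GrowsAtMostPolynomially I fun t => ‖u t‖

open Classical in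
/-- The coefficient `ξ^q_j` of the update of the coordinate transform. -/
noncomputable def xiCoeff (ev : ℕ → 𝕜) (α : ℝ) (β γ : EReal) (I : Set ℝ)
    (a : (ℕ →₀ ℕ) → ℕ → ℝ → 𝕜) (q : ℕ →₀ ℕ) (j : ℕ) (t : ℝ) : 𝕜 :=
  if j ∈ removedIdx ev α β γ q then muIntegral I (muExp ev q j) (a q j) t else 0

open Classical in
/-- The coefficient `F^q_j` of the update of the normal form. -/
noncomputable def formCoeff (ev : ℕ → 𝕜) (α : ℝ) (β γ : EReal)
    (a : (ℕ →₀ ℕ) → ℕ → ℝ → 𝕜) (q : ℕ →₀ ℕ) (j : ℕ) (t : ℝ) : 𝕜 :=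
  if j ∈ removedIdx ev α β γ q then 0 else a q j t

end Spectrum

namespace NestedBanach

variable {𝕜 : Type u} [RCLike 𝕜] (V : NestedBanach.{u, w} 𝕜)
  {H : Type w} [NormedAddCommGroup H] [InnerProductSpace 𝕜 H]
  (iso : V.X 0 ≃ₗᵢ[𝕜] H) (e : ℕ → V.Limit)

/-- `F` separates invariant subspaces: its central, stable and unstable components are sums of
series in the monomials `v^q`, `|q| ≤ p`, where respectively: `q^s` and `q^u` are both zero or both
nonzero; `q^s ≠ 0`; `q^u ≠ 0`. -/
def SeparatesInvariantSubspaces (ev : ℕ → 𝕜) (α : ℝ) (β γ : EReal) (I : Set ℝ) (p : ℕ)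
    (F : ℝ → V.Limit → V.Limit) : Prop :=
  ∃ Fc Fs Fu : ℝ → V.Limit → V.Limit,
    (∀ t ∈ I, ∀ v, F t v = Fc t v + Fs t v + Fu t v) ∧
    V.IsComponentSeries iso e I p (centralIdx ev α)
      (fun q => (¬ Meets q (stableIdx ev β) ∧ ¬ Meets q (unstableIdx ev γ)) ∨
        (Meets q (stableIdx ev β) ∧ Meets q (unstableIdx ev γ))) Fc ∧
    V.IsComponentSeries iso e I p (stableIdx ev β) (fun q => Meets q (stableIdx ev β)) Fs ∧
    V.IsComponentSeries iso e I p (unstableIdx ev γ) (fun q => Meets q (unstableIdx ev γ)) Fu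

/-- Partial sums of `∑_{|q| = n} ∑ⱼ c^q_j(t) v^q eⱼ`, over the `q` and `j` that involve only the
first `N` coordinates. -/
noncomputable def coeffPartialSum (n : ℕ) (c : (ℕ →₀ ℕ) → ℕ → ℝ → 𝕜) (N : ℕ) (t : ℝ)
    (v : V.Limit) : V.Limit :=
  ∑ q ∈ (Finset.range N).finsuppAntidiag n, ∑ j ∈ Finset.range N,
    (c q j t * V.monomial iso e q v) • e j

/-- `R` is the residual of the coordinate transform `ξ` and the system `X' = A X + F(t, X)`:
`R = ∂ₜξ + ξ'_V ∘ (A + F) - A ∘ ξ - f ∘ ξ`. The first two terms are the derivative of `ξ` at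
`(t, v)` in the direction `(1, A v + F(t, v))`. -/
def IsResidual (I : Set ℝ) (A : V.Limit →ₗ[𝕜] V.Limit) (f ξ F R : ℝ → V.Limit → V.Limit) :
    Prop :=
  ∀ t ∈ I, ∀ v, ∀ k,
    HasDerivAt (fun s : ℝ => V.proj k (ξ (t + s) (v + (s : 𝕜) • (A v + F t v))))
      (V.proj k (A (ξ t v) + f t (ξ t v) + R t v)) 0

/-- The triple `(ξ, F, R)` arises from a construction in which all integrals are `μt`-regular.
The construction starts from `Ξ 2 = id` and `Φ 2 = 0`. Let `P n` be the residual of `Ξ n` and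
`Φ n`, and let `-a^q_j`, `|q| = n`, be the coefficients of its part `-T n` of degree `n`.
If `j ∈ J^q`, the term `v^q eⱼ` is removed from the system by adding to `Ξ n` that term with
coefficient `muIntegral I μ^q_j a^q_j`, which is a `μt`-regular integral. If `j ∉ J^q`, the term
`a^q_j v^q eⱼ` is added to `Φ n`. After `p - 2` steps this ends in `(ξ, F, R)`. -/
def ConstructedByRegularIntegrals (ev : ℕ → 𝕜) (α : ℝ) (β γ : EReal) (μt : ℝ) (I : Set ℝ)
    (A : V.Limit →ₗ[𝕜] V.Limit) (f : ℝ → V.Limit → V.Limit) (p : ℕ)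
    (ξ F R : ℝ → V.Limit → V.Limit) : Prop :=
  ∃ (Ξ Φ P T : ℕ → ℝ → V.Limit → V.Limit) (a : (ℕ →₀ ℕ) → ℕ → ℝ → 𝕜),
    (∀ t ∈ I, ∀ v, Ξ 2 t v = v ∧ Φ 2 t v = 0) ∧
    (∀ t ∈ I, ∀ v, Ξ p t v = ξ t v ∧ Φ p t v = F t v ∧ P p t v = R t v) ∧
    (∀ n, 2 ≤ n → n ≤ p → V.IsResidual I A f (Ξ n) (Φ n) (P n)) ∧
    ∀ n, 2 ≤ n → n < p →
      V.PolTendsto I (V.coeffPartialSum iso e n a) (T n) ∧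
      V.IsOrder I (n + 1) (fun t v => P n t v + T n t v) ∧
      (∀ q : ℕ →₀ ℕ, q.degree = n → ∀ j,
        ContDiffOn ℝ ∞ (a q j) I ∧
        (∀ m, GrowsAtMostPolynomially I fun t => ‖iteratedDeriv m (a q j) t‖) ∧
        (j ∈ removedIdx ev α β γ q → IsRegularIntegral I μt (muExp ev q j) (a q j))) ∧
      V.PolTendsto I (V.coeffPartialSum iso e n (xiCoeff ev α β γ I a))
        (fun t v => Ξ (n + 1) t v - Ξ n t v) ∧
      V.PolTendsto I (V.coeffPartialSum iso e n (formCoeff ev α β γ a))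
        (fun t v => Φ (n + 1) t v - Φ n t v)

end NestedBanach

/-!
The normal form is built degree by degree. Let the transform be `id + ∑ Xₙ` and the normal form
`∑ Yₙ`, with time-dependent multilinear maps `Xₙ`, `Yₙ` on `V_∞` for `2 ≤ n < N`, and let the residual
(`residual`) be of order `N`, with homogeneous part `-T` of degree `N`. Adding `X` and `Y` of degree
`N` cancels this part, and makes the residual be of order `N + 1` (`isOrder_residual_succ`), if they
solve the homological equation

  `∂ₜX + X'A - AX + Y = T`.

In the basis of eigenvectors it reads `∂ₜX^q_j + μ^q_j X^q_j + Y^q_j = T^q_j`. The entries that the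
normal form may keep go to `Y`; for the others `Y^q_j = 0`, and `X^q_j` is the integral `muIntegral`
of `T^q_j`, which solves the equation (`hasDerivAt_muIntegral`) and is regular by the gap condition
(`IsSpectralClass.lt_abs_re_muExp`). Two things have to be shown: that `T` is regular enough for these
integrals, and that the integrated entries are those of a bounded multilinear map.

*Regularity.* A multilinear family is called tame (`TameMult`) if it is smooth in time and all its
time derivatives are bounded, with norms that grow at most polynomially. The Taylor coefficients of
`f` at `0` are tame: the growth condition on `f` gives bounds along each line, with constants that
depend on the line, and the Baire category theorem in the Fréchet space `V_∞`, combined with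
polarization, makes them uniform (`exists_uniform_bound`, `tameMult_of_diag`,
`HasPolynomialGrowth.tameMult_taylorMult`). Tame families are closed under composition, so up to
higher order the residual is a polynomial with tame coefficients along each line
(`exists_tamePoly_residual`), and by the same principle `T` is tame
(`SmoothMap.tameMult_taylorMult`).

*Boundedness.* Because the eigenvectors are orthogonal in a comparable sequence of Hilbert spaces,
diagonal operators are bounded on the scale by the supremum of their entries, and because of the
compact inclusions the expansions in eigenvectors converge in operator norm (`isDiagonalBasis`). A
matrix defines a tame multilinear map as soon as its finite truncations are bounded uniformly
(`IsDiagonalBasis.exists_tameMult`). To bound the truncations of the integrals, split the matrix into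
blocks according to the spectral classes of the indices. The kernel
`exp (-(∑ a, αᵢₐ - αⱼ) (t - τ))` factors into exponentials of single eigenvalues, that is, into diagonal
operators before and after `T`. On a block to be removed, the product of their norms decays
exponentially (`IsSpectralClass.exists_exponents`), so the integral of the composition is bounded by
a convolution of an exponential with a power (`IsDiagonalBasis.tameBound_muIntegral`). Time
derivatives are controlled by the differential equation itself
(`IsDiagonalBasis.matrixTame_muIntegral`). This solves the homological equation
(`IsDiagonalBasis.exists_homological`), and the steps can be iterated
(`IsDiagonalBasis.exists_isStep`).

The remaining assertions follow from the form of the solution. The entries that are kept preserve the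
spectral subspaces (`separatesInvariantSubspaces`), the coefficients in the monomials are sums of
matrix elements over tuples of indices (`constructedByRegularIntegrals`), bounded polynomials are
compact because they factor through compact inclusions (`CompactlyNested.isCompactHomPoly`), and the
residual is the defect of the transform along a solution (`hasDerivAt_id_add_polySum`).
-/

/-! ### Nested sequences of Banach spaces -/

namespace BanachTower

variable {𝕜 : Type u} [RCLike 𝕜] (V : BanachTower.{u, w} 𝕜)

instance isScalarTower (k : ℕ) : IsScalarTower ℝ 𝕜 (V.X k) where
  smul_assoc r c x := by
    change (r • c) • x = (algebraMap ℝ 𝕜) r • c • x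
    rw [smul_smul, Algebra.smul_def]

theorem incl_proj (k : ℕ) (v : V.Limit) : V.incl k (V.proj (k + 1) v) = V.proj k v :=
  v.2 k

theorem ext_proj {v w : V.Limit} (h : ∀ k, V.proj k v = V.proj k w) : v = w :=
  Subtype.ext (funext h)

/-- The inclusions are injective, so an element of `V_∞` is determined by any one of its
components. -/
theorem proj_injective (k : ℕ) : Function.Injective (V.proj k) := by
  induction k with
  | zero =>
    intro v w h
    refine V.ext_proj fun k => ?_
    induction k with
    | zero => exact h
    | succ k ih =>
      refine V.incl_injective k ?_
      rw [incl_proj, incl_proj, ih]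
  | succ k ih =>
    intro v w h
    refine ih ?_
    rw [← V.incl_proj k v, ← V.incl_proj k w, h]

theorem inclAdd_proj (k m : ℕ) (v : V.Limit) :
    V.inclAdd k m (V.proj (k + m) v) = V.proj k v := by
  induction m with
  | zero => rfl
  | succ m ih => exact (congrArg _ (V.incl_proj (k + m) v)).trans ih

theorem exists_inclusion {k K : ℕ} (h : k ≤ K) :
    ∃ T : V.X K →L[𝕜] V.X k, ∀ v, T (V.proj K v) = V.proj k v := by
  obtain ⟨m, rfl⟩ := Nat.exists_eq_add_of_le h
  exact ⟨V.inclAdd k m, V.inclAdd_proj k m⟩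

/-- The bounded inclusion `X K ⊂ X k`, for `k ≤ K`. -/
noncomputable def inclOfLE {k K : ℕ} (h : k ≤ K) : V.X K →L[𝕜] V.X k :=
  (V.exists_inclusion h).choose

@[simp]
theorem inclOfLE_proj {k K : ℕ} (h : k ≤ K) (v : V.Limit) :
    V.inclOfLE h (V.proj K v) = V.proj k v :=
  (V.exists_inclusion h).choose_spec v

/-- A constant for the inequality `‖v‖ₖ ≤ C ‖v‖_K`, with `k ≤ K`. -/
theorem exists_norm_proj_le {k K : ℕ} (h : k ≤ K) :
    ∃ C : ℝ, 1 ≤ C ∧ ∀ v, ‖V.proj k v‖ ≤ C * ‖V.proj K v‖ := by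
  refine ⟨max 1 ‖V.inclOfLE h‖, le_max_left _ _, fun v => ?_⟩
  rw [← V.inclOfLE_proj h v]
  exact ((V.inclOfLE h).le_opNorm _).trans
    (mul_le_mul_of_nonneg_right (le_max_right _ _) (norm_nonneg _))

theorem continuous_proj (k : ℕ) : Continuous (V.proj k) :=
  (continuous_apply k).comp continuous_subtype_val

/-- The space `V_∞` is closed in the product of all the spaces, so it is a complete metrizable
space for the topology given by all the norms. -/
theorem isClosed_limit : IsClosed (V.Limit : Set (∀ k, V.X k)) := by
  have : (V.Limit : Set (∀ k, V.X k)) = ⋂ k, {x | V.incl k (x (k + 1)) = x k} := by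
    ext x
    simp only [mem_iInter]
    rfl
  rw [this]
  exact isClosed_iInter fun k => isClosed_eq
    ((V.incl k).continuous.comp (continuous_apply _)) (continuous_apply _)

/-- A sequence in `V_∞` that converges in every one of the spaces has a limit in `V_∞`. -/
theorem exists_limit_of_cauchySeq (x : ℕ → V.Limit)
    (hx : ∀ k, CauchySeq fun N => V.proj k (x N)) :
    ∃ v : V.Limit, ∀ k, Tendsto (fun N => V.proj k (x N)) atTop (𝓝 (V.proj k v)) := by
  choose y hy using fun k => cauchySeq_tendsto_of_complete (hx k)
  refine ⟨⟨y, fun k => ?_⟩, hy⟩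
  refine tendsto_nhds_unique (((V.incl k).continuous.tendsto _).comp (hy (k + 1))) ?_
  simpa only [Function.comp_def, incl_proj] using hy k

/-- Neighbourhoods of a point of `V_∞` contain balls for one of the norms. -/
theorem exists_ball_subset {U : Set V.Limit} {v : V.Limit} (hU : U ∈ 𝓝 v) :
    ∃ k, ∃ ε > 0, ∀ w, ‖V.proj k (w - v)‖ ≤ ε → w ∈ U := by
  rw [nhds_subtype_eq_comap, mem_comap] at hU
  obtain ⟨S, hS, hSU⟩ := hU
  rw [nhds_pi, Filter.mem_pi] at hS
  obtain ⟨F, hF, s, hs, hsS⟩ := hS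
  choose r hr hrs using fun k => Metric.mem_nhds_iff.1 (hs k)
  obtain ⟨K, hK⟩ := hF.bddAbove
  choose C hC1 hC using fun k : Iic K => V.exists_norm_proj_le (k := k) (K := K) k.2
  obtain ⟨ε, hε, hεr⟩ : ∃ ε > 0, ∀ k : Iic K, C k * ε < r k := by
    have h : ∀ k : Iic K, ∃ ε > 0, C k * ε < r k := fun k =>
      ⟨r k / (2 * C k), by have := hr k; have := hC1 k; positivity, by
        have h1 := hr k
        have h2 : 0 < C k := by linarith [hC1 k]
        field_simp
        linarith⟩
    choose δ hδ hδr using h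
    have hne : (Finset.univ : Finset (Iic K)).Nonempty := ⟨⟨K, le_refl K⟩, Finset.mem_univ _⟩
    refine ⟨Finset.univ.inf' hne δ, (Finset.lt_inf'_iff _).2 fun k _ => hδ k, fun k => ?_⟩
    refine lt_of_le_of_lt (mul_le_mul_of_nonneg_left (Finset.inf'_le _ (Finset.mem_univ k)) ?_)
      (hδr k)
    linarith [hC1 k]
  refine ⟨K, ε, hε, fun w hw => hSU (hsS fun k hk => hrs k ?_)⟩
  have hkK : k ≤ K := hK hk
  rw [Metric.mem_ball, dist_eq_norm]
  calc ‖(w : ∀ k, V.X k) k - (v : ∀ k, V.X k) k‖ = ‖V.proj k (w - v)‖ := rfl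
    _ ≤ C ⟨k, hkK⟩ * ‖V.proj K (w - v)‖ := hC ⟨k, hkK⟩ _
    _ ≤ C ⟨k, hkK⟩ * ε := mul_le_mul_of_nonneg_left hw (by linarith [hC1 ⟨k, hkK⟩])
    _ < r k := hεr ⟨k, hkK⟩

end BanachTower

namespace NestedBanach

variable {𝕜 : Type u} [RCLike 𝕜] (V : NestedBanach.{u, w} 𝕜)

theorem denseRange_proj_pi (k : ℕ) (ι : Type*) :
    DenseRange fun (x : ι → V.Limit) a => V.proj k (x a) :=
  DenseRange.piMap fun _ => V.dense k

/-- `n`-linear maps on `V_∞`. -/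
abbrev Mult (n : ℕ) := MultilinearMap 𝕜 (fun _ : Fin n => V.Limit) V.Limit

/-- A product of norms of the arguments of a multilinear map can be estimated in a stronger
norm. -/
theorem exists_prod_norm_le {k K : ℕ} (h : k ≤ K) (n : ℕ) :
    ∃ C : ℝ, 1 ≤ C ∧ ∀ x : Fin n → V.Limit,
      ∏ a, ‖V.proj k (x a)‖ ≤ C * ∏ a, ‖V.proj K (x a)‖ := by
  obtain ⟨C, hC1, hC⟩ := V.exists_norm_proj_le h
  refine ⟨C ^ n, one_le_pow₀ hC1, fun x => ?_⟩
  calc ∏ a, ‖V.proj k (x a)‖ ≤ ∏ a, C * ‖V.proj K (x a)‖ :=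
        Finset.prod_le_prod (fun _ _ => norm_nonneg _) fun a _ => hC _
    _ = C ^ n * ∏ a, ‖V.proj K (x a)‖ := by
        rw [Finset.prod_mul_distrib, Finset.prod_const, Finset.card_univ, Fintype.card_fin]

/-- Bounded multilinear maps that agree on `V_∞` are equal, by density. -/
theorem cmm_ext {F : Type*} [NormedAddCommGroup F] [NormedSpace 𝕜 F] {k n : ℕ}
    {Λ Λ' : ContinuousMultilinearMap 𝕜 (fun _ : Fin n => V.X k) F}
    (h : ∀ x : Fin n → V.Limit, Λ (fun a => V.proj k (x a)) = Λ' fun a => V.proj k (x a)) :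
    Λ = Λ' := by
  have := (V.denseRange_proj_pi k (Fin n)).equalizer Λ.cont Λ'.cont (funext h)
  exact ContinuousMultilinearMap.ext fun x => congrFun this x

/-- A multilinear map on `V_∞` that is bounded in the norm of `X k` extends to `X k`, with the same
bound: curry the first argument, and extend the linear map with values in the multilinear maps of
one argument less. -/
theorem exists_extension (k : ℕ) : ∀ {n : ℕ} {F : Type w} [NormedAddCommGroup F]
    [NormedSpace 𝕜 F] [CompleteSpace F]
    (M : MultilinearMap 𝕜 (fun _ : Fin n => V.Limit) F) {C : ℝ} (_ : 0 ≤ C)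
    (_ : ∀ x, ‖M x‖ ≤ C * ∏ a, ‖V.proj k (x a)‖),
    ∃ Λ : ContinuousMultilinearMap 𝕜 (fun _ : Fin n => V.X k) F,
      (∀ x, Λ (fun a => V.proj k (x a)) = M x) ∧ ‖Λ‖ ≤ C := by
  intro n
  induction n with
  | zero =>
    intro F _ _ _ M C hC hM
    refine ⟨ContinuousMultilinearMap.constOfIsEmpty 𝕜 _ (M 0), fun x => ?_, ?_⟩
    · rw [Subsingleton.elim x 0]
      rfl
    · rw [ContinuousMultilinearMap.norm_constOfIsEmpty]
      simpa using hM 0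
  | succ n ih =>
    intro F _ _ _ M C hC hM
    have h (v : V.Limit) := ih (M.curryLeft v) (C := C * ‖V.proj k v‖) (by positivity)
      fun x => by
        have := hM (Fin.cons v x)
        rw [Fin.prod_univ_succ] at this
        simpa [mul_assoc] using this
    choose L hL hLn using h
    let f : V.Limit →ₗ[𝕜] ContinuousMultilinearMap 𝕜 (fun _ : Fin n => V.X k) F :=
      { toFun := L
        map_add' := fun v w => V.cmm_ext fun x => by simp [hL]
        map_smul' := fun c v => V.cmm_ext fun x => by simp [hL] }
    have hb : ∃ C, ∀ v, ‖f v‖ ≤ C * ‖V.proj k v‖ := ⟨C, hLn⟩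
    refine ⟨(f.extendOfNorm (V.proj k)).uncurryLeft, fun x => ?_, ?_⟩
    · rw [ContinuousLinearMap.uncurryLeft_apply, LinearMap.extendOfNorm_eq (V.dense k) hb]
      change L (x 0) _ = _
      have := hL (x 0) (Fin.tail x)
      simp only [MultilinearMap.curryLeft_apply, Fin.cons_self_tail] at this
      exact this
    · rw [ContinuousLinearMap.uncurryLeft_norm]
      exact ContinuousLinearMap.opNorm_le_bound _ hC fun v =>
        LinearMap.norm_extendOfNorm_apply_le (V.dense k) C hLn v

end NestedBanach

/-! ### Families of curves with tame growth -/

/-- A sequence of weights on a set of parameters, increasing up to constants. It plays the role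
of the sequence of norms for families of curves. -/
def IsWeight {Ω : Type*} (ρ : ℕ → Ω → ℝ) : Prop :=
  (∀ k y, 0 ≤ ρ k y) ∧ ∀ k K, k ≤ K → ∃ C : ℝ, 1 ≤ C ∧ ∀ y, ρ k y ≤ C * ρ K y

theorem isWeight_one {Ω : Type*} : IsWeight fun (_ : ℕ) (_ : Ω) => (1 : ℝ) :=
  ⟨fun _ _ => zero_le_one, fun _ _ _ => ⟨1, le_rfl, fun _ => by simp⟩⟩

namespace NestedBanach

variable {𝕜 : Type u} [RCLike 𝕜] (V : NestedBanach.{u, w} 𝕜) (I : Set ℝ) {Ω : Type*}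

theorem isWeight_prod (n : ℕ) :
    IsWeight fun (k : ℕ) (x : Fin n → V.Limit) => ∏ a, ‖V.proj k (x a)‖ :=
  ⟨fun _ _ => Finset.prod_nonneg fun _ _ => norm_nonneg _, fun _ _ h => V.exists_prod_norm_le h n⟩

/-- A family of curves in `V_∞`, with parameters in `Ω`, that grows at most polynomially in
time, uniformly with respect to the weights `ρ`. -/
def TameBound (ρ : ℕ → Ω → ℝ) (c : Ω → ℝ → V.Limit) : Prop :=
  ∀ l, ∃ k r : ℕ, ∃ C : ℝ, 0 ≤ C ∧ ∀ y, ∀ t ∈ I, ‖V.proj l (c y t)‖ ≤ C * (1 + |t|) ^ r * ρ k y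

/-- A family of curves in `V_∞` that is `m` times differentiable on `I`, and all of whose
derivatives of order at most `m` grow at most polynomially. -/
def Tame (ρ : ℕ → Ω → ℝ) : ℕ → (Ω → ℝ → V.Limit) → Prop
  | 0, c => V.TameBound I ρ c
  | m + 1, c => V.TameBound I ρ c ∧ ∃ c' : Ω → ℝ → V.Limit,
      (∀ y, ∀ t ∈ I, ∀ l, HasDerivAt (fun s => V.proj l (c y s)) (V.proj l (c' y t)) t) ∧
        Tame ρ m c'

/-- A smooth curve all of whose derivatives grow at most polynomially. -/
def TameCurve (c : ℝ → V.Limit) : Prop :=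
  ∀ m, V.Tame I (fun _ (_ : Unit) => 1) m fun _ => c

/-- A smooth time-dependent multilinear map all of whose time derivatives are bounded, with norms
that grow at most polynomially in time. -/
def TameMult {n : ℕ} (M : ℝ → V.Mult n) : Prop :=
  ∀ m, V.Tame I (fun k (x : Fin n → V.Limit) => ∏ a, ‖V.proj k (x a)‖) m fun x t => M t x

variable {V I} {ρ : ℕ → Ω → ℝ}

/-- The bound holds with all sufficiently strong weights, so that a common one can be chosen for
several families. -/
theorem TameBound.exists_of_le {c : Ω → ℝ → V.Limit} (hρ : IsWeight ρ) (h : V.TameBound I ρ c)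
    (l : ℕ) : ∃ k₀, ∀ k ≥ k₀, ∃ r : ℕ, ∃ C : ℝ, 0 ≤ C ∧
      ∀ y, ∀ t ∈ I, ‖V.proj l (c y t)‖ ≤ C * (1 + |t|) ^ r * ρ k y := by
  obtain ⟨k, r, C, hC, h⟩ := h l
  refine ⟨k, fun K hK => ?_⟩
  obtain ⟨D, hD, hDρ⟩ := hρ.2 k K hK
  refine ⟨r, C * D, by positivity, fun y t ht => (h y t ht).trans ?_⟩
  calc C * (1 + |t|) ^ r * ρ k y ≤ C * (1 + |t|) ^ r * (D * ρ K y) := by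
        gcongr
        exact hDρ y
    _ = C * D * (1 + |t|) ^ r * ρ K y := by ring

theorem Tame.bound {m : ℕ} {c : Ω → ℝ → V.Limit} (h : V.Tame I ρ m c) : V.TameBound I ρ c := by
  cases m with
  | zero => exact h
  | succ m => exact h.1

theorem TameBound.congr {c d : Ω → ℝ → V.Limit} (h : V.TameBound I ρ c)
    (hcd : ∀ y, ∀ t ∈ I, c y t = d y t) : V.TameBound I ρ d := by
  intro l
  obtain ⟨k, r, C, hC, h⟩ := h l
  exact ⟨k, r, C, hC, fun y t ht => hcd y t ht ▸ h y t ht⟩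

theorem Tame.congr (hI : IsOpen I) {m : ℕ} {c d : Ω → ℝ → V.Limit} (h : V.Tame I ρ m c)
    (hcd : ∀ y, ∀ t ∈ I, c y t = d y t) : V.Tame I ρ m d := by
  cases m with
  | zero => exact TameBound.congr h hcd
  | succ m =>
    obtain ⟨hb, c', hc', h'⟩ := h
    refine ⟨hb.congr hcd, c', fun y t ht l => (hc' y t ht l).congr_of_eventuallyEq ?_, h'⟩
    filter_upwards [hI.mem_nhds ht] with s hs
    rw [hcd y s hs]

/-- Substitution into the parameter of a family, where the weights are controlled. -/
theorem TameBound.reindex {Ω' : Type*} {ρ' : ℕ → Ω' → ℝ} {c : Ω → ℝ → V.Limit}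
    (h : V.TameBound I ρ c) (g : Ω' → Ω)
    (hg : ∀ k, ∃ k', ∃ C : ℝ, 0 ≤ C ∧ ∀ y, ρ k (g y) ≤ C * ρ' k' y) :
    V.TameBound I ρ' fun y => c (g y) := by
  intro l
  obtain ⟨k, r, C, hC, h⟩ := h l
  obtain ⟨k', D, hD, hg⟩ := hg k
  refine ⟨k', r, C * D, by positivity, fun y t ht => (h _ t ht).trans ?_⟩
  calc C * (1 + |t|) ^ r * ρ k (g y) ≤ C * (1 + |t|) ^ r * (D * ρ' k' y) := by
        gcongr
        exact hg y
    _ = _ := by ring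

theorem Tame.reindex {Ω' : Type*} {ρ' : ℕ → Ω' → ℝ} {m : ℕ} {c : Ω → ℝ → V.Limit}
    (h : V.Tame I ρ m c) (g : Ω' → Ω)
    (hg : ∀ k, ∃ k', ∃ C : ℝ, 0 ≤ C ∧ ∀ y, ρ k (g y) ≤ C * ρ' k' y) :
    V.Tame I ρ' m fun y => c (g y) := by
  induction m generalizing c with
  | zero => exact TameBound.reindex h g hg
  | succ m ih =>
    obtain ⟨hb, c', hc', h'⟩ := h
    exact ⟨hb.reindex g hg, fun y => c' (g y), fun y => hc' (g y), ih h'⟩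

theorem TameBound.add {c d : Ω → ℝ → V.Limit} (hρ : IsWeight ρ) (hc : V.TameBound I ρ c)
    (hd : V.TameBound I ρ d) : V.TameBound I ρ fun y t => c y t + d y t := by
  intro l
  obtain ⟨k₁, h₁⟩ := hc.exists_of_le hρ l
  obtain ⟨k₂, h₂⟩ := hd.exists_of_le hρ l
  obtain ⟨r₁, C₁, hC₁, h₁⟩ := h₁ _ (le_max_left k₁ k₂)
  obtain ⟨r₂, C₂, hC₂, h₂⟩ := h₂ _ (le_max_right k₁ k₂)
  refine ⟨max k₁ k₂, max r₁ r₂, C₁ + C₂, by positivity, fun y t ht => ?_⟩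
  have h1 : (1 : ℝ) ≤ 1 + |t| := by linarith [abs_nonneg t]
  have hρ0 := hρ.1 (max k₁ k₂) y
  rw [map_add]
  calc _ ≤ C₁ * (1 + |t|) ^ r₁ * ρ (max k₁ k₂) y + C₂ * (1 + |t|) ^ r₂ * ρ (max k₁ k₂) y :=
        (norm_add_le _ _).trans (add_le_add (h₁ y t ht) (h₂ y t ht))
    _ ≤ C₁ * (1 + |t|) ^ max r₁ r₂ * ρ (max k₁ k₂) y +
        C₂ * (1 + |t|) ^ max r₁ r₂ * ρ (max k₁ k₂) y := by
        gcongr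
        · exact le_max_left _ _
        · exact le_max_right _ _
    _ = _ := by ring

theorem Tame.add {m : ℕ} {c d : Ω → ℝ → V.Limit} (hρ : IsWeight ρ) (hc : V.Tame I ρ m c)
    (hd : V.Tame I ρ m d) : V.Tame I ρ m fun y t => c y t + d y t := by
  induction m generalizing c d with
  | zero => exact TameBound.add hρ hc hd
  | succ m ih =>
    obtain ⟨hb, c', hc', h'⟩ := hc
    obtain ⟨hb₂, d', hd', h₂'⟩ := hd
    refine ⟨hb.add hρ hb₂, fun y t => c' y t + d' y t, fun y t ht l => ?_, ih h' h₂'⟩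
    simpa only [map_add] using! (hc' y t ht l).add (hd' y t ht l)

theorem TameBound.map {c : Ω → ℝ → V.Limit} (hc : V.TameBound I ρ c)
    {A : V.Limit →ₗ[𝕜] V.Limit} (hA : V.IsBoundedOp A) :
    V.TameBound I ρ fun y t => A (c y t) := by
  intro l
  obtain ⟨j, T, hT⟩ := hA l
  obtain ⟨k, r, C, hC, h⟩ := hc j
  refine ⟨k, r, ‖T‖ * C, by positivity, fun y t ht => ?_⟩
  rw [← hT]
  calc _ ≤ ‖T‖ * (C * (1 + |t|) ^ r * ρ k y) := T.le_opNorm_of_le (h y t ht)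
    _ = _ := by ring

theorem Tame.map {m : ℕ} {c : Ω → ℝ → V.Limit} (hc : V.Tame I ρ m c)
    {A : V.Limit →ₗ[𝕜] V.Limit} (hA : V.IsBoundedOp A) :
    V.Tame I ρ m fun y t => A (c y t) := by
  induction m generalizing c with
  | zero => exact TameBound.map hc hA
  | succ m ih =>
    obtain ⟨hb, c', hc', h'⟩ := hc
    refine ⟨hb.map hA, fun y t => A (c' y t), fun y t ht l => ?_, ih h'⟩
    obtain ⟨j, T, hT⟩ := hA l
    have := ((T.restrictScalars ℝ).hasFDerivAt (x := V.proj j (c y t))).comp_hasDerivAt t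
      (hc' y t ht j)
    simpa only [Function.comp_def, ContinuousLinearMap.coe_restrictScalars', hT] using! this

theorem isBoundedOp_smul (a : 𝕜) : V.IsBoundedOp (a • LinearMap.id) := fun l =>
  ⟨l, a • ContinuousLinearMap.id 𝕜 _, fun v => by simp⟩

theorem Tame.smul {m : ℕ} {c : Ω → ℝ → V.Limit} (hc : V.Tame I ρ m c) (a : 𝕜) :
    V.Tame I ρ m fun y t => a • c y t :=
  hc.map (isBoundedOp_smul a)

theorem Tame.sub {m : ℕ} {c d : Ω → ℝ → V.Limit} (hρ : IsWeight ρ) (hc : V.Tame I ρ m c)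
    (hd : V.Tame I ρ m d) : V.Tame I ρ m fun y t => c y t - d y t := by
  have h : (fun y t => c y t - d y t) = fun y t => c y t + (-1 : 𝕜) • d y t := by
    funext y t
    rw [sub_eq_add_neg]
    exact congrArg _ (neg_one_smul 𝕜 _).symm
  rw [h]
  exact hc.add hρ (hd.smul (-1))

theorem tame_zero {m : ℕ} : V.Tame I ρ m fun _ _ => 0 := by
  induction m with
  | zero =>
    exact fun l => ⟨0, 0, 0, le_rfl, fun y t _ => by simp⟩
  | succ m ih =>
    refine ⟨fun l => ⟨0, 0, 0, le_rfl, fun y t _ => by simp⟩, fun _ _ => 0, fun y t _ l => ?_, ih⟩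
    simpa using hasDerivAt_const t (0 : V.X l)

theorem Tame.sum {ι : Type*} {m : ℕ} {c : ι → Ω → ℝ → V.Limit} (hρ : IsWeight ρ) (s : Finset ι)
    (hc : ∀ i ∈ s, V.Tame I ρ m (c i)) : V.Tame I ρ m fun y t => ∑ i ∈ s, c i y t := by
  classical
  induction s using Finset.induction_on with
  | empty => simpa using tame_zero
  | insert i s hi ih =>
    simp only [Finset.sum_insert hi]
    exact (hc i (Finset.mem_insert_self i s)).add hρ
      (ih fun j hj => hc j (Finset.mem_insert_of_mem hj))

theorem Tame.contDiffOn (hI : IsOpen I) {m : ℕ} {c : Ω → ℝ → V.Limit} (h : V.Tame I ρ (m + 1) c)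
    (y : Ω) (l : ℕ) : ContDiffOn ℝ m (fun t => V.proj l (c y t)) I := by
  induction m generalizing c with
  | zero =>
    obtain ⟨hb, c', hc', h'⟩ := h
    refine contDiffOn_zero.2 fun t ht => (hc' y t ht l).continuousAt.continuousWithinAt
  | succ m ih =>
    obtain ⟨hb, c', hc', h'⟩ := h
    rw [Nat.cast_succ, contDiffOn_succ_iff_deriv_of_isOpen hI]
    refine ⟨fun t ht => (hc' y t ht l).differentiableAt.differentiableWithinAt, by simp, ?_⟩
    exact (ih h').congr fun t ht => (hc' y t ht l).deriv

theorem TameCurve.smoothCurve (hI : IsOpen I) {c : ℝ → V.Limit} (h : V.TameCurve I c) :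
    V.SmoothCurve I c := fun k =>
  contDiffOn_infty.2 fun n => (h (n + 1)).contDiffOn hI () k

theorem TameMult.smoothCurve (hI : IsOpen I) {n : ℕ} {M : ℝ → V.Mult n} (h : V.TameMult I M)
    (x : Fin n → V.Limit) : V.SmoothCurve I fun t => M t x := fun k =>
  contDiffOn_infty.2 fun n => (h (n + 1)).contDiffOn hI x k

theorem one_add_abs_pow_le (r : ℕ) (t : ℝ) :
    (1 + |t|) ^ r ≤ 2 ^ r * (1 + |t| ^ ((r : ℝ) + 1)) := by
  have h0 := abs_nonneg t
  rcases le_total |t| 1 with h | h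
  · calc (1 + |t|) ^ r ≤ 2 ^ r := pow_le_pow_left₀ (by positivity) (by linarith) _
      _ ≤ 2 ^ r * (1 + |t| ^ ((r : ℝ) + 1)) :=
        le_mul_of_one_le_right (by positivity) (by linarith [Real.rpow_nonneg h0 ((r : ℝ) + 1)])
  · calc (1 + |t|) ^ r ≤ (2 * |t|) ^ r := pow_le_pow_left₀ (by positivity) (by linarith) _
      _ = 2 ^ r * |t| ^ (r : ℝ) := by rw [mul_pow, Real.rpow_natCast]
      _ ≤ 2 ^ r * (1 + |t| ^ ((r : ℝ) + 1)) := by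
        gcongr
        have := Real.rpow_le_rpow_of_exponent_le h (by linarith : (r : ℝ) ≤ r + 1)
        linarith

theorem growsAtMostPolynomially_of_le {φ : ℝ → ℝ} {C : ℝ} {r : ℕ} (hC : 0 ≤ C)
    (h : ∀ t ∈ I, |φ t| ≤ C * (1 + |t|) ^ r) : GrowsAtMostPolynomially I φ := by
  refine ⟨(C + 1) * 2 ^ r, r + 1, by positivity, by positivity, fun t ht => (h t ht).trans ?_⟩
  calc C * (1 + |t|) ^ r ≤ (C + 1) * (1 + |t|) ^ r := by gcongr; linarith
    _ ≤ (C + 1) * (2 ^ r * (1 + |t| ^ ((r : ℝ) + 1))) := by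
      gcongr
      exact one_add_abs_pow_le r t
    _ = _ := by ring

theorem exists_of_growsAtMostPolynomially {φ : ℝ → ℝ} (h : GrowsAtMostPolynomially I φ) :
    ∃ C : ℝ, ∃ r : ℕ, 0 ≤ C ∧ ∀ t ∈ I, |φ t| ≤ C * (1 + |t|) ^ r := by
  obtain ⟨C, r, hC, hr, h⟩ := h
  refine ⟨C * 2, ⌈r⌉₊, by positivity, fun t ht => (h t ht).trans ?_⟩
  have h0 := abs_nonneg t
  have h1 : |t| ^ r ≤ (1 + |t|) ^ ⌈r⌉₊ := by
    calc |t| ^ r ≤ (1 + |t|) ^ r := Real.rpow_le_rpow h0 (by linarith) hr.le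
      _ ≤ (1 + |t|) ^ (⌈r⌉₊ : ℝ) :=
        Real.rpow_le_rpow_of_exponent_le (by linarith) (Nat.le_ceil r)
      _ = _ := Real.rpow_natCast _ _
  have h2 : (1 : ℝ) ≤ (1 + |t|) ^ ⌈r⌉₊ := one_le_pow₀ (by linarith)
  rw [mul_assoc]
  gcongr
  linarith

/-- A smooth curve is tame if all its derivatives in all the spaces grow at most polynomially. The
derivatives in the single spaces form a curve in `V_∞`, because the inclusions are bounded. -/
theorem tameCurve_of_growth (hI : IsOpen I) {c : ℝ → V.Limit} (hs : V.SmoothCurve I c)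
    (hg : ∀ k l, GrowsAtMostPolynomially I fun t => ‖iteratedDeriv l (fun s => V.proj k (c s)) t‖) :
    V.TameCurve I c := by
  classical
  intro m
  induction m generalizing c with
  | zero =>
    intro l
    obtain ⟨C, r, hC, h⟩ := exists_of_growsAtMostPolynomially (hg l 0)
    exact ⟨0, r, C, hC, fun _ t ht => by simpa using h t ht⟩
  | succ m ih =>
    refine ⟨fun l => ?_, ?_⟩
    · obtain ⟨C, r, hC, h⟩ := exists_of_growsAtMostPolynomially (hg l 0)
      exact ⟨0, r, C, hC, fun _ t ht => by simpa using h t ht⟩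
    have hd : ∀ t ∈ I, ∀ k, DifferentiableAt ℝ (fun s => V.proj k (c s)) t := fun t ht k =>
      ((hs k).differentiableOn (by simp)).differentiableAt (hI.mem_nhds ht)
    have hmem : ∀ t ∈ I, (fun k => deriv (fun s => V.proj k (c s)) t) ∈ V.Limit := fun t ht k => by
      have := (((V.incl k).restrictScalars ℝ).hasFDerivAt
        (x := V.proj (k + 1) (c t))).comp_hasDerivAt t (hd t ht (k + 1)).hasDerivAt
      simp only [Function.comp_def, ContinuousLinearMap.coe_restrictScalars', V.incl_proj] at this
      exact this.deriv.symm
    let d : ℝ → V.Limit := fun t => if ht : t ∈ I then ⟨_, hmem t ht⟩ else 0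
    have hdk : ∀ t ∈ I, ∀ k, V.proj k (d t) = deriv (fun s => V.proj k (c s)) t := fun t ht k => by
      simp only [d, dif_pos ht]
      rfl
    refine ⟨fun _ => d, fun _ t ht l => ?_, ih (fun k => ?_) fun k l => ?_⟩
    · rw [hdk t ht l]
      exact (hd t ht l).hasDerivAt
    · exact ((contDiffOn_infty_iff_deriv_of_isOpen hI).1 (hs k)).2.congr
        fun t ht => hdk t ht k
    · obtain ⟨C, r, hC, hr, h⟩ := hg k (l + 1)
      refine ⟨C, r, hC, hr, fun t ht => ?_⟩
      have e : iteratedDeriv l (fun s => V.proj k (d s)) t =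
          iteratedDeriv (l + 1) (fun s => V.proj k (c s)) t := by
        rw [iteratedDeriv_succ']
        refine Filter.EventuallyEq.iteratedDeriv_eq l ?_
        filter_upwards [hI.mem_nhds ht] with s hs using hdk s hs k
      simp only [e]
      exact h t ht

/-- The time derivative of a family of multilinear maps is multilinear. -/
theorem exists_mult_deriv {n : ℕ} {M : ℝ → V.Mult n} {c' : (Fin n → V.Limit) → ℝ → V.Limit}
    (hc' : ∀ x, ∀ t ∈ I, ∀ l, HasDerivAt (fun s => V.proj l (M s x)) (V.proj l (c' x t)) t) :
    ∃ M' : ℝ → V.Mult n, ∀ x, ∀ t ∈ I, M' t x = c' x t := by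
  classical
  refine ⟨fun t => if ht : t ∈ I then
    { toFun := fun x => c' x t
      map_update_add' := fun x a y z => V.ext_proj fun l => ?_
      map_update_smul' := fun x a b y => V.ext_proj fun l => ?_ } else 0, fun x t ht => ?_⟩
  · refine (hc' _ t ht l).unique ?_
    have := (hc' (Function.update x a y) t ht l).add (hc' (Function.update x a z) t ht l)
    rw [map_add]
    refine this.congr_of_eventuallyEq (.of_forall fun s => ?_)
    simp
  · refine (hc' _ t ht l).unique ?_
    have := (hc' (Function.update x a y) t ht l).const_smul b
    rw [map_smul]
    refine this.congr_of_eventuallyEq (.of_forall fun s => ?_)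
    simp
  · simp only [dif_pos ht]
    rfl

/-- The time derivative of a tame family of multilinear maps is again one. -/
theorem TameMult.exists_deriv {n m : ℕ} {M : ℝ → V.Mult n}
    (h : V.Tame I (fun k (x : Fin n → V.Limit) => ∏ a, ‖V.proj k (x a)‖) (m + 1) fun x t => M t x)
    (hI : IsOpen I) :
    ∃ M' : ℝ → V.Mult n,
      (∀ t ∈ I, ∀ x l, HasDerivAt (fun s => V.proj l (M s x)) (V.proj l (M' t x)) t) ∧
      V.Tame I (fun k (x : Fin n → V.Limit) => ∏ a, ‖V.proj k (x a)‖) m fun x t => M' t x := by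
  obtain ⟨hb, c', hc', h'⟩ := h
  obtain ⟨M', hM'⟩ := exists_mult_deriv hc'
  refine ⟨M', fun t ht x l => ?_, h'.congr hI fun x t ht => (hM' x t ht).symm⟩
  rw [hM' x t ht]
  exact hc' x t ht l

/-- By uniqueness of derivatives, any derivative of a tame family is tame. -/
theorem Tame.of_hasDerivAt (hI : IsOpen I) {m : ℕ} {c c' : Ω → ℝ → V.Limit}
    (h : V.Tame I ρ (m + 1) c)
    (hc : ∀ y, ∀ t ∈ I, ∀ l, HasDerivAt (fun s => V.proj l (c y s)) (V.proj l (c' y t)) t) :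
    V.Tame I ρ m c' := by
  obtain ⟨hb, d, hd, h'⟩ := h
  exact h'.congr hI fun y t ht => V.ext_proj fun l => (hd y t ht l).unique (hc y t ht l)

end NestedBanach

/-! ### Extension of multilinear families to the Banach spaces -/

namespace NestedBanach

variable {𝕜 : Type u} [RCLike 𝕜] (V : NestedBanach.{u, w} 𝕜) {I : Set ℝ}

instance smulCommClass (k : ℕ) : SMulCommClass 𝕜 ℝ (V.X k) :=
  (inferInstance : SMulCommClass ℝ 𝕜 (V.X k)).symm

open Classical in
/-- The extension of a multilinear map on `V_∞` to a bounded map from `X k` to `X l`, if there is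
one, and zero otherwise. -/
noncomputable def ext (k l : ℕ) {n : ℕ} (M : V.Mult n) :
    ContinuousMultilinearMap 𝕜 (fun _ : Fin n => V.X k) (V.X l) :=
  if h : ∃ Λ : ContinuousMultilinearMap 𝕜 (fun _ : Fin n => V.X k) (V.X l),
    ∀ x, Λ (fun a => V.proj k (x a)) = V.proj l (M x) then h.choose else 0

variable {V}

theorem exists_extension_of_bound {k l n : ℕ} (M : V.Mult n) {C : ℝ} (hC : 0 ≤ C)
    (h : ∀ x, ‖V.proj l (M x)‖ ≤ C * ∏ a, ‖V.proj k (x a)‖) :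
    ∃ Λ : ContinuousMultilinearMap 𝕜 (fun _ : Fin n => V.X k) (V.X l),
      (∀ x, Λ (fun a => V.proj k (x a)) = V.proj l (M x)) ∧ ‖Λ‖ ≤ C :=
  V.exists_extension k ((V.proj l).compMultilinearMap M) hC h

theorem ext_apply_proj {k l n : ℕ} {M : V.Mult n} {C : ℝ} (hC : 0 ≤ C)
    (h : ∀ x, ‖V.proj l (M x)‖ ≤ C * ∏ a, ‖V.proj k (x a)‖) (x : Fin n → V.Limit) :
    V.ext k l M (fun a => V.proj k (x a)) = V.proj l (M x) := by
  obtain ⟨Λ, hΛ, -⟩ := exists_extension_of_bound M hC h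
  have h' : ∃ Λ : ContinuousMultilinearMap 𝕜 (fun _ : Fin n => V.X k) (V.X l),
    ∀ x, Λ (fun a => V.proj k (x a)) = V.proj l (M x) := ⟨Λ, hΛ⟩
  rw [ext, dif_pos h']
  exact h'.choose_spec x

/-- Differentiability in time of the extension, in the norm of multilinear maps, if there is a
bounded second derivative. -/
theorem hasDerivAt_ext (hI : IsOpen I) {k l n : ℕ} {M M' M'' : ℝ → V.Mult n}
    (hM : ∀ t ∈ I, ∀ x, HasDerivAt (fun s => V.proj l (M s x)) (V.proj l (M' t x)) t)
    (hM' : ∀ t ∈ I, ∀ x, HasDerivAt (fun s => V.proj l (M' s x)) (V.proj l (M'' t x)) t)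
    {C : ℝ} {r : ℕ} (hC : 0 ≤ C)
    (b : ∀ t ∈ I, ∀ x, ‖V.proj l (M t x)‖ ≤ C * (1 + |t|) ^ r * ∏ a, ‖V.proj k (x a)‖)
    (b' : ∀ t ∈ I, ∀ x, ‖V.proj l (M' t x)‖ ≤ C * (1 + |t|) ^ r * ∏ a, ‖V.proj k (x a)‖)
    (b'' : ∀ t ∈ I, ∀ x, ‖V.proj l (M'' t x)‖ ≤ C * (1 + |t|) ^ r * ∏ a, ‖V.proj k (x a)‖)
    {t : ℝ} (ht : t ∈ I) :
    HasDerivAt (fun s => V.ext k l (M s)) (V.ext k l (M' t)) t := by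
  obtain ⟨δ, hδ, hball⟩ := Metric.isOpen_iff.1 hI t ht
  set B : ℝ := C * (1 + (|t| + δ)) ^ r with hB
  have hB0 : 0 ≤ B := by positivity
  have habs : ∀ s ∈ Metric.ball t δ, C * (1 + |s|) ^ r ≤ B := fun s hs => by
    rw [hB]
    gcongr
    rw [Metric.mem_ball, Real.dist_eq] at hs
    have := abs_sub_abs_le_abs_sub s t
    linarith
  -- the remainder is quadratic for each vector, with a constant proportional to the product of
  -- norms; as it is itself a multilinear map, this bounds its norm
  have key : ∀ s ∈ Metric.ball t δ,
      ‖V.ext k l (M s) - V.ext k l (M t) - (s - t) • V.ext k l (M' t)‖ ≤ B * |s - t| ^ 2 := by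
    intro s hs
    have hpt : ∀ x, ‖V.proj l ((M s - M t - ((s - t : ℝ) : 𝕜) • M' t) x)‖ ≤
        B * |s - t| ^ 2 * ∏ a, ‖V.proj k (x a)‖ := by
      intro x
      have hP : 0 ≤ ∏ a, ‖V.proj k (x a)‖ := Finset.prod_nonneg fun _ _ => norm_nonneg _
      have hconv : ∀ y ∈ Metric.ball t δ,
          ‖V.proj l (M' y x) - V.proj l (M' t x)‖ ≤ B * (∏ a, ‖V.proj k (x a)‖) * ‖y - t‖ := by
        intro y hy
        refine (convex_ball t δ).norm_image_sub_le_of_norm_hasDerivWithin_le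
          (f' := fun z => V.proj l (M'' z x))
          (fun z hz => (hM' z (hball hz) x).hasDerivWithinAt) (fun z hz => ?_)
          (Metric.mem_ball_self hδ) hy
        exact (b'' z (hball hz) x).trans (mul_le_mul_of_nonneg_right (habs z hz) hP)
      have hsub : Metric.closedBall t |s - t| ⊆ Metric.ball t δ := fun y hy =>
        lt_of_le_of_lt (Metric.mem_closedBall.1 hy) (by simpa [Real.dist_eq] using hs)
      have hder : ∀ y ∈ Metric.closedBall t |s - t|, HasDerivWithinAt
          (fun y => V.proj l (M y x) - (y - t) • V.proj l (M' t x))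
          (V.proj l (M' y x) - V.proj l (M' t x)) (Metric.closedBall t |s - t|) y := by
        intro y hy
        have h1 := hM y (hball (hsub hy)) x
        have h2 := ((hasDerivAt_id y).sub_const t).smul_const (V.proj l (M' t x))
        rw [one_smul] at h2
        exact (h1.sub h2).hasDerivWithinAt
      have hmv := (convex_closedBall t |s - t|).norm_image_sub_le_of_norm_hasDerivWithin_le hder
        (C := B * (∏ a, ‖V.proj k (x a)‖) * |s - t|) (fun y hy => (hconv y (hsub hy)).trans ?_)
        (Metric.mem_closedBall_self (abs_nonneg _))
        (show s ∈ Metric.closedBall t |s - t| by simp [Real.dist_eq])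
      · simp only [sub_self, zero_smul, sub_zero] at hmv
        have e : V.proj l ((M s - M t - ((s - t : ℝ) : 𝕜) • M' t) x) =
            V.proj l (M s x) - (s - t) • V.proj l (M' t x) - V.proj l (M t x) := by
          rw [sub_apply, sub_apply, smul_apply,
            map_sub, map_sub, map_smul, RCLike.real_smul_eq_coe_smul (K := 𝕜)]
          abel
        rw [e]
        refine hmv.trans (le_of_eq ?_)
        rw [Real.norm_eq_abs]
        ring
      · gcongr
        simpa [Real.dist_eq] using hy
    obtain ⟨Λ, hΛ, hΛn⟩ := exists_extension_of_bound _ (by positivity) hpt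
    have hb : ∀ {u : ℝ}, 0 ≤ C * (1 + |u|) ^ r := fun {u} => by positivity
    have e : V.ext k l (M s) - V.ext k l (M t) - (s - t) • V.ext k l (M' t) = Λ := by
      refine V.cmm_ext fun x => ?_
      rw [hΛ, sub_apply, sub_apply,
        smul_apply, ext_apply_proj hb (b s (hball hs)), ext_apply_proj hb (b t ht),
        ext_apply_proj hb (b' t ht), sub_apply, sub_apply,
        smul_apply, map_sub, map_sub, map_smul,
        RCLike.real_smul_eq_coe_smul (K := 𝕜)]
    rw [e]
    exact hΛn
  rw [hasDerivAt_iff_isLittleO]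
  have hO : (fun s => V.ext k l (M s) - V.ext k l (M t) - (s - t) • V.ext k l (M' t)) =O[𝓝 t]
      fun s => (s - t) ^ 2 := by
    refine Asymptotics.IsBigO.of_bound B ?_
    filter_upwards [Metric.ball_mem_nhds t hδ] with s hs
    simpa using key s hs
  refine hO.trans_isLittleO ?_
  have : (fun s : ℝ => (s - t) ^ 2) =o[𝓝 t] fun s => (s - t) ^ 1 := by
    have h0 : Tendsto (fun s : ℝ => s - t) (𝓝 t) (𝓝 0) := by
      simpa using (continuous_sub_right t).tendsto t
    exact (Asymptotics.isLittleO_pow_pow one_lt_two).comp_tendsto h0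
  simpa using this

/-- The extension of a tame multilinear family to maps from `X k` to `X l` is `m` times continuously
differentiable in the norm of multilinear maps, if `k` is large. Two more derivatives on `V_∞` are
needed: one for the continuity of the highest derivative, and one for the uniform remainder. -/
theorem contDiffOn_ext (hI : IsOpen I) {n : ℕ} (m : ℕ) {M : ℝ → V.Mult n}
    (h : V.Tame I (fun k (x : Fin n → V.Limit) => ∏ a, ‖V.proj k (x a)‖) (m + 2) fun x t => M t x)
    (l : ℕ) : ∃ k₀, ∀ k ≥ k₀, ContDiffOn ℝ m (fun t => V.ext k l (M t)) I ∧
      ∀ t ∈ I, ∀ x, V.ext k l (M t) (fun a => V.proj k (x a)) = V.proj l (M t x) := by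
  have hw := V.isWeight_prod n
  -- one step of the induction: the extension is differentiable
  have step : ∀ {M : ℝ → V.Mult n} {m : ℕ}, V.Tame I
      (fun k (x : Fin n → V.Limit) => ∏ a, ‖V.proj k (x a)‖) (m + 2) (fun x t => M t x) →
      ∃ M' : ℝ → V.Mult n, V.Tame I (fun k (x : Fin n → V.Limit) => ∏ a, ‖V.proj k (x a)‖)
        (m + 1) (fun x t => M' t x) ∧ ∃ k₀, ∀ k ≥ k₀,
        (∀ t ∈ I, HasDerivAt (fun s => V.ext k l (M s)) (V.ext k l (M' t)) t) ∧
        ∀ t ∈ I, ∀ x, V.ext k l (M t) (fun a => V.proj k (x a)) = V.proj l (M t x) := by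
    intro M m h
    obtain ⟨M', hM, h'⟩ := TameMult.exists_deriv h hI
    obtain ⟨M'', hM', h''⟩ := TameMult.exists_deriv h' hI
    obtain ⟨k₁, hk₁⟩ := h.bound.exists_of_le hw l
    obtain ⟨k₂, hk₂⟩ := h'.bound.exists_of_le hw l
    obtain ⟨k₃, hk₃⟩ := h''.bound.exists_of_le hw l
    refine ⟨M', h', max k₁ (max k₂ k₃), fun k hk => ?_⟩
    obtain ⟨r₁, C₁, hC₁, b₁⟩ := hk₁ k (by omega)
    obtain ⟨r₂, C₂, hC₂, b₂⟩ := hk₂ k (by omega)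
    obtain ⟨r₃, C₃, hC₃, b₃⟩ := hk₃ k (by omega)
    have mono : ∀ {D : ℝ} {r : ℕ} (t : ℝ) (x : Fin n → V.Limit), 0 ≤ D → D ≤ C₁ + C₂ + C₃ →
        r ≤ r₁ + r₂ + r₃ → D * (1 + |t|) ^ r * ∏ a, ‖V.proj k (x a)‖ ≤
          (C₁ + C₂ + C₃) * (1 + |t|) ^ (r₁ + r₂ + r₃) * ∏ a, ‖V.proj k (x a)‖ := by
      intro D r t x hD0 hD hr
      have h1 : (1 : ℝ) ≤ 1 + |t| := by linarith [abs_nonneg t]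
      have hP : 0 ≤ ∏ a, ‖V.proj k (x a)‖ := Finset.prod_nonneg fun _ _ => norm_nonneg _
      gcongr
    refine ⟨fun t ht => hasDerivAt_ext hI (fun t ht x => hM t ht x l)
      (fun t ht x => hM' t ht x l) (C := C₁ + C₂ + C₃) (r := r₁ + r₂ + r₃) (by positivity)
      (fun t ht x => (b₁ x t ht).trans (mono t x hC₁ (by linarith) (by omega)))
      (fun t ht x => (b₂ x t ht).trans (mono t x hC₂ (by linarith) (by omega)))
      (fun t ht x => (b₃ x t ht).trans (mono t x hC₃ (by linarith) (by omega))) ht,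
      fun t ht x => ?_⟩
    exact ext_apply_proj (C := C₁ * (1 + |t|) ^ r₁) (by positivity) (fun x => b₁ x t ht) x
  induction m generalizing M with
  | zero =>
    obtain ⟨M', h', k₀, hk₀⟩ := step h
    refine ⟨k₀, fun k hk => ⟨contDiffOn_zero.2 fun t ht => ?_, (hk₀ k hk).2⟩⟩
    exact ((hk₀ k hk).1 t ht).continuousAt.continuousWithinAt
  | succ m ih =>
    obtain ⟨M', h', k₀, hk₀⟩ := step h
    obtain ⟨k₁, hk₁⟩ := ih h'
    refine ⟨max k₀ k₁, fun k hk => ⟨?_, (hk₀ k (by omega)).2⟩⟩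
    rw [Nat.cast_succ, contDiffOn_succ_iff_deriv_of_isOpen hI]
    refine ⟨fun t ht => ((hk₀ k (by omega)).1 t ht).differentiableAt.differentiableWithinAt,
      by simp, ?_⟩
    exact (hk₁ k (by omega)).1.congr fun t ht => ((hk₀ k (by omega)).1 t ht).deriv

end NestedBanach

/-! ### Smooth maps -/

namespace NestedBanach

variable {𝕜 : Type u} [RCLike 𝕜] {V : NestedBanach.{u, w} 𝕜} {I : Set ℝ}

/-- The evaluation of a multilinear map is smooth in the map and in its arguments jointly. -/
theorem contDiff_cmm_apply {E F : Type*} [NormedAddCommGroup E] [NormedSpace 𝕜 E]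
    [NormedAddCommGroup F] [NormedSpace 𝕜 F] [CompleteSpace F] (m : ℕ) (r : WithTop ℕ∞) :
    ContDiff 𝕜 r (fun z : ContinuousMultilinearMap 𝕜 (fun _ : Fin m => E) F × (Fin m → E) =>
      z.1 z.2) := by
  have h := (ContinuousLinearMap.id 𝕜
    (ContinuousMultilinearMap 𝕜 (fun _ : Fin m => E) F)).analyticOnNhd_uncurry_of_multilinear
    (s := univ)
  exact contDiffOn_univ.1 h.contDiffOn_of_completeSpace

/-- The extensions exist on all sufficiently small spaces `X k`, so that a common `k` can be chosen
for several maps. -/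
theorem SmoothMap.exists_of_le {φ : ℝ → V.Limit → V.Limit} (h : V.SmoothMap I φ) (n l : ℕ) :
    ∃ k₀, ∀ k ≥ k₀, ∃ g : ℝ → V.X k → V.X l,
      (∀ t ∈ I, ∀ v, g t (V.proj k v) = V.proj l (φ t v)) ∧
      ContDiffOn ℝ n (fun z : ℝ × V.X k => g z.1 z.2) (I ×ˢ univ) ∧
      ∀ t ∈ I, ContDiff 𝕜 n (g t) := by
  obtain ⟨k₀, g, hg, hgn, hgt⟩ := h n l
  refine ⟨k₀, fun k hk => ⟨fun t x => g t (V.inclOfLE hk x), fun t ht v => ?_, ?_, fun t ht => ?_⟩⟩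
  · simp only [V.inclOfLE_proj, hg t ht]
  · refine hgn.comp (f := fun z : ℝ × V.X k => (z.1, V.inclOfLE hk z.2)) ?_ fun z hz =>
      ⟨hz.1, mem_univ _⟩
    exact (contDiff_fst.prodMk
      (((V.inclOfLE hk).restrictScalars ℝ).contDiff.comp contDiff_snd)).contDiffOn
  · exact (hgt t ht).comp (V.inclOfLE hk).contDiff

theorem SmoothMap.congr {φ ψ : ℝ → V.Limit → V.Limit} (h : V.SmoothMap I φ)
    (hφ : ∀ t ∈ I, ∀ v, φ t v = ψ t v) : V.SmoothMap I ψ := by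
  intro n l
  obtain ⟨k, g, hg, h'⟩ := h n l
  exact ⟨k, g, fun t ht v => by rw [hg t ht, hφ t ht], h'⟩

theorem smoothMap_linear {A : V.Limit →ₗ[𝕜] V.Limit} (hA : V.IsBoundedOp A) :
    V.SmoothMap I fun _ v => A v := by
  intro n l
  obtain ⟨k, T, hT⟩ := hA l
  exact ⟨k, fun _ => T, fun _ _ => hT, ((T.restrictScalars ℝ).contDiff.comp contDiff_snd).contDiffOn,
    fun _ _ => T.contDiff⟩

theorem isBoundedOp_id : V.IsBoundedOp LinearMap.id := fun l =>
  ⟨l, ContinuousLinearMap.id 𝕜 _, fun _ => rfl⟩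

theorem smoothMap_id : V.SmoothMap I fun _ v => v :=
  smoothMap_linear isBoundedOp_id

theorem SmoothMap.comp {φ ψ : ℝ → V.Limit → V.Limit} (hφ : V.SmoothMap I φ)
    (hψ : V.SmoothMap I ψ) : V.SmoothMap I fun t v => φ t (ψ t v) := by
  intro n l
  obtain ⟨k, g, hg, hgn, hgt⟩ := hφ n l
  obtain ⟨k', g', hg', hgn', hgt'⟩ := hψ n k
  refine ⟨k', fun t x => g t (g' t x), fun t ht v => by simp only [hg' t ht, hg t ht], ?_, fun t ht => ?_⟩
  · exact hgn.comp (f := fun z : ℝ × V.X k' => (z.1, g' z.1 z.2))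
      (contDiff_fst.contDiffOn.prodMk hgn') fun z hz => ⟨hz.1, mem_univ _⟩
  · exact (hgt t ht).comp (hgt' t ht)

theorem SmoothMap.map {φ : ℝ → V.Limit → V.Limit} {A : V.Limit →ₗ[𝕜] V.Limit}
    (hA : V.IsBoundedOp A) (hφ : V.SmoothMap I φ) : V.SmoothMap I fun t v => A (φ t v) :=
  (smoothMap_linear hA).comp hφ

theorem SmoothMap.add {φ ψ : ℝ → V.Limit → V.Limit} (hφ : V.SmoothMap I φ)
    (hψ : V.SmoothMap I ψ) : V.SmoothMap I fun t v => φ t v + ψ t v := by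
  intro n l
  obtain ⟨k₁, h₁⟩ := hφ.exists_of_le n l
  obtain ⟨k₂, h₂⟩ := hψ.exists_of_le n l
  obtain ⟨g, hg, hgn, hgt⟩ := h₁ _ (le_max_left k₁ k₂)
  obtain ⟨g', hg', hgn', hgt'⟩ := h₂ _ (le_max_right k₁ k₂)
  refine ⟨max k₁ k₂, fun t x => g t x + g' t x, fun t ht v => ?_, hgn.add hgn',
    fun t ht => (hgt t ht).add (hgt' t ht)⟩
  simp only [hg t ht, hg' t ht, map_add]

theorem SmoothMap.sub {φ ψ : ℝ → V.Limit → V.Limit} (hφ : V.SmoothMap I φ)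
    (hψ : V.SmoothMap I ψ) : V.SmoothMap I fun t v => φ t v - ψ t v := by
  refine (hφ.add (hψ.map (isBoundedOp_smul (-1)))).congr fun t _ v => ?_
  rw [sub_eq_add_neg]
  exact congrArg _ (neg_one_smul 𝕜 (ψ t v))

theorem smoothMap_zero : V.SmoothMap I fun _ _ => 0 :=
  fun _ _ => ⟨0, fun _ _ => 0, fun _ _ _ => by simp, contDiffOn_const, fun _ _ => contDiff_const⟩

theorem SmoothMap.sum {ι : Type*} {φ : ι → ℝ → V.Limit → V.Limit} (s : Finset ι)
    (h : ∀ i ∈ s, V.SmoothMap I (φ i)) : V.SmoothMap I fun t v => ∑ i ∈ s, φ i t v := by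
  classical
  induction s using Finset.induction_on with
  | empty => simpa using smoothMap_zero
  | insert i s hi ih =>
    simp only [Finset.sum_insert hi]
    exact (h i (Finset.mem_insert_self i s)).add
      (ih fun j hj => h j (Finset.mem_insert_of_mem hj))

/-- Smooth maps can be substituted into tame multilinear families. -/
theorem TameMult.smoothMap (hI : IsOpen I) {m : ℕ} {M : ℝ → V.Mult m} (hM : V.TameMult I M)
    {φ : Fin m → ℝ → V.Limit → V.Limit} (hφ : ∀ a, V.SmoothMap I (φ a)) :
    V.SmoothMap I fun t v => M t fun a => φ a t v := by
  intro n l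
  obtain ⟨k, hk⟩ := contDiffOn_ext hI n (hM (n + 2)) l
  obtain ⟨hΛ, hΛM⟩ := hk k le_rfl
  choose K₀ hK₀ using fun a => (hφ a).exists_of_le n k
  obtain ⟨K, hK⟩ := (Set.finite_range K₀).bddAbove
  choose g hg hgn hgt using fun a => hK₀ a K (hK (mem_range_self a))
  refine ⟨K, fun t x => V.ext k l (M t) fun a => g a t x, fun t ht v => ?_, ?_, fun t ht => ?_⟩
  · simp only [hg _ t ht]
    exact hΛM t ht _
  · have h1 : ContDiffOn ℝ n (fun z : ℝ × V.X K => V.ext k l (M z.1)) (I ×ˢ univ) :=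
      hΛ.comp contDiffOn_fst fun z hz => hz.1
    have h2 : ContDiffOn ℝ n (fun (z : ℝ × V.X K) a => g a z.1 z.2) (I ×ˢ univ) :=
      contDiffOn_pi.2 hgn
    exact ((contDiff_cmm_apply m n).restrict_scalars ℝ).comp_contDiffOn (h1.prodMk h2)
  · exact (V.ext k l (M t)).contDiff.comp (contDiff_pi.2 fun a => hgt a t ht)

/-- Substitution of smooth curves into smooth maps. -/
theorem SmoothMap.smoothCurve {φ : ℝ → V.Limit → V.Limit} (hφ : V.SmoothMap I φ)
    {X : ℝ → V.Limit} (hX : V.SmoothCurve I X) : V.SmoothCurve I fun t => φ t (X t) := by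
  refine fun l => contDiffOn_infty.2 fun n => ?_
  obtain ⟨k, g, hg, hgn, -⟩ := hφ n l
  refine ContDiffOn.congr (f := fun t => g t (V.proj k (X t))) ?_ fun t ht => (hg t ht _).symm
  exact hgn.comp (f := fun t => (t, V.proj k (X t)))
    (contDiffOn_id.prodMk (contDiffOn_infty.1 (hX k) n)) fun t ht => ⟨ht, mem_univ _⟩

/-- The product rule for a tame multilinear family, applied to curves. The shift by `t₀` allows for
a real parameter along a line, at a fixed time, in place of the time. -/
theorem TameMult.hasDerivAt (hI : IsOpen I) {m : ℕ} {M M' : ℝ → V.Mult m} (hM : V.TameMult I M)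
    (hM' : ∀ t ∈ I, ∀ x l, HasDerivAt (fun s => V.proj l (M s x)) (V.proj l (M' t x)) t)
    {t₀ s₀ : ℝ} (ht : t₀ + s₀ ∈ I) {c : Fin m → ℝ → V.Limit} {c' : Fin m → V.Limit}
    (hc : ∀ a k, HasDerivAt (fun s => V.proj k (c a s)) (V.proj k (c' a)) s₀) (l : ℕ) :
    HasDerivAt (fun s => V.proj l (M (t₀ + s) fun a => c a s))
      (V.proj l (M' (t₀ + s₀) (fun a => c a s₀) +
        ∑ a, M (t₀ + s₀) (Function.update (fun a => c a s₀) a (c' a)))) s₀ := by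
  obtain ⟨k, hk⟩ := contDiffOn_ext hI 1 (hM 3) l
  obtain ⟨hΛ, hΛM⟩ := hk k le_rfl
  have hΛ' := ((hΛ.differentiableOn (by simp)).differentiableAt (hI.mem_nhds ht)).hasDerivAt
  -- the derivative of the extension restricts to `M'`
  have hval : ∀ x, deriv (fun t => V.ext k l (M t)) (t₀ + s₀) (fun a => V.proj k (x a)) =
      V.proj l (M' (t₀ + s₀) x) := by
    intro x
    have h1 := ((ContinuousMultilinearMap.apply 𝕜 (fun _ : Fin m => V.X k) (V.X l)
      (fun a => V.proj k (x a))).restrictScalars ℝ).hasFDerivAt.comp_hasDerivAt (t₀ + s₀) hΛ'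
    refine HasDerivAt.unique ?_ (hM' _ ht x l)
    refine h1.congr_of_eventuallyEq ?_
    filter_upwards [hI.mem_nhds ht] with s hs
    exact (hΛM s hs x).symm
  have hΛs : HasDerivAt (fun s => (ContinuousMultilinearMap.restrictScalarsLinear ℝ
      (V.ext k l (M (t₀ + s))) : ContinuousMultilinearMap ℝ (fun _ : Fin m => V.X k) (V.X l)))
      (ContinuousMultilinearMap.restrictScalarsLinear ℝ
        (deriv (fun t => V.ext k l (M t)) (t₀ + s₀))) s₀ := by
    have h2 : HasDerivAt (fun s => V.ext k l (M (t₀ + s)))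
        (deriv (fun t => V.ext k l (M t)) (t₀ + s₀)) s₀ := by
      simpa using! hΛ'.comp_const_add t₀ s₀
    let L : ContinuousMultilinearMap 𝕜 (fun _ : Fin m => V.X k) (V.X l) →L[ℝ]
      ContinuousMultilinearMap ℝ (fun _ : Fin m => V.X k) (V.X l) :=
        ContinuousMultilinearMap.restrictScalarsLinear ℝ
    exact L.hasFDerivAt.comp_hasDerivAt s₀ h2
  have h3 := (hΛs.hasFDerivAt.continuousMultilinearMap_apply
    (g := fun a s => V.proj k (c a s)) fun a => (hc a k).hasFDerivAt).hasDerivAt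
  have h4 : ∀ᶠ s in 𝓝 s₀, t₀ + s ∈ I :=
    (continuous_const.add continuous_id).continuousAt.eventually_mem (hI.mem_nhds ht)
  refine HasDerivAt.congr_of_eventuallyEq (f := fun s => V.ext k l (M (t₀ + s))
    fun a => V.proj k (c a s)) ?_ ?_
  · refine h3.congr_deriv ?_
    have hupd (a : Fin m) : (V.ext k l (M (t₀ + s₀)))
        (Function.update (fun b => V.proj k (c b s₀)) a (V.proj k (c' a))) =
        V.proj l (M (t₀ + s₀) (Function.update (fun b => c b s₀) a (c' a))) := by
      rw [← hΛM _ ht]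
      exact congrArg _ (Function.comp_update (V.proj k) (fun b => c b s₀) a (c' a)).symm
    simp [hval, hupd]
  · filter_upwards [h4] with s hs
    exact (hΛM _ hs _).symm

end NestedBanach

/-! ### Orders of vanishing -/

namespace NestedBanach

variable {𝕜 : Type u} [RCLike 𝕜] {V : NestedBanach.{u, w} 𝕜} {I : Set ℝ}

theorem IsOrder.exists_of_le {n : ℕ} {φ : ℝ → V.Limit → V.Limit} (h : V.IsOrder I n φ) (l : ℕ) :
    ∃ k₀, ∀ k ≥ k₀, ∀ K ⊆ I, IsCompact K → ∃ C δ : ℝ, 0 ≤ C ∧ 0 < δ ∧ ∀ t ∈ K, ∀ v,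
      ‖V.proj k v‖ < δ → ‖V.proj l (φ t v)‖ ≤ C * ‖V.proj k v‖ ^ n := by
  obtain ⟨k₀, h⟩ := h l
  refine ⟨k₀, fun k hk K hKI hK => ?_⟩
  obtain ⟨C, δ, hδ, h⟩ := h K hKI hK
  obtain ⟨D, hD1, hD⟩ := V.exists_norm_proj_le hk
  have hD0 : 0 < D := by linarith
  refine ⟨|C| * D ^ n, δ / D, by positivity, by positivity, fun t ht v hv => ?_⟩
  have hv' : ‖V.proj k₀ v‖ < δ := by
    refine (hD v).trans_lt ?_
    rw [lt_div_iff₀ hD0] at hv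
    linarith
  calc _ ≤ C * ‖V.proj k₀ v‖ ^ n := h t ht v hv'
    _ ≤ |C| * (D * ‖V.proj k v‖) ^ n := by
      gcongr
      · exact le_abs_self C
      · exact hD v
    _ = _ := by ring

theorem IsOrder.congr {n : ℕ} {φ ψ : ℝ → V.Limit → V.Limit} (h : V.IsOrder I n φ)
    (hφ : ∀ t ∈ I, ∀ v, φ t v = ψ t v) : V.IsOrder I n ψ := by
  intro l
  obtain ⟨k, h⟩ := h l
  refine ⟨k, fun K hKI hK => ?_⟩
  obtain ⟨C, δ, hδ, h⟩ := h K hKI hK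
  exact ⟨C, δ, hδ, fun t ht v hv => hφ t (hKI ht) v ▸ h t ht v hv⟩

theorem IsOrder.mono {n m : ℕ} (hmn : m ≤ n) {φ : ℝ → V.Limit → V.Limit} (h : V.IsOrder I n φ) :
    V.IsOrder I m φ := by
  intro l
  obtain ⟨k, h⟩ := h.exists_of_le l
  refine ⟨k, fun K hKI hK => ?_⟩
  obtain ⟨C, δ, hC, hδ, h⟩ := h k le_rfl K hKI hK
  refine ⟨C, min δ 1, by positivity, fun t ht v hv => ?_⟩
  refine (h t ht v (hv.trans_le (min_le_left _ _))).trans ?_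
  exact mul_le_mul_of_nonneg_left
    (pow_le_pow_of_le_one (norm_nonneg _) (hv.trans_le (min_le_right _ _)).le hmn) hC

theorem IsOrder.add {n : ℕ} {φ ψ : ℝ → V.Limit → V.Limit} (hφ : V.IsOrder I n φ)
    (hψ : V.IsOrder I n ψ) : V.IsOrder I n fun t v => φ t v + ψ t v := by
  intro l
  obtain ⟨k₁, h₁⟩ := hφ.exists_of_le l
  obtain ⟨k₂, h₂⟩ := hψ.exists_of_le l
  refine ⟨max k₁ k₂, fun K hKI hK => ?_⟩
  obtain ⟨C₁, δ₁, hC₁, hδ₁, h₁⟩ := h₁ _ (le_max_left _ _) K hKI hK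
  obtain ⟨C₂, δ₂, hC₂, hδ₂, h₂⟩ := h₂ _ (le_max_right _ _) K hKI hK
  refine ⟨C₁ + C₂, min δ₁ δ₂, by positivity, fun t ht v hv => ?_⟩
  rw [map_add, add_mul]
  exact (norm_add_le _ _).trans (add_le_add (h₁ t ht v (hv.trans_le (min_le_left _ _)))
    (h₂ t ht v (hv.trans_le (min_le_right _ _))))

theorem IsOrder.map {n : ℕ} {φ : ℝ → V.Limit → V.Limit} {A : V.Limit →ₗ[𝕜] V.Limit}
    (hA : V.IsBoundedOp A) (hφ : V.IsOrder I n φ) : V.IsOrder I n fun t v => A (φ t v) := by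
  intro l
  obtain ⟨j, T, hT⟩ := hA l
  obtain ⟨k, h⟩ := hφ j
  refine ⟨k, fun K hKI hK => ?_⟩
  obtain ⟨C, δ, hδ, h⟩ := h K hKI hK
  refine ⟨‖T‖ * C, δ, hδ, fun t ht v hv => ?_⟩
  rw [← hT, mul_assoc]
  exact T.le_opNorm_of_le (h t ht v hv)

theorem IsOrder.sub {n : ℕ} {φ ψ : ℝ → V.Limit → V.Limit} (hφ : V.IsOrder I n φ)
    (hψ : V.IsOrder I n ψ) : V.IsOrder I n fun t v => φ t v - ψ t v := by
  refine (hφ.add (hψ.map (isBoundedOp_smul (-1)))).congr fun t _ v => ?_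
  rw [sub_eq_add_neg]
  exact congrArg _ (neg_one_smul 𝕜 (ψ t v))

theorem isOrder_zero (n : ℕ) : V.IsOrder I n fun _ _ => 0 :=
  fun _ => ⟨0, fun _ _ _ => ⟨0, 1, one_pos, fun _ _ _ _ => by simp⟩⟩

theorem IsOrder.sum {n : ℕ} {ι : Type*} {φ : ι → ℝ → V.Limit → V.Limit} (s : Finset ι)
    (h : ∀ i ∈ s, V.IsOrder I n (φ i)) : V.IsOrder I n fun t v => ∑ i ∈ s, φ i t v := by
  classical
  induction s using Finset.induction_on with
  | empty => simpa using isOrder_zero n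
  | insert i s hi ih =>
    simp only [Finset.sum_insert hi]
    exact (h i (Finset.mem_insert_self i s)).add
      (ih fun j hj => h j (Finset.mem_insert_of_mem hj))

theorem isOrder_id : V.IsOrder I 1 fun _ v => v :=
  fun l => ⟨l, fun _ _ _ => ⟨1, 1, one_pos, fun _ _ _ _ => by simp⟩⟩

theorem exists_one_add_abs_pow_le {K : Set ℝ} (hK : IsCompact K) (r : ℕ) :
    ∃ B : ℝ, 0 < B ∧ ∀ t ∈ K, (1 + |t|) ^ r ≤ B := by
  obtain ⟨R, hR⟩ := hK.isBounded.exists_norm_le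
  refine ⟨(1 + |R|) ^ r, by positivity, fun t ht => ?_⟩
  have : |t| ≤ |R| := (hR t ht).trans (le_abs_self R)
  gcongr

/-- Orders of vanishing add up in a product. -/
theorem TameMult.isOrder {m : ℕ} {M : ℝ → V.Mult m} (hM : V.TameMult I M) {n : Fin m → ℕ}
    {φ : Fin m → ℝ → V.Limit → V.Limit} (hφ : ∀ a, V.IsOrder I (n a) (φ a)) :
    V.IsOrder I (∑ a, n a) fun t v => M t fun a => φ a t v := by
  intro l
  obtain ⟨k, r, C, hC, h⟩ := (hM 0).bound l
  choose K₀ hK₀ using fun a => (hφ a).exists_of_le k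
  obtain ⟨K, hK⟩ := (Set.finite_range K₀).bddAbove
  refine ⟨K, fun S hSI hS => ?_⟩
  choose D δ hD hδ hφ' using fun a => hK₀ a K (hK (mem_range_self a)) S hSI hS
  obtain ⟨B, hB, hBt⟩ := exists_one_add_abs_pow_le hS r
  obtain ⟨ε, hε, hεδ⟩ : ∃ ε > 0, ∀ a, ε ≤ δ a := by
    rcases isEmpty_or_nonempty (Fin m) with hm | hm
    · exact ⟨1, one_pos, fun a => hm.elim a⟩
    · obtain ⟨a, ha⟩ := Finite.exists_min δ
      exact ⟨δ a, hδ a, ha⟩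
  refine ⟨C * B * ∏ a, D a, ε, hε, fun t ht v hv => (h _ t (hSI ht)).trans ?_⟩
  calc C * (1 + |t|) ^ r * ∏ a, ‖V.proj k (φ a t v)‖
      ≤ C * B * ∏ a, (D a * ‖V.proj K v‖ ^ n a) := by
        gcongr with a
        · exact hBt t ht
        · exact hφ' a t ht v (hv.trans_le (hεδ a))
    _ = _ := by
        rw [Finset.prod_mul_distrib, Finset.prod_pow_eq_pow_sum]
        ring

/-- The increment of a nonlinearity whose derivative is `O(‖v‖)` gains one order. -/
theorem DerivIsOrderOne.isOrder_sub {f : ℝ → V.Limit → V.Limit} (hf : V.DerivIsOrderOne I f)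
    {n : ℕ} {φ ψ : ℝ → V.Limit → V.Limit} (hφ : V.IsOrder I 1 φ) (hψ : V.IsOrder I 1 ψ)
    (hsub : V.IsOrder I n fun t v => φ t v - ψ t v) :
    V.IsOrder I (n + 1) fun t v => f t (φ t v) - f t (ψ t v) := by
  intro l
  obtain ⟨k, g, hg, hgd, hgb⟩ := hf l
  obtain ⟨k₁, h₁⟩ := hφ.exists_of_le k
  obtain ⟨k₂, h₂⟩ := hψ.exists_of_le k
  obtain ⟨k₃, h₃⟩ := hsub.exists_of_le k
  refine ⟨max k₁ (max k₂ k₃), fun S hSI hS => ?_⟩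
  obtain ⟨C, δ, hδ, hgb⟩ := hgb S hSI hS
  obtain ⟨C₁, δ₁, hC₁, hδ₁, h₁⟩ := h₁ _ (le_max_left _ _) S hSI hS
  obtain ⟨C₂, δ₂, hC₂, hδ₂, h₂⟩ := h₂ _ (by omega : max k₁ (max k₂ k₃) ≥ k₂) S hSI hS
  obtain ⟨C₃, δ₃, hC₃, hδ₃, h₃⟩ := h₃ _ (by omega : max k₁ (max k₂ k₃) ≥ k₃) S hSI hS
  set K := max k₁ (max k₂ k₃)
  refine ⟨|C| * (C₁ + C₂) * C₃, min (min δ₁ δ₂) (min δ₃ (δ / (C₁ + C₂ + 1))), by positivity,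
    fun t ht v hv => ?_⟩
  simp only [lt_min_iff] at hv
  obtain ⟨⟨hv1, hv2⟩, hv3, hv4⟩ := hv
  set x := ‖V.proj K v‖ with hx
  have hx0 : 0 ≤ x := norm_nonneg _
  have hρ : (C₁ + C₂) * x < δ := by
    rw [lt_div_iff₀ (by positivity)] at hv4
    nlinarith
  have b1 := h₁ t ht v hv1
  have b2 := h₂ t ht v hv2
  rw [pow_one] at b1 b2
  -- the mean value inequality on a ball that contains both values
  have hmv := (convex_closedBall (0 : V.X k) ((C₁ + C₂) * x)).norm_image_sub_le_of_norm_fderiv_le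
    (𝕜 := 𝕜) (f := g t) (C := |C| * ((C₁ + C₂) * x)) (x := V.proj k (ψ t v))
    (y := V.proj k (φ t v)) (fun y _ => hgd t (hSI ht) y) (fun y hy => ?_) ?_ ?_
  · rw [map_sub, ← hg t (hSI ht), ← hg t (hSI ht)]
    refine hmv.trans ?_
    rw [← map_sub]
    calc |C| * ((C₁ + C₂) * x) * ‖V.proj k (φ t v - ψ t v)‖
        ≤ |C| * ((C₁ + C₂) * x) * (C₃ * x ^ n) := by
          gcongr
          exact h₃ t ht v hv3
      _ = _ := by ring
  · rw [mem_closedBall_zero_iff] at hy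
    refine (hgb t ht y (hy.trans_lt hρ)).trans ?_
    gcongr
    exact le_abs_self C
  · rw [mem_closedBall_zero_iff]
    nlinarith
  · rw [mem_closedBall_zero_iff]
    nlinarith

end NestedBanach

/-! ### Taylor expansion of smooth maps -/

/-- Partial derivatives as restrictions of the total derivative. -/
theorem iteratedFDeriv_prodMk_left {E F : Type*} [NormedAddCommGroup E] [NormedSpace ℝ E]
    [NormedAddCommGroup F] [NormedSpace ℝ F] {I : Set ℝ} (hI : IsOpen I) {n : ℕ} {G : ℝ × E → F}
    (hG : ContDiffOn ℝ n G (I ×ˢ univ)) {t : ℝ} (ht : t ∈ I) (y : E) {i : ℕ} (hi : i ≤ n) :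
    iteratedFDeriv ℝ i (fun x => G (t, x)) y =
      (iteratedFDeriv ℝ i G (t, y)).compContinuousLinearMap
        fun _ => ContinuousLinearMap.inr ℝ ℝ E := by
  set s : Set (ℝ × E) := (fun z => (t, 0) + z) ⁻¹' (I ×ˢ univ) with hs
  have hso : IsOpen s := (hI.prod isOpen_univ).preimage (continuous_const.add continuous_id)
  have hG' : ContDiffOn ℝ n (fun z => G ((t, 0) + z)) s :=
    hG.comp (contDiff_const.add contDiff_id).contDiffOn fun z hz => hz
  have hmem : ∀ x : E, ContinuousLinearMap.inr ℝ ℝ E x ∈ s := fun x => by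
    simp [hs, ht]
  have hpre : ContinuousLinearMap.inr ℝ ℝ E ⁻¹' s = univ := eq_univ_of_forall hmem
  have h := (ContinuousLinearMap.inr ℝ ℝ E).iteratedFDerivWithin_comp_right hG' hso.uniqueDiffOn
    (by rw [hpre]; exact uniqueDiffOn_univ) (hmem y) (i := i) (by exact_mod_cast hi)
  rw [hpre, iteratedFDerivWithin_univ, iteratedFDerivWithin_of_isOpen i hso (hmem y),
    iteratedFDeriv_comp_add_left] at h
  have e : (fun z => G ((t, 0) + z)) ∘ ContinuousLinearMap.inr ℝ ℝ E = fun x => G (t, x) := by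
    funext x
    simp
  rw [e] at h
  simpa using h

/-- Iterated derivatives along a line through the origin. -/
theorem iteratedDeriv_smul_right {𝕜 E F : Type*} [RCLike 𝕜] [NormedAddCommGroup E]
    [NormedSpace 𝕜 E] [NormedAddCommGroup F] [NormedSpace 𝕜 F] {n : ℕ} {g : E → F}
    (hg : ContDiff 𝕜 n g) (x : E) (s : 𝕜) {i : ℕ} (hi : i ≤ n) :
    iteratedDeriv i (fun s : 𝕜 => g (s • x)) s = iteratedFDeriv 𝕜 i g (s • x) fun _ => x := by
  have h := (ContinuousLinearMap.toSpanSingleton 𝕜 x).iteratedFDeriv_comp_right hg s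
    (i := i) (by exact_mod_cast hi)
  rw [iteratedDeriv]
  have e : (fun s : 𝕜 => g (s • x)) = g ∘ ContinuousLinearMap.toSpanSingleton 𝕜 x := by
    funext s
    simp
  rw [e, h]
  simp

namespace NestedBanach

variable {𝕜 : Type u} [RCLike 𝕜] {V : NestedBanach.{u, w} 𝕜} {I : Set ℝ}

/-- The derivatives at `0` of two extensions of the same map agree on `V_∞`. -/
theorem iteratedFDeriv_eq_of_extends {F : Type*} [NormedAddCommGroup F] [NormedSpace 𝕜 F]
    {k k' m : ℕ} {g : V.X k → F} {g' : V.X k' → F} (hg : ContDiff 𝕜 m g) (hg' : ContDiff 𝕜 m g')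
    (h : ∀ v, g (V.proj k v) = g' (V.proj k' v)) (x : Fin m → V.Limit) :
    iteratedFDeriv 𝕜 m g 0 (fun a => V.proj k (x a)) =
      iteratedFDeriv 𝕜 m g' 0 (fun a => V.proj k' (x a)) := by
  have e : g ∘ V.inclOfLE (le_max_left k k') = g' ∘ V.inclOfLE (le_max_right k k') := by
    refine (V.dense (max k k')).equalizer (hg.continuous.comp (V.inclOfLE _).continuous)
      (hg'.continuous.comp (V.inclOfLE _).continuous) (funext fun v => ?_)
    simp [h]
  have h1 := (V.inclOfLE (le_max_left k k')).iteratedFDeriv_comp_right hg 0 (i := m) le_rfl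
  have h2 := (V.inclOfLE (le_max_right k k')).iteratedFDeriv_comp_right hg' 0 (i := m) le_rfl
  rw [e, h2] at h1
  have h3 := congrArg (fun Λ => Λ fun a => V.proj (max k k') (x a)) h1
  simpa using h3.symm

/-- The derivative of order `m` at `0` of a smooth map, as a multilinear map on `V_∞`. It does not
depend on the extension that is differentiated, so the derivatives in the single spaces are
compatible with the inclusions. -/
theorem SmoothMap.exists_deriv_at_zero {φ : ℝ → V.Limit → V.Limit} (hφ : V.SmoothMap I φ)
    (m : ℕ) {t : ℝ} (ht : t ∈ I) : ∃ D : V.Mult m, ∀ (k l : ℕ) (g : V.X k → V.X l),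
      ContDiff 𝕜 m g → (∀ v, g (V.proj k v) = V.proj l (φ t v)) →
      ∀ x, V.proj l (D x) = iteratedFDeriv 𝕜 m g 0 fun a => V.proj k (x a) := by
  choose k g hg hgn hgt using fun l => hφ m l
  have hcoh : ∀ x : Fin m → V.Limit,
      (fun l => iteratedFDeriv 𝕜 m (g l t) 0 fun a => V.proj (k l) (x a)) ∈ V.Limit := by
    intro x l
    have h1 := (V.incl l).iteratedFDeriv_comp_left ((hgt (l + 1) t ht).contDiffAt (x := 0))
      (i := m) le_rfl
    have h2 := iteratedFDeriv_eq_of_extends (V := V)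
      ((V.incl l).contDiff.comp (hgt (l + 1) t ht)) (hgt l t ht)
      (fun v => by simp only [Function.comp_apply, hg _ t ht, V.incl_proj]) x
    rw [h1] at h2
    exact h2
  refine ⟨⟨fun x => ⟨_, hcoh x⟩, fun x a y z => ?_, fun x a c y => ?_⟩,
    fun K l g' hg' hgφ x => ?_⟩
  · refine V.ext_proj fun l => ?_
    rw [map_add]
    change iteratedFDeriv 𝕜 m (g l t) 0 _ =
      iteratedFDeriv 𝕜 m (g l t) 0 _ + iteratedFDeriv 𝕜 m (g l t) 0 _
    have hu (v : V.Limit) : (fun b => V.proj (k l) (Function.update x a v b)) =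
        Function.update (fun b => V.proj (k l) (x b)) a (V.proj (k l) v) := by
      exact Function.comp_update (V.proj (k l)) x a v
    rw [hu, hu, hu, map_add, ContinuousMultilinearMap.map_update_add]
  · refine V.ext_proj fun l => ?_
    rw [map_smul]
    change iteratedFDeriv 𝕜 m (g l t) 0 _ = c • iteratedFDeriv 𝕜 m (g l t) 0 _
    have hu (v : V.Limit) : (fun b => V.proj (k l) (Function.update x a v b)) =
        Function.update (fun b => V.proj (k l) (x b)) a (V.proj (k l) v) := by
      exact Function.comp_update (V.proj (k l)) x a v
    rw [hu, hu, map_smul, ContinuousMultilinearMap.map_update_smul]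
  · exact iteratedFDeriv_eq_of_extends (hgt l t ht) hg'
      (fun v => by rw [hg l t ht, hgφ]) x

open Classical in
/-- The Taylor coefficient of degree `m` at `0` of a smooth map: a symmetric multilinear map
whose value at `(v, …, v)` is the homogeneous part of degree `m`. The average over permutations
makes it symmetric by definition. -/
noncomputable def taylorMult (I : Set ℝ) (φ : ℝ → V.Limit → V.Limit) (m : ℕ) (t : ℝ) : V.Mult m :=
  if h : V.SmoothMap I φ ∧ t ∈ I then
    ((m.factorial : 𝕜)⁻¹ * (m.factorial : 𝕜)⁻¹) • ∑ σ : Equiv.Perm (Fin m),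
      (h.1.exists_deriv_at_zero m h.2).choose.domDomCongr σ
  else 0

theorem taylorMult_comp_perm (φ : ℝ → V.Limit → V.Limit) (m : ℕ) (t : ℝ)
    (x : Fin m → V.Limit) (σ : Equiv.Perm (Fin m)) :
    taylorMult I φ m t (x ∘ σ) = taylorMult I φ m t x := by
  unfold taylorMult
  split_ifs with h
  · simp only [smul_apply, sum_apply, MultilinearMap.domDomCongr_apply]
    congr 1
    refine Fintype.sum_equiv (Equiv.mulLeft σ) _ _ fun τ => ?_
    rfl
  · rfl

theorem SmoothMap.proj_taylorMult {φ : ℝ → V.Limit → V.Limit} (hφ : V.SmoothMap I φ) {m : ℕ}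
    {t : ℝ} (ht : t ∈ I) {k l : ℕ} {g : V.X k → V.X l} (hg : ContDiff 𝕜 m g)
    (h : ∀ v, g (V.proj k v) = V.proj l (φ t v)) (v : V.Limit) :
    V.proj l (taylorMult I φ m t fun _ => v) =
      (m.factorial : 𝕜)⁻¹ • iteratedFDeriv 𝕜 m g 0 fun _ => V.proj k v := by
  have hs := (hφ.exists_deriv_at_zero m ht).choose_spec k l g hg h fun _ => v
  have hm : (m.factorial : 𝕜) ≠ 0 := by exact_mod_cast m.factorial_ne_zero
  rw [taylorMult, dif_pos ⟨hφ, ht⟩]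
  simp only [smul_apply, sum_apply, MultilinearMap.domDomCongr_apply,
    Finset.sum_const, Finset.card_univ, Fintype.card_perm, Fintype.card_fin]
  rw [map_smul, map_nsmul, hs, ← Nat.cast_smul_eq_nsmul 𝕜, smul_smul, mul_assoc,
    inv_mul_cancel₀ hm, mul_one]

theorem SmoothMap.continuous_taylorMult {φ : ℝ → V.Limit → V.Limit} (hφ : V.SmoothMap I φ)
    (m : ℕ) {t : ℝ} (ht : t ∈ I) (l : ℕ) :
    Continuous fun v => V.proj l (taylorMult I φ m t fun _ => v) := by
  obtain ⟨k, g, hg, -, hgt⟩ := hφ m l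
  simp only [hφ.proj_taylorMult ht (hgt t ht) (hg t ht)]
  exact ((iteratedFDeriv 𝕜 m (g t) 0).cont.comp
    (continuous_pi fun _ => V.continuous_proj k)).const_smul _

theorem SmoothMap.proj_taylorMult_eq_iteratedDeriv {φ : ℝ → V.Limit → V.Limit}
    (hφ : V.SmoothMap I φ) (m : ℕ) {t : ℝ} (ht : t ∈ I) (l : ℕ) (h : V.Limit) :
    V.proj l (taylorMult I φ m t fun _ => h) =
      (m.factorial : 𝕜)⁻¹ • iteratedDeriv m (fun s : 𝕜 => V.proj l (φ t (s • h))) 0 := by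
  obtain ⟨k, g, hg, -, hgt⟩ := hφ m l
  rw [hφ.proj_taylorMult ht (hgt t ht) (hg t ht)]
  have := iteratedDeriv_smul_right (hgt t ht) (V.proj k h) 0 (i := m) le_rfl
  rw [zero_smul] at this
  rw [← this]
  simp only [← map_smul, hg t ht]

/-- The Taylor coefficients in terms of a total derivative over the reals. -/
theorem SmoothMap.proj_taylorMult_eq_real (hI : IsOpen I) {φ : ℝ → V.Limit → V.Limit}
    (hφ : V.SmoothMap I φ) {m n : ℕ} (hm : m ≤ n) {k l : ℕ} {g : ℝ → V.X k → V.X l}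
    (hg : ∀ t ∈ I, ∀ v, g t (V.proj k v) = V.proj l (φ t v))
    (hgn : ContDiffOn ℝ n (fun z : ℝ × V.X k => g z.1 z.2) (I ×ˢ univ))
    (hgt : ∀ t ∈ I, ContDiff 𝕜 n (g t)) {t : ℝ} (ht : t ∈ I) (v : V.Limit) :
    V.proj l (taylorMult I φ m t fun _ => v) = (m.factorial : ℝ)⁻¹ •
      iteratedFDeriv ℝ m (fun z : ℝ × V.X k => g z.1 z.2) (t, 0) fun _ => (0, V.proj k v) := by
  have hgm : ContDiff 𝕜 m (g t) := (hgt t ht).of_le (by exact_mod_cast hm)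
  rw [hφ.proj_taylorMult ht hgm (hg t ht), RCLike.real_smul_eq_coe_smul (K := 𝕜)]
  have h1 := hgm.contDiffAt.restrictScalars_iteratedFDeriv (𝕜 := ℝ) (x := (0 : V.X k))
  have h2 := iteratedFDeriv_prodMk_left hI hgn ht (0 : V.X k) hm
  have h3 := congrArg (fun Λ => Λ fun _ => V.proj k v) (h1.trans h2)
  simp only [Function.comp_apply, ContinuousMultilinearMap.coe_restrictScalars,
    ContinuousMultilinearMap.compContinuousLinearMap_apply, ContinuousLinearMap.inr_apply] at h3
  rw [h3]
  simp

theorem SmoothMap.smoothCurve_taylorMult (hI : IsOpen I) {φ : ℝ → V.Limit → V.Limit}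
    (hφ : V.SmoothMap I φ) (m : ℕ) (v : V.Limit) :
    V.SmoothCurve I fun t => taylorMult I φ m t fun _ => v := by
  refine fun l => contDiffOn_infty.2 fun n => ?_
  obtain ⟨k, g, hg, hgn, hgt⟩ := hφ (n + m) l
  refine ContDiffOn.congr ?_ fun t ht =>
    hφ.proj_taylorMult_eq_real hI (Nat.le_add_left m n) hg hgn hgt ht v
  refine contDiffOn_const.smul fun t ht => ContDiffAt.contDiffWithinAt ?_
  have h1 : ContDiffAt ℝ (n + m : ℕ) (fun z : ℝ × V.X k => g z.1 z.2) (t, 0) :=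
    hgn.contDiffAt ((hI.prod isOpen_univ).mem_nhds ⟨ht, mem_univ _⟩)
  have h2 := h1.iteratedFDeriv_right (i := m) (m := n) (by norm_cast)
  have h3 : ContDiffAt ℝ n (fun s : ℝ => iteratedFDeriv ℝ m
      (fun z : ℝ × V.X k => g z.1 z.2) (s, 0)) t :=
    h2.comp t (contDiff_id.prodMk contDiff_const).contDiffAt
  exact (ContinuousMultilinearMap.apply ℝ (fun _ : Fin m => ℝ × V.X k) (V.X l)
    fun _ => (0, V.proj k v)).contDiff.contDiffAt.comp t h3

/-- Taylor's theorem, uniformly for time in compact sets. -/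
theorem SmoothMap.isOrder_sub_taylorMult (hI : IsOpen I) {φ : ℝ → V.Limit → V.Limit}
    (hφ : V.SmoothMap I φ) (n : ℕ) :
    V.IsOrder I (n + 1) fun t v =>
      φ t v - ∑ m ∈ Finset.range (n + 1), taylorMult I φ m t fun _ => v := by
  intro l
  obtain ⟨k, g, hg, hgn, hgt⟩ := hφ (n + 1) l
  set G := fun z : ℝ × V.X k => g z.1 z.2 with hG
  have hcont : ContinuousOn (iteratedFDeriv ℝ (n + 1) G) (I ×ˢ univ) := by
    refine (hgn.continuousOn_iteratedFDerivWithin le_rfl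
      (hI.prod isOpen_univ).uniqueDiffOn).congr fun z hz => ?_
    exact (iteratedFDerivWithin_of_isOpen (n + 1) (hI.prod isOpen_univ) hz).symm
  refine ⟨k, fun K hKI hK => ?_⟩
  -- continuity bounds the derivative near each point of `K × {0}`, and compactness makes the bound
  -- uniform
  obtain ⟨C, δ, hδ, hC⟩ : ∃ C δ : ℝ, 0 < δ ∧ ∀ t ∈ K, ∀ x, ‖x‖ < δ →
      ‖iteratedFDeriv ℝ (n + 1) G (t, x)‖ ≤ C := by
    refine hK.induction_on (p := fun S => ∃ C δ : ℝ, 0 < δ ∧ ∀ t ∈ S, ∀ x, ‖x‖ < δ →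
      ‖iteratedFDeriv ℝ (n + 1) G (t, x)‖ ≤ C) ⟨0, 1, one_pos, by simp⟩ ?_ ?_ ?_
    · rintro S T hST ⟨C, δ, hδ, h⟩
      exact ⟨C, δ, hδ, fun t ht => h t (hST ht)⟩
    · rintro S T ⟨C, δ, hδ, h⟩ ⟨C', δ', hδ', h'⟩
      refine ⟨max C C', min δ δ', lt_min hδ hδ', fun t ht x hx => ?_⟩
      rcases ht with ht | ht
      · exact (h t ht x (hx.trans_le (min_le_left _ _))).trans (le_max_left _ _)
      · exact (h' t ht x (hx.trans_le (min_le_right _ _))).trans (le_max_right _ _)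
    · intro t ht
      have hnhds := (hI.prod isOpen_univ).mem_nhds
        (show (t, (0 : V.X k)) ∈ I ×ˢ univ from ⟨hKI ht, mem_univ _⟩)
      have h1 := ((hcont.continuousAt hnhds).norm.eventually_lt continuousAt_const
        (lt_add_one ‖iteratedFDeriv ℝ (n + 1) G (t, 0)‖))
      obtain ⟨ε, hε, hball⟩ := Metric.eventually_nhds_iff.1 h1
      refine ⟨Metric.ball t ε, mem_nhdsWithin_of_mem_nhds (Metric.ball_mem_nhds t hε),
        ‖iteratedFDeriv ℝ (n + 1) G (t, 0)‖ + 1, ε, hε, fun s hs x hx => ?_⟩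
      refine (hball (y := (s, x)) ?_).le
      rw [Prod.dist_eq]
      exact max_lt hs (by simpa using hx)
  refine ⟨C / (n.factorial : ℝ), δ, hδ, fun t ht v hv => ?_⟩
  have htI := hKI ht
  set x := V.proj k v with hx
  have hgR : ContDiff ℝ (n + 1 : ℕ) (g t) := (hgt t htI).restrict_scalars ℝ
  -- the derivatives along the line through `x`
  have hder : ∀ i ≤ n + 1, ∀ s : ℝ, iteratedDeriv i (fun s : ℝ => g t (s • x)) s =
      iteratedFDeriv ℝ i G (t, s • x) fun _ => (0, x) := by
    intro i hi s
    rw [iteratedDeriv_smul_right hgR x s hi]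
    have := iteratedFDeriv_prodMk_left hI hgn htI (s • x) hi
    rw [show g t = fun x => G (t, x) from rfl, this]
    simp
  have hu : ContDiff ℝ (n + 1 : ℕ) fun s : ℝ => g t (s • x) :=
    hgR.comp (contDiff_id.smul contDiff_const)
  have hwithin : ∀ i ≤ n + 1, ∀ s ∈ Icc (0 : ℝ) 1,
      iteratedDerivWithin i (fun s : ℝ => g t (s • x)) (Icc 0 1) s =
        iteratedFDeriv ℝ i G (t, s • x) fun _ => (0, x) := by
    intro i hi s hs
    rw [iteratedDerivWithin_eq_iteratedDeriv (uniqueDiffOn_Icc one_pos)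
      ((hu.of_le (by exact_mod_cast hi)).contDiffAt) hs, hder i hi s]
  have hT := taylor_mean_remainder_bound (n := n) (x := 1) (C := C * ‖x‖ ^ (n + 1)) zero_le_one
    (f := fun s : ℝ => g t (s • x)) (by exact_mod_cast hu.contDiffOn) ⟨zero_le_one, le_rfl⟩
    fun s hs => ?_
  · rw [taylor_within_apply] at hT
    simp only [one_smul, sub_zero, one_pow, mul_one] at hT
    have e : V.proj l (φ t v - ∑ m ∈ Finset.range (n + 1), taylorMult I φ m t fun _ => v) =
        g t x - ∑ m ∈ Finset.range (n + 1), (m.factorial : ℝ)⁻¹ •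
          iteratedDerivWithin m (fun s : ℝ => g t (s • x)) (Icc 0 1) 0 := by
      rw [map_sub, map_sum, ← hg t htI]
      congr 1
      refine Finset.sum_congr rfl fun m hm => ?_
      have hm' : m ≤ n + 1 := (Finset.mem_range.1 hm).le
      rw [hφ.proj_taylorMult_eq_real hI hm' hg hgn hgt htI v,
        hwithin m hm' 0 ⟨le_rfl, zero_le_one⟩, zero_smul]
    rw [e, div_mul_eq_mul_div]
    exact hT
  · rw [hwithin (n + 1) le_rfl s hs]
    refine (ContinuousMultilinearMap.le_opNorm _ _).trans ?_
    have hn : ‖((0 : ℝ), x)‖ = ‖x‖ := by simp [Prod.norm_def]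
    rw [Finset.prod_const, Finset.card_univ, Fintype.card_fin, hn]
    gcongr
    refine hC t ht _ (lt_of_le_of_lt ?_ hv)
    rw [norm_smul, Real.norm_of_nonneg hs.1]
    exact mul_le_of_le_one_left (norm_nonneg _) hs.2

end NestedBanach

/-! ### Polarization and uniform boundedness -/

/-- Polarization with an arbitrary base point `h`. Each term on the left is a sum over the functions
`r` that choose for each argument either `h` or one of the `x i` with `i ∉ S`. Inclusion-exclusion
over `S` leaves the `r` that attain all indices, which are the permutations. -/
theorem MultilinearMap.polarization {R E F : Type*} [CommRing R] [AddCommGroup E] [Module R E]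
    [AddCommGroup F] [Module R F] {n : ℕ} (M : MultilinearMap R (fun _ : Fin n => E) F) (h : E)
    (x : Fin n → E) :
    ∑ S : Finset (Fin n), ((-1 : ℤ) ^ S.card) • M (fun _ => h + ∑ i ∈ Sᶜ, x i) =
      ∑ σ : Equiv.Perm (Fin n), M (x ∘ σ) := by
  classical
  set y : Option (Fin n) → E := fun o => o.elim h x with hy
  set T : (Fin n → Option (Fin n)) → Finset (Fin n) :=
    fun r => Finset.univ.filter fun i => ∀ a, r a ≠ some i with hT
  have h1 : ∀ S : Finset (Fin n), M (fun _ => h + ∑ i ∈ Sᶜ, x i) =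
      ∑ r : Fin n → Option (Fin n), if S ⊆ T r then M (fun a => y (r a)) else 0 := by
    intro S
    have e : (fun _ : Fin n => h + ∑ i ∈ Sᶜ, x i) =
        fun _ => ∑ o ∈ Finset.insertNone Sᶜ, y o := by
      funext _
      rw [Finset.sum_insertNone]
      rfl
    rw [e, MultilinearMap.map_sum_finset, ← Finset.sum_filter]
    refine Finset.sum_congr (Finset.ext fun r => ?_) fun _ _ => rfl
    simp only [Fintype.mem_piFinset, Finset.mem_insertNone, Finset.mem_compl, hT,
      Finset.mem_filter, Finset.mem_univ, true_and, Finset.subset_iff]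
    exact ⟨fun H i hi a ha => H a i ha hi, fun H a i hi hS => H hS a hi⟩
  have h2 : ∀ r : Fin n → Option (Fin n),
      (∑ S : Finset (Fin n), ((-1 : ℤ) ^ S.card) •
        if S ⊆ T r then M (fun a => y (r a)) else 0) =
        if T r = ∅ then M (fun a => y (r a)) else 0 := by
    intro r
    have : ∀ S : Finset (Fin n), (((-1 : ℤ) ^ S.card) •
        if S ⊆ T r then M (fun a => y (r a)) else 0) =
        if S ∈ (T r).powerset then ((-1 : ℤ) ^ S.card) • M (fun a => y (r a)) else 0 := by
      intro S
      simp only [Finset.mem_powerset]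
      split_ifs <;> simp
    simp only [this]
    rw [Finset.sum_ite_mem, Finset.univ_inter, ← Finset.sum_smul,
      Finset.sum_powerset_neg_one_pow_card]
    split_ifs <;> simp
  simp only [h1, Finset.smul_sum]
  rw [Finset.sum_comm]
  simp only [h2]
  rw [← Finset.sum_filter]
  symm
  refine Finset.sum_bij (fun (σ : Equiv.Perm (Fin n)) _ a => some (σ a)) (fun σ _ => ?_)
    (fun σ _ τ _ hστ => ?_) (fun r hr => ?_) fun σ _ => ?_
  · simp only [Finset.mem_filter, Finset.mem_univ, true_and, hT, Finset.filter_eq_empty_iff]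
    intro i _ H
    exact H (σ.symm i) (by simp)
  · ext a
    have := congrFun hστ a
    simpa using congrArg Fin.val (Option.some.inj this)
  · simp only [Finset.mem_filter, Finset.mem_univ, true_and, hT, Finset.filter_eq_empty_iff,
      not_forall, not_not, forall_const] at hr
    choose τ hτ using fun i => hr (x := i)
    have hinj : Function.Injective τ := fun i j hij => by
      have := hτ i
      rw [hij, hτ j] at this
      exact (Option.some.inj this).symm
    let e := Equiv.ofBijective τ (Finite.injective_iff_bijective.1 hinj)
    refine ⟨e.symm, Finset.mem_univ _, funext fun a => ?_⟩
    rw [← hτ (e.symm a)]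
    exact congrArg r (e.apply_symm_apply a)
  · rfl

/-- Polarization of a symmetric multilinear map. -/
theorem MultilinearMap.polarization_of_symm {R E F : Type*} [CommRing R] [AddCommGroup E]
    [Module R E] [AddCommGroup F] [Module R F] {n : ℕ} (M : MultilinearMap R (fun _ : Fin n => E) F)
    (hM : ∀ x (σ : Equiv.Perm (Fin n)), M (x ∘ σ) = M x) (h : E) (x : Fin n → E) :
    n.factorial • M x =
      ∑ S : Finset (Fin n), ((-1 : ℤ) ^ S.card) • M (fun _ => h + ∑ i ∈ Sᶜ, x i) := by
  rw [M.polarization]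
  simp [hM, Fintype.card_perm]

instance BanachTower.baireSpace_limit {𝕜 : Type u} [RCLike 𝕜] (V : BanachTower.{u, w} 𝕜) :
    BaireSpace V.Limit := by
  have := V.isClosed_limit.isCompletelyPseudoMetrizableSpace
  exact BaireSpace.of_completelyPseudoMetrizable (X := (V.Limit : Set (∀ k, V.X k)))

namespace NestedBanach

variable {𝕜 : Type u} [RCLike 𝕜] {V : NestedBanach.{u, w} 𝕜} {I : Set ℝ}

/-- A uniform boundedness principle for symmetric multilinear maps: a bound for every vector on
the diagonal, with constants that may depend on the vector, implies a uniform bound. By the Baire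
category theorem, one of the bounds holds in an open set, and polarization around a point of this
set carries it over to small vectors off the diagonal. -/
theorem exists_uniform_bound {F : Type*} [NormedAddCommGroup F] [NormedSpace 𝕜 F] {n : ℕ}
    {ι : Type*} (B : ι → MultilinearMap 𝕜 (fun _ : Fin n => V.Limit) F)
    (hsymm : ∀ i x (σ : Equiv.Perm (Fin n)), B i (x ∘ σ) = B i x)
    (hcont : ∀ i, Continuous fun h => B i fun _ => h) (ρ : ℕ → ι → ℝ)
    (hρ : ∀ N i, 0 ≤ ρ N i) (hB : ∀ h, ∃ N, ∀ i, ‖B i fun _ => h‖ ≤ ρ N i) :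
    ∃ N k : ℕ, ∃ C : ℝ, 0 ≤ C ∧ ∀ i x, ‖B i x‖ ≤ C * ρ N i * ∏ a, ‖V.proj k (x a)‖ := by
  set E : ℕ → Set V.Limit := fun N => {h | ∀ i, ‖B i fun _ => h‖ ≤ ρ N i} with hE
  have hEc : ∀ N, IsClosed (E N) := fun N => by
    have : E N = ⋂ i, {h | ‖B i fun _ => h‖ ≤ ρ N i} := by
      ext h
      simp [hE]
    rw [this]
    exact isClosed_iInter fun i => isClosed_le (hcont i).norm continuous_const
  have hEu : ⋃ N, E N = univ := eq_univ_of_forall fun h => by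
    obtain ⟨N, hN⟩ := hB h
    exact mem_iUnion.2 ⟨N, hN⟩
  obtain ⟨N, h₀, hh₀⟩ := nonempty_interior_of_iUnion_of_closed hEc hEu
  obtain ⟨k, ε, hε, hball⟩ := V.exists_ball_subset (mem_interior_iff_mem_nhds.1 hh₀)
  set c : ℝ := ε / (n + 1) with hc
  have hc0 : 0 < c := by positivity
  -- the bound for small vectors, by polarization around `h₀`
  have small : ∀ i x, (∀ a, ‖V.proj k (x a)‖ ≤ c) → ‖B i x‖ ≤ 2 ^ n * ρ N i := by
    intro i x hx
    have hpol := (B i).polarization_of_symm (hsymm i) h₀ x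
    have h1 : ‖B i x‖ ≤ ‖n.factorial • B i x‖ := by
      rw [← Nat.cast_smul_eq_nsmul 𝕜, norm_smul, RCLike.norm_natCast]
      exact le_mul_of_one_le_left (norm_nonneg _)
        (by exact_mod_cast Nat.one_le_iff_ne_zero.2 n.factorial_ne_zero)
    refine h1.trans ?_
    rw [hpol]
    refine (norm_sum_le _ _).trans ?_
    have h2 : ∀ S : Finset (Fin n),
        ‖((-1 : ℤ) ^ S.card) • B i (fun _ => h₀ + ∑ i ∈ Sᶜ, x i)‖ ≤ ρ N i := by
      intro S
      have h3 : ‖((-1 : ℤ) ^ S.card) • B i (fun _ => h₀ + ∑ i ∈ Sᶜ, x i)‖ =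
          ‖B i (fun _ => h₀ + ∑ i ∈ Sᶜ, x i)‖ := by
        rcases neg_one_pow_eq_or ℤ S.card with h | h <;> simp [h]
      rw [h3]
      refine hball _ ?_ i
      rw [add_sub_cancel_left, map_sum]
      refine (norm_sum_le _ _).trans ((Finset.sum_le_sum fun a _ => hx a).trans ?_)
      rw [Finset.sum_const, nsmul_eq_mul, hc, mul_div_assoc', div_le_iff₀ (by positivity)]
      have : ((Sᶜ).card : ℝ) ≤ n := by
        exact_mod_cast (Finset.card_le_univ _).trans_eq (Fintype.card_fin n)
      nlinarith
    refine (Finset.sum_le_sum fun S _ => h2 S).trans (le_of_eq ?_)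
    rw [Finset.sum_const, Finset.card_univ, Fintype.card_finset, Fintype.card_fin, nsmul_eq_mul]
    simp
  refine ⟨N, k, 2 ^ n * (c⁻¹) ^ n, by positivity, fun i x => ?_⟩
  by_cases hx : ∃ a, V.proj k (x a) = 0
  · obtain ⟨a, ha⟩ := hx
    have ha0 : x a = 0 := V.proj_injective k (by rw [ha, map_zero])
    rw [(B i).map_coord_zero a ha0, norm_zero]
    have := hρ N i
    have hP : 0 ≤ ∏ a, ‖V.proj k (x a)‖ := Finset.prod_nonneg fun _ _ => norm_nonneg _
    positivity
  · push Not at hx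
    have hn : ∀ a, (0 : ℝ) < ‖V.proj k (x a)‖ := fun a => norm_pos_iff.2 (hx a)
    -- scale each argument to the norm `c`
    set y : Fin n → V.Limit := fun a => ((c / ‖V.proj k (x a)‖ : ℝ) : 𝕜) • x a with hy
    have hyc : ∀ a, ‖V.proj k (y a)‖ ≤ c := by
      intro a
      rw [hy, map_smul, norm_smul, RCLike.norm_ofReal, abs_of_pos (div_pos hc0 (hn a)),
        div_mul_cancel₀ _ (hn a).ne']
    have hxy : x = fun a => ((‖V.proj k (x a)‖ / c : ℝ) : 𝕜) • y a := by
      funext a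
      rw [hy, smul_smul, ← RCLike.ofReal_mul, div_mul_div_cancel₀ hc0.ne', div_self (hn a).ne',
        RCLike.ofReal_one, one_smul]
    calc ‖B i x‖ = ‖B i fun a => ((‖V.proj k (x a)‖ / c : ℝ) : 𝕜) • y a‖ := by rw [← hxy]
      _ = (∏ a, (‖V.proj k (x a)‖ / c)) * ‖B i y‖ := by
        rw [MultilinearMap.map_smul_univ, norm_smul, norm_prod]
        congr 1
        refine Finset.prod_congr rfl fun a _ => ?_
        rw [RCLike.norm_ofReal, abs_of_pos (div_pos (hn a) hc0)]
      _ ≤ (∏ a, (‖V.proj k (x a)‖ / c)) * (2 ^ n * ρ N i) := by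
        refine mul_le_mul_of_nonneg_left (small i y hyc) ?_
        exact Finset.prod_nonneg fun a _ => (div_pos (hn a) hc0).le
      _ = _ := by
        simp only [div_eq_mul_inv]
        rw [Finset.prod_mul_distrib, Finset.prod_const, Finset.card_univ, Fintype.card_fin]
        ring

theorem continuous_of_bound {F : Type w} [NormedAddCommGroup F] [NormedSpace 𝕜 F]
    [CompleteSpace F] {n : ℕ} (M : MultilinearMap 𝕜 (fun _ : Fin n => V.Limit) F) {C : ℝ} {k : ℕ}
    (hC : 0 ≤ C) (h : ∀ x, ‖M x‖ ≤ C * ∏ a, ‖V.proj k (x a)‖) : Continuous M := by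
  obtain ⟨Λ, hΛ, -⟩ := V.exists_extension k M hC h
  have e : (M : (Fin n → V.Limit) → F) = fun x => Λ fun a => V.proj k (x a) :=
    funext fun x => (hΛ x).symm
  rw [e]
  exact Λ.cont.comp (continuous_pi fun a => (V.continuous_proj k).comp (continuous_apply a))

/-- A symmetric multilinear family is tame if its values on the diagonal are tame curves. The
uniform bounds come from the Baire category theorem; they are applied to the values of the family
at single times, and to its increments in order to bound the time derivative. -/
theorem tameMult_of_diag (hI : IsOpen I) (hIc : I.OrdConnected) {n : ℕ} {M : ℝ → V.Mult n}
    (hsymm : ∀ t ∈ I, ∀ x (σ : Equiv.Perm (Fin n)), M t (x ∘ σ) = M t x)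
    (hcont : ∀ t ∈ I, ∀ l, Continuous fun h => V.proj l (M t fun _ => h))
    (hM : ∀ h, V.TameCurve I fun t => M t fun _ => h) : V.TameMult I M := by
  intro m
  have growth : ∀ {N r : ℕ} {C s : ℝ}, C ≤ N → r ≤ N → 1 ≤ s → 0 ≤ C → C * s ^ r ≤ N * s ^ N := by
    intro N r C s hC hr hs hC0
    gcongr
  -- the bound for the family itself
  have bound : ∀ {M : ℝ → V.Mult n},
      (∀ t ∈ I, ∀ x (σ : Equiv.Perm (Fin n)), M t (x ∘ σ) = M t x) →
      (∀ t ∈ I, ∀ l, Continuous fun h => V.proj l (M t fun _ => h)) →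
      (∀ h, V.TameCurve I fun t => M t fun _ => h) →
      V.TameBound I (fun k (x : Fin n → V.Limit) => ∏ a, ‖V.proj k (x a)‖) fun x t => M t x := by
    intro M hsymm hcont hM l
    obtain ⟨N, k, C, hC, h⟩ := exists_uniform_bound (V := V)
      (fun t : I => (V.proj l).compMultilinearMap (M t))
      (fun t x σ => congrArg (V.proj l) (hsymm t t.2 x σ)) (fun t => hcont t t.2 l)
      (fun N t => N * (1 + |(t : ℝ)|) ^ N) (fun N t => by positivity) fun h => by
        obtain ⟨k, r, C, hC, hb⟩ := (hM h 0).bound l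
        refine ⟨max r ⌈C⌉₊, fun t => (hb () t t.2).trans ?_⟩
        rw [mul_one]
        exact growth ((Nat.le_ceil C).trans (by exact_mod_cast le_max_right _ _))
          (le_max_left _ _) (by linarith [abs_nonneg (t : ℝ)]) hC
    refine ⟨k, N, C * N, by positivity, fun x t ht => ?_⟩
    have := h ⟨t, ht⟩ x
    rwa [← mul_assoc] at this
  induction m generalizing M with
  | zero => exact bound hsymm hcont hM
  | succ m ih =>
    refine ⟨bound hsymm hcont hM, ?_⟩
    have hn : (n.factorial : 𝕜) ≠ 0 := by exact_mod_cast n.factorial_ne_zero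
    choose d hd using fun h : V.Limit => (hM h 1).2
    have hd' : ∀ h, ∀ t ∈ I, ∀ l,
        HasDerivAt (fun s => V.proj l (M s fun _ => h)) (V.proj l (d h () t)) t :=
      fun h t ht l => (hd h).1 () t ht l
    -- differentiability off the diagonal, by polarization
    have hder : ∀ x : Fin n → V.Limit, ∀ t ∈ I, ∀ l, HasDerivAt (fun s => V.proj l (M s x))
        (V.proj l ((n.factorial : 𝕜)⁻¹ • ∑ S : Finset (Fin n),
          ((-1 : ℤ) ^ S.card) • d (0 + ∑ i ∈ Sᶜ, x i) () t)) t := by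
      intro x t ht l
      have h1 : HasDerivAt (fun s => (n.factorial : 𝕜)⁻¹ • ∑ S : Finset (Fin n),
          ((-1 : ℤ) ^ S.card) • V.proj l (M s fun _ => 0 + ∑ i ∈ Sᶜ, x i))
          ((n.factorial : 𝕜)⁻¹ • ∑ S : Finset (Fin n),
            ((-1 : ℤ) ^ S.card) • V.proj l (d (0 + ∑ i ∈ Sᶜ, x i) () t)) t := by
        refine HasDerivAt.const_smul _ (HasDerivAt.fun_sum fun S _ => ?_)
        rcases neg_one_pow_eq_or ℤ S.card with h | h
        · simpa only [h, one_smul] using hd' _ t ht l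
        · simpa only [h, neg_smul, one_smul] using! (hd' _ t ht l).neg
      simp only [map_smul, map_sum, map_zsmul]
      refine h1.congr_of_eventuallyEq ?_
      filter_upwards [hI.mem_nhds ht] with s hs
      have h2 := (M s).polarization_of_symm (hsymm s hs) 0 x
      have h3 : M s x = (n.factorial : 𝕜)⁻¹ • (n.factorial • M s x) := by
        rw [← Nat.cast_smul_eq_nsmul 𝕜, smul_smul, inv_mul_cancel₀ hn, one_smul]
      rw [h3, h2, map_smul, map_sum]
      simp only [map_zsmul]
    obtain ⟨M', hM'⟩ := exists_mult_deriv hder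
    have hMd : ∀ x, ∀ t ∈ I, ∀ l,
        HasDerivAt (fun s => V.proj l (M s x)) (V.proj l (M' t x)) t := fun x t ht l => by
      rw [hM' x t ht]
      exact hder x t ht l
    refine ⟨fun x t => M' t x, hMd, ih (M := M') ?_ ?_ ?_⟩
    · intro t ht x σ
      refine V.ext_proj fun l => (hMd (x ∘ σ) t ht l).unique
        ((hMd x t ht l).congr_of_eventuallyEq ?_)
      filter_upwards [hI.mem_nhds ht] with s hs
      rw [hsymm s hs]
    · -- the derivative is bounded, because of a uniform Lipschitz bound
      intro t ht l
      obtain ⟨N, k, C, hC, h⟩ := exists_uniform_bound (V := V)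
        (fun z : I × I => (V.proj l).compMultilinearMap (M z.1) -
          (V.proj l).compMultilinearMap (M z.2))
        (fun z x σ => by
          simp only [sub_apply, LinearMap.compMultilinearMap_apply]
          rw [hsymm _ z.1.2, hsymm _ z.2.2])
        (fun z => (hcont _ z.1.2 l).sub (hcont _ z.2.2 l))
        (fun N z => N * (1 + (|(z.1 : ℝ)| + |(z.2 : ℝ)|)) ^ N * |(z.1 : ℝ) - z.2|)
        (fun N z => by positivity) fun h => by
          obtain ⟨k, r, C, hC, hb⟩ := (hd h).2.bound l
          refine ⟨max r ⌈C⌉₊, fun z => ?_⟩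
          have hsub : uIcc (z.2 : ℝ) z.1 ⊆ I := hIc.uIcc_subset z.2.2 z.1.2
          have := (convex_uIcc (z.2 : ℝ) z.1).norm_image_sub_le_of_norm_hasDerivWithin_le
            (fun s hs => (hd' h s (hsub hs) l).hasDerivWithinAt)
            (C := C * (1 + (|(z.1 : ℝ)| + |(z.2 : ℝ)|)) ^ r) (fun s hs => ?_) left_mem_uIcc
            right_mem_uIcc
          · refine this.trans (mul_le_mul_of_nonneg_right ?_ (norm_nonneg _))
            exact growth ((Nat.le_ceil C).trans (by exact_mod_cast le_max_right _ _))
              (le_max_left _ _) (by linarith [abs_nonneg (z.1 : ℝ), abs_nonneg (z.2 : ℝ)]) hC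
          · refine (hb () s (hsub hs)).trans ?_
            rw [mul_one]
            gcongr
            rcases mem_uIcc.1 hs with h | h <;> rcases abs_cases s with h' | h' <;>
              rcases abs_cases (z.1 : ℝ) with h1 | h1 <;>
              rcases abs_cases (z.2 : ℝ) with h2 | h2 <;> linarith
      have hb : ∀ x, ‖V.proj l (M' t x)‖ ≤
          C * (N * (1 + (|t| + 1 + |t|)) ^ N) * ∏ a, ‖V.proj k (x a)‖ := by
        intro x
        have hP : 0 ≤ ∏ a, ‖V.proj k (x a)‖ := Finset.prod_nonneg fun _ _ => norm_nonneg _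
        refine (hMd x t ht l).le_of_lip' (by positivity) ?_
        filter_upwards [hI.mem_nhds ht, Metric.ball_mem_nhds t one_pos] with s hs hst
        have h1 := h (⟨s, hs⟩, ⟨t, ht⟩) x
        simp only [sub_apply, LinearMap.compMultilinearMap_apply] at h1
        refine h1.trans ?_
        rw [Metric.mem_ball, Real.dist_eq] at hst
        have h2 : |s| ≤ |t| + 1 := by linarith [abs_sub_abs_le_abs_sub s t]
        rw [Real.norm_eq_abs]
        calc C * (N * (1 + (|s| + |t|)) ^ N * |s - t|) * ∏ a, ‖V.proj k (x a)‖
            ≤ C * (N * (1 + (|t| + 1 + |t|)) ^ N * |s - t|) * ∏ a, ‖V.proj k (x a)‖ := by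
              gcongr
          _ = _ := by ring
      exact (continuous_of_bound ((V.proj l).compMultilinearMap (M' t)) (by positivity) hb).comp
        (continuous_pi fun _ => continuous_id)
    · intro h m
      exact (hM h (m + 1)).of_hasDerivAt hI fun _ t ht l => hMd _ t ht l

end NestedBanach

/-! ### Taylor coefficients of tame maps -/

/-- A polynomial with values in a normed space that is `O(s ^ n)` has no terms of degree less
than `n`. -/
theorem eq_zero_of_norm_sum_pow_smul_le {𝕜 E : Type*} [RCLike 𝕜] [NormedAddCommGroup E]
    [NormedSpace 𝕜 E] {n : ℕ} {u : ℕ → E} {C δ : ℝ} (hδ : 0 < δ)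
    (h : ∀ s : 𝕜, ‖s‖ < δ → ‖∑ m ∈ Finset.range n, s ^ m • u m‖ ≤ C * ‖s‖ ^ n) :
    ∀ m < n, u m = 0 := by
  induction n generalizing u with
  | zero => intro m hm; omega
  | succ n ih =>
    have h0 : u 0 = 0 := by
      have := h 0 (by simpa using hδ)
      simpa [Finset.sum_range_succ'] using this
    have h1 : ∀ s : 𝕜, s ≠ 0 → ‖s‖ < δ →
        ‖∑ m ∈ Finset.range n, s ^ m • u (m + 1)‖ ≤ C * ‖s‖ ^ n := by
      intro s hs hsδ
      have h2 := h s hsδ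
      have h3 : ∑ m ∈ Finset.range (n + 1), s ^ m • u m =
          s • ∑ m ∈ Finset.range n, s ^ m • u (m + 1) := by
        rw [Finset.sum_range_succ', h0, smul_zero, add_zero, Finset.smul_sum]
        exact Finset.sum_congr rfl fun m _ => by rw [smul_smul, pow_succ']
      rw [h3, norm_smul, pow_succ', mul_left_comm] at h2
      exact le_of_mul_le_mul_left h2 (norm_pos_iff.2 hs)
    have h2 : ∀ s : 𝕜, ‖s‖ < δ →
        ‖∑ m ∈ Finset.range n, s ^ m • u (m + 1)‖ ≤ C * ‖s‖ ^ n := by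
      intro s hs
      by_cases hs0 : s = 0
      swap
      · exact h1 s hs0 hs
      -- at `s = 0` the estimate follows by continuity
      subst hs0
      have hc : Continuous fun s : 𝕜 => C * ‖s‖ ^ n - ‖∑ m ∈ Finset.range n, s ^ m • u (m + 1)‖ := by
        fun_prop
      have h4 : (0 : 𝕜) ∈ closure {s : 𝕜 | s ≠ 0 ∧ ‖s‖ < δ} := by
        rw [Metric.mem_closure_iff]
        intro ε hε
        refine ⟨((min ε δ / 2 : ℝ) : 𝕜), ⟨?_, ?_⟩, ?_⟩
        · have : min ε δ / 2 ≠ 0 := by positivity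
          exact_mod_cast this
        · rw [RCLike.norm_ofReal, abs_of_pos (by positivity)]
          linarith [min_le_right ε δ, lt_min hε hδ]
        · rw [dist_zero_left, RCLike.norm_ofReal, abs_of_pos (by positivity)]
          linarith [min_le_left ε δ, lt_min hε hδ]
      have h5 : {s : 𝕜 | s ≠ 0 ∧ ‖s‖ < δ} ⊆
          {s : 𝕜 | 0 ≤ C * ‖s‖ ^ n - ‖∑ m ∈ Finset.range n, s ^ m • u (m + 1)‖} :=
        fun s hs => sub_nonneg.2 (h1 s hs.1 hs.2)
      exact sub_nonneg.1 (closure_minimal h5 (isClosed_le continuous_const hc) h4)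
    intro m hm
    rcases m with _ | m
    · exact h0
    · exact ih h2 m (by omega)

namespace NestedBanach

variable {𝕜 : Type u} [RCLike 𝕜] {V : NestedBanach.{u, w} 𝕜} {I : Set ℝ}

theorem TameCurve.exists_deriv (hI : IsOpen I) {c : ℝ → V.Limit} (h : V.TameCurve I c) :
    ∃ c' : ℝ → V.Limit, (∀ t ∈ I, ∀ l, HasDerivAt (fun s => V.proj l (c s)) (V.proj l (c' t)) t) ∧
      V.TameCurve I c' := by
  obtain ⟨_, c', hc', _⟩ := h 1
  exact ⟨c' (), fun t ht l => hc' () t ht l, fun m => (h (m + 1)).of_hasDerivAt hI hc'⟩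

theorem TameMult.exists_tameMult_deriv (hI : IsOpen I) {n : ℕ} {M : ℝ → V.Mult n}
    (h : V.TameMult I M) : ∃ M' : ℝ → V.Mult n,
      (∀ t ∈ I, ∀ x l, HasDerivAt (fun s => V.proj l (M s x)) (V.proj l (M' t x)) t) ∧
      V.TameMult I M' := by
  obtain ⟨M', hM', _⟩ := TameMult.exists_deriv (h 1) hI
  exact ⟨M', hM', fun m => (h (m + 1)).of_hasDerivAt hI fun x t ht l => hM' t ht x l⟩

theorem TameCurve.sum {ι : Type*} {c : ι → ℝ → V.Limit} (s : Finset ι)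
    (h : ∀ i ∈ s, V.TameCurve I (c i)) : V.TameCurve I fun t => ∑ i ∈ s, c i t := fun m =>
  Tame.sum isWeight_one s fun i hi => h i hi m

theorem TameCurve.map {c : ℝ → V.Limit} (h : V.TameCurve I c) {A : V.Limit →ₗ[𝕜] V.Limit}
    (hA : V.IsBoundedOp A) : V.TameCurve I fun t => A (c t) := fun m => (h m).map hA

theorem tameCurve_const (v : V.Limit) : V.TameCurve I fun _ => v := by
  intro m
  cases m with
  | zero => exact fun l => ⟨0, 0, ‖V.proj l v‖, norm_nonneg _, fun _ _ _ => by simp⟩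
  | succ m =>
    exact ⟨fun l => ⟨0, 0, ‖V.proj l v‖, norm_nonneg _, fun _ _ _ => by simp⟩, fun _ _ => 0,
      fun _ t _ l => by simpa using hasDerivAt_const t (V.proj l v), tame_zero⟩

/-- A tame multilinear map, applied to tame curves. -/
theorem TameMult.tameCurve (hI : IsOpen I) {n : ℕ} {M : ℝ → V.Mult n} (hM : V.TameMult I M)
    {c : Fin n → ℝ → V.Limit} (hc : ∀ a, V.TameCurve I (c a)) :
    V.TameCurve I fun t => M t fun a => c a t := by
  intro m
  have bound : ∀ {M : ℝ → V.Mult n} {c : Fin n → ℝ → V.Limit}, V.TameMult I M →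
      (∀ a, V.TameCurve I (c a)) →
      V.TameBound I (fun _ (_ : Unit) => 1) fun _ t => M t fun a => c a t := by
    intro M c hM hc l
    obtain ⟨k, r, C, hC, h⟩ := (hM 0).bound l
    choose k' q D hD h' using fun a => (hc a 0).bound k
    refine ⟨0, r + ∑ a, q a, C * ∏ a, D a, mul_nonneg hC (Finset.prod_nonneg fun a _ => hD a),
      fun _ t ht => (h _ t ht).trans ?_⟩
    calc C * (1 + |t|) ^ r * ∏ a, ‖V.proj k (c a t)‖
        ≤ C * (1 + |t|) ^ r * ∏ a, (D a * (1 + |t|) ^ q a) := by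
          gcongr with a _
          simpa using h' a () t ht
      _ = C * (∏ a, D a) * (1 + |t|) ^ (r + ∑ a, q a) * 1 := by
          rw [Finset.prod_mul_distrib, Finset.prod_pow_eq_pow_sum, pow_add]
          ring
  induction m generalizing M c with
  | zero => exact bound hM hc
  | succ m ih =>
    obtain ⟨M', hM', hM'T⟩ := hM.exists_tameMult_deriv hI
    choose c' hc' hc'T using fun a => (hc a).exists_deriv hI
    refine ⟨bound hM hc, fun _ t => M' t (fun a => c a t) +
      ∑ a, M t (Function.update (fun a => c a t) a (c' a t)), fun _ t ht l => ?_, ?_⟩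
    · have := hM.hasDerivAt hI hM' (t₀ := 0) (s₀ := t) (by simpa using ht) (c := c)
        (c' := fun a => c' a t) (fun a k => hc' a t ht k) l
      simpa only [zero_add] using this
    · refine (ih hM'T hc).add isWeight_one (Tame.sum isWeight_one _ fun a _ => ?_)
      have h := ih hM (c := Function.update c a (c' a)) fun b => by
        rcases eq_or_ne b a with rfl | hb
        · simpa using hc'T b
        · simpa [hb] using hc b
      refine h.congr hI fun _ t _ => congrArg (M t) (funext fun b => ?_)
      rcases eq_or_ne b a with rfl | hb
      · simp
      · simp [hb]

/-- A map that is polynomial along each line through `0`, where the coefficients are tame curves. -/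
def TamePoly (V : NestedBanach.{u, w} 𝕜) (I : Set ℝ) (φ : ℝ → V.Limit → V.Limit) : Prop :=
  ∀ h, ∃ (ι : Type) (_ : Fintype ι) (d : ι → ℕ) (c : ι → ℝ → V.Limit),
    (∀ i, V.TameCurve I (c i)) ∧ ∀ t ∈ I, ∀ s : 𝕜, φ t (s • h) = ∑ i, s ^ d i • c i t

theorem tamePoly_id : V.TamePoly I fun _ v => v := fun h =>
  ⟨Unit, inferInstance, fun _ => 1, fun _ _ => h, fun _ => tameCurve_const h, fun t _ s => by simp⟩

theorem TamePoly.map {φ : ℝ → V.Limit → V.Limit} (hφ : V.TamePoly I φ)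
    {A : V.Limit →ₗ[𝕜] V.Limit} (hA : V.IsBoundedOp A) : V.TamePoly I fun t v => A (φ t v) := by
  intro h
  obtain ⟨ι, _, d, c, hc, hφ⟩ := hφ h
  refine ⟨ι, inferInstance, d, fun i t => A (c i t), fun i => (hc i).map hA, fun t ht s => ?_⟩
  simp only [hφ t ht, map_sum, map_smul]

theorem TamePoly.sum {κ : Type} (S : Finset κ) {φ : κ → ℝ → V.Limit → V.Limit}
    (hφ : ∀ j ∈ S, V.TamePoly I (φ j)) : V.TamePoly I fun t v => ∑ j ∈ S, φ j t v := by
  intro h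
  choose ι inst d c hc hφ using fun j : S => hφ j j.2 h
  refine ⟨Σ j : S, ι j, inferInstance, fun i => d i.1 i.2, fun i => c i.1 i.2,
    fun i => hc i.1 i.2, fun t ht s => ?_⟩
  rw [Fintype.sum_sigma]
  change ∑ j ∈ S, φ j t (s • h) = _
  rw [← Finset.sum_coe_sort]
  exact Finset.sum_congr rfl fun j _ => hφ j t ht s

theorem TamePoly.add {φ ψ : ℝ → V.Limit → V.Limit} (hφ : V.TamePoly I φ)
    (hψ : V.TamePoly I ψ) : V.TamePoly I fun t v => φ t v + ψ t v := by
  have h := TamePoly.sum (V := V) (I := I) (Finset.univ : Finset Bool)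
    (φ := fun b => if b then φ else ψ) fun b _ => by cases b <;> simpa
  simpa using h

theorem TamePoly.sub {φ ψ : ℝ → V.Limit → V.Limit} (hφ : V.TamePoly I φ)
    (hψ : V.TamePoly I ψ) : V.TamePoly I fun t v => φ t v - ψ t v := by
  have h : (fun t v => φ t v - ψ t v) = fun t v =>
      φ t v + ((-1 : 𝕜) • (LinearMap.id : V.Limit →ₗ[𝕜] V.Limit)) (ψ t v) := by
    funext t v
    rw [sub_eq_add_neg]
    exact congrArg _ (neg_one_smul 𝕜 _).symm
  rw [h]
  exact hφ.add (hψ.map (isBoundedOp_smul (-1)))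

theorem TameMult.tamePoly (hI : IsOpen I) {n : ℕ} {M : ℝ → V.Mult n} (hM : V.TameMult I M)
    {φ : Fin n → ℝ → V.Limit → V.Limit} (hφ : ∀ a, V.TamePoly I (φ a)) :
    V.TamePoly I fun t v => M t fun a => φ a t v := by
  classical
  intro h
  choose ι inst d c hc hφ using fun a => hφ a h
  refine ⟨∀ a, ι a, inferInstance, fun i => ∑ a, d a (i a), fun i t => M t fun a => c a (i a) t,
    fun i => hM.tameCurve hI fun a => hc a (i a), fun t ht s => ?_⟩
  simp only [hφ _ t ht]
  rw [MultilinearMap.map_sum]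
  refine Finset.sum_congr rfl fun i _ => ?_
  rw [MultilinearMap.map_smul_univ, Finset.prod_pow_eq_pow_sum]

theorem IsOrder.comp {n : ℕ} {φ ψ : ℝ → V.Limit → V.Limit} (hφ : V.IsOrder I n φ)
    (hψ : V.IsOrder I 1 ψ) : V.IsOrder I n fun t v => φ t (ψ t v) := by
  intro l
  obtain ⟨k₁, h₁⟩ := hφ.exists_of_le l
  obtain ⟨k₂, h₂⟩ := hψ.exists_of_le k₁
  refine ⟨k₂, fun K hK hKc => ?_⟩
  obtain ⟨C, δ, hC, hδ, h₁⟩ := h₁ k₁ le_rfl K hK hKc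
  obtain ⟨D, η, hD, hη, h₂⟩ := h₂ k₂ le_rfl K hK hKc
  refine ⟨C * D ^ n, min η (δ / (D + 1)), by positivity, fun t ht v hv => ?_⟩
  have h3 := h₂ t ht v (hv.trans_le (min_le_left _ _))
  rw [pow_one] at h3
  have h4 : ‖V.proj k₁ (ψ t v)‖ < δ := by
    have h5 := hv.trans_le (min_le_right _ _)
    rw [lt_div_iff₀ (by positivity)] at h5
    nlinarith [norm_nonneg (V.proj k₂ v)]
  calc _ ≤ C * ‖V.proj k₁ (ψ t v)‖ ^ n := h₁ t ht _ h4
    _ ≤ C * (D * ‖V.proj k₂ v‖) ^ n := by gcongr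
    _ = _ := by ring

theorem IsOrder.exists_smul_le {n : ℕ} {φ : ℝ → V.Limit → V.Limit} (hφ : V.IsOrder I n φ)
    {t : ℝ} (ht : t ∈ I) (l : ℕ) (h : V.Limit) : ∃ C δ : ℝ, 0 < δ ∧
      ∀ s : 𝕜, ‖s‖ < δ → ‖V.proj l (φ t (s • h))‖ ≤ C * ‖s‖ ^ n := by
  obtain ⟨k, hk⟩ := hφ l
  obtain ⟨C, δ, hδ, H⟩ := hk {t} (by simpa using ht) isCompact_singleton
  refine ⟨C * ‖V.proj k h‖ ^ n, δ / (‖V.proj k h‖ + 1), by positivity, fun s hs => ?_⟩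
  have h1 : ‖V.proj k (s • h)‖ = ‖s‖ * ‖V.proj k h‖ := by rw [map_smul, norm_smul]
  rw [lt_div_iff₀ (by positivity)] at hs
  have := H t rfl (s • h) (by rw [h1]; nlinarith [norm_nonneg s])
  rw [h1] at this
  exact this.trans_eq (by ring)

/-- The Taylor coefficients of a map that is a tame polynomial along each line, up to
order `n + 1`. -/
theorem SmoothMap.taylorMult_eq_sum (hI : IsOpen I) {φ ψ : ℝ → V.Limit → V.Limit}
    (hφ : V.SmoothMap I φ) {n : ℕ} (hn : V.IsOrder I (n + 1) fun t v => φ t v - ψ t v)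
    {h : V.Limit} {ι : Type} [Fintype ι] {d : ι → ℕ} {c : ι → ℝ → V.Limit}
    (hψ : ∀ t ∈ I, ∀ s : 𝕜, ψ t (s • h) = ∑ i, s ^ d i • c i t) {m : ℕ} (hm : m ≤ n) {t : ℝ}
    (ht : t ∈ I) :
    (taylorMult I φ m t fun _ => h) = ∑ i with d i = m, c i t := by
  have h1 : V.IsOrder I (n + 1) fun t v =>
      ψ t v - ∑ m ∈ Finset.range (n + 1), taylorMult I φ m t fun _ => v :=
    ((hφ.isOrder_sub_taylorMult hI n).sub hn).congr fun t _ v => by abel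
  refine V.ext_proj fun l => ?_
  obtain ⟨C, δ, hδ, h2⟩ := h1.exists_smul_le ht l h
  -- the terms of degree at most `n` of `ψ`; the others are `O(s ^ (n + 1))`
  set u : ℕ → V.X l := fun m => V.proj l ((∑ i with d i = m, c i t) - taylorMult I φ m t fun _ => h)
    with hu
  have h3 : ∀ s : 𝕜, V.proj l (ψ t (s • h) -
      ∑ m ∈ Finset.range (n + 1), taylorMult I φ m t fun _ => s • h) =
      ∑ m ∈ Finset.range (n + 1), s ^ m • u m +
        ∑ i with n < d i, s ^ d i • V.proj l (c i t) := by
    intro s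
    have h4 : ∀ m, (taylorMult I φ m t fun _ => s • h) = s ^ m • taylorMult I φ m t fun _ => h :=
      fun m => by simpa using (taylorMult I φ m t).map_smul_univ (fun _ => s) fun _ => h
    have h5 : ∑ i with d i < n + 1, s ^ d i • c i t =
        ∑ m ∈ Finset.range (n + 1), s ^ m • ∑ i with d i = m, c i t := by
      have h6 : ∀ i ∈ Finset.univ.filter fun i => d i < n + 1, d i ∈ Finset.range (n + 1) := by
        simp
      rw [← Finset.sum_fiberwise_of_maps_to h6]
      refine Finset.sum_congr rfl fun m hm => ?_
      rw [Finset.smul_sum, Finset.filter_filter]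
      refine Finset.sum_congr (Finset.filter_congr fun i _ => ?_) fun i hi => ?_
      · have := Finset.mem_range.1 hm
        constructor
        · exact fun h => h.2
        · exact fun h => ⟨by omega, h⟩
      · rw [(Finset.mem_filter.1 hi).2]
    rw [hψ t ht, ← Finset.sum_filter_add_sum_filter_not Finset.univ fun i => d i < n + 1, h5]
    simp only [h4, hu, map_sub, map_add, map_sum, map_smul, smul_sub, Finset.sum_sub_distrib,
      not_lt, Nat.succ_le_iff]
    abel
  have h7 : ∀ s : 𝕜, ‖s‖ < min δ 1 → ‖∑ m ∈ Finset.range (n + 1), s ^ m • u m‖ ≤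
      (C + ∑ i with n < d i, ‖V.proj l (c i t)‖) * ‖s‖ ^ (n + 1) := by
    intro s hs
    have h8 := h2 s (hs.trans_le (min_le_left _ _))
    rw [h3] at h8
    have h9 : ‖∑ i with n < d i, s ^ d i • V.proj l (c i t)‖ ≤
        (∑ i with n < d i, ‖V.proj l (c i t)‖) * ‖s‖ ^ (n + 1) := by
      rw [Finset.sum_mul]
      refine (norm_sum_le _ _).trans (Finset.sum_le_sum fun i hi => ?_)
      rw [norm_smul, norm_pow, mul_comm]
      gcongr ?_ * ?_
      exact pow_le_pow_of_le_one (norm_nonneg _) (hs.trans_le (min_le_right _ _)).le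
        (Finset.mem_filter.1 hi).2
    have h10 := norm_sub_le (∑ m ∈ Finset.range (n + 1), s ^ m • u m +
        ∑ i with n < d i, s ^ d i • V.proj l (c i t)) (∑ i with n < d i, s ^ d i • V.proj l (c i t))
    rw [add_sub_cancel_right] at h10
    rw [add_mul]
    linarith
  have h11 := eq_zero_of_norm_sum_pow_smul_le (lt_min hδ one_pos) h7 m (by omega)
  rw [hu] at h11
  simp only [map_sub] at h11
  exact (sub_eq_zero.1 h11).symm

/-- The Taylor coefficients of `φ` are tame, if `φ` is a tame polynomial along each line, up to
higher order terms. -/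
theorem SmoothMap.tameMult_taylorMult (hI : IsOpen I) (hIc : I.OrdConnected)
    {φ ψ : ℝ → V.Limit → V.Limit} (hφ : V.SmoothMap I φ) {n : ℕ}
    (hn : V.IsOrder I (n + 1) fun t v => φ t v - ψ t v) (hψ : V.TamePoly I ψ) :
    V.TameMult I (taylorMult I φ n) := by
  refine tameMult_of_diag hI hIc (fun t _ => taylorMult_comp_perm φ n t)
    (fun t ht l => hφ.continuous_taylorMult n ht l) fun h => ?_
  obtain ⟨ι, _, d, c, hc, hψ⟩ := hψ h
  intro m
  refine (TameCurve.sum (Finset.univ.filter fun i => d i = n) fun i _ => hc i) m |>.congr hI ?_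
  exact fun _ t ht => (hφ.taylorMult_eq_sum hI hn hψ le_rfl ht).symm

/-- A map of order `n` is given by its `n`-th Taylor coefficient, up to terms of order `n + 1`. -/
theorem SmoothMap.isOrder_sub_taylorMult_of_isOrder (hI : IsOpen I)
    {φ : ℝ → V.Limit → V.Limit} (hφ : V.SmoothMap I φ) {n : ℕ} (hn : V.IsOrder I n φ) :
    V.IsOrder I (n + 1) fun t v => φ t v - taylorMult I φ n t fun _ => v := by
  refine (hφ.isOrder_sub_taylorMult hI n).congr fun t ht v => ?_
  rw [Finset.sum_range_succ, Finset.sum_eq_zero, zero_add]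
  intro m hm
  have hm := Finset.mem_range.1 hm
  obtain ⟨n, rfl⟩ : ∃ k, n = k + 1 := ⟨n - 1, by omega⟩
  have h := hφ.taylorMult_eq_sum hI (n := n) (ψ := fun _ _ => 0) (h := v) (ι := Empty)
    (d := fun _ => 0) (c := fun _ _ => 0) (m := m) (by simpa using hn) (by simp) (by omega) ht
  simpa using h

/-- The Taylor coefficients of a map with polynomial growth are tame. -/
theorem HasPolynomialGrowth.tameMult_taylorMult (hI : IsOpen I) (hIc : I.OrdConnected)
    {f : ℝ → V.Limit → V.Limit} (hf : V.SmoothMap I f) (hg : V.HasPolynomialGrowth I f) (n : ℕ) :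
    V.TameMult I (taylorMult I f n) := by
  refine tameMult_of_diag hI hIc (fun t _ => taylorMult_comp_perm f n t)
    (fun t ht l => hf.continuous_taylorMult n ht l) fun h => ?_
  refine tameCurve_of_growth hI (hf.smoothCurve_taylorMult hI n h) fun k l => ?_
  obtain ⟨C, r, hC, hr, H⟩ := hg 0 h k l n
  refine ⟨‖(n.factorial : 𝕜)⁻¹‖ * C + 1, r, by positivity, hr, fun t ht => ?_⟩
  have h1 : (fun s => V.proj k (taylorMult I f n s fun _ => h)) =ᶠ[𝓝 t] fun τ =>
      (n.factorial : 𝕜)⁻¹ • iteratedDeriv n (fun s : 𝕜 => V.proj k (f τ (0 + s • h))) 0 := by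
    filter_upwards [hI.mem_nhds ht] with τ hτ
    simpa only [zero_add] using hf.proj_taylorMult_eq_iteratedDeriv n hτ k h
  have h2 := H t ht
  rw [abs_norm] at h2 ⊢
  rw [Filter.EventuallyEq.iteratedDeriv_eq _ h1, iteratedDeriv_fun_const_smul_field, norm_smul]
  have h3 : 0 ≤ 1 + |t| ^ r := by positivity
  nlinarith [mul_le_mul_of_nonneg_left h2 (norm_nonneg (n.factorial : 𝕜)⁻¹)]

/-- Composition of a map with polynomial growth and a tame polynomial. -/
theorem exists_tamePoly_comp (hI : IsOpen I) (hIc : I.OrdConnected)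
    {f ξ : ℝ → V.Limit → V.Limit} (hf : V.SmoothMap I f) (hg : V.HasPolynomialGrowth I f)
    (hξ : V.TamePoly I ξ) (hξ1 : V.IsOrder I 1 ξ) (n : ℕ) :
    ∃ ψ : ℝ → V.Limit → V.Limit, V.TamePoly I ψ ∧
      V.IsOrder I (n + 1) fun t v => f t (ξ t v) - ψ t v :=
  ⟨_, TamePoly.sum (Finset.range (n + 1)) fun m _ =>
      TameMult.tamePoly hI (hg.tameMult_taylorMult hI hIc hf m) fun _ => hξ,
    (hf.isOrder_sub_taylorMult hI n).comp hξ1⟩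

end NestedBanach

/-! ### The basis of eigenvectors -/

/-- Diagonal operators with respect to an orthonormal family are bounded by their largest entry. -/
theorem Orthonormal.norm_sum_smul_inner_le {𝕜 G ι : Type*} [RCLike 𝕜] [NormedAddCommGroup G]
    [InnerProductSpace 𝕜 G] {b : ι → G} (hb : Orthonormal 𝕜 b) (s : Finset ι) {d : ι → 𝕜} {B : ℝ}
    (hB : 0 ≤ B) (hd : ∀ i, ‖d i‖ ≤ B) (y : G) :
    ‖∑ i ∈ s, (d i * inner 𝕜 (b i) y) • b i‖ ≤ B * ‖y‖ := by
  have h1 : ‖∑ i ∈ s, (d i * inner 𝕜 (b i) y) • b i‖ ^ 2 = ∑ i ∈ s, ‖d i * inner 𝕜 (b i) y‖ ^ 2 := by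
    have h2 := hb.inner_sum (fun i => d i * inner 𝕜 (b i) y) (fun i => d i * inner 𝕜 (b i) y) s
    rw [inner_self_eq_norm_sq_to_K] at h2
    have h3 : ∀ z : 𝕜, (starRingEnd 𝕜) z * z = ((‖z‖ ^ 2 : ℝ) : 𝕜) := fun z => by
      rw [RCLike.conj_mul]; norm_cast
    simp only [h3] at h2
    exact_mod_cast h2
  refine le_of_sq_le_sq ?_ (by positivity)
  rw [h1, mul_pow]
  calc ∑ i ∈ s, ‖d i * inner 𝕜 (b i) y‖ ^ 2 ≤ ∑ i ∈ s, B ^ 2 * ‖inner 𝕜 (b i) y‖ ^ 2 := by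
        refine Finset.sum_le_sum fun i _ => ?_
        rw [norm_mul, mul_pow]
        gcongr
        exact hd i
    _ = B ^ 2 * ∑ i ∈ s, ‖inner 𝕜 (b i) y‖ ^ 2 := by rw [Finset.mul_sum]
    _ ≤ B ^ 2 * ‖y‖ ^ 2 := by
        gcongr
        exact hb.sum_inner_products_le y

/-- Orthogonal expansions converge uniformly on precompact sets. -/
theorem Orthonormal.exists_norm_sub_sum_le {𝕜 G : Type*} [RCLike 𝕜] [NormedAddCommGroup G]
    [InnerProductSpace 𝕜 G] [CompleteSpace G] {b : ℕ → G} (hb : Orthonormal 𝕜 b)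
    (hspan : (Submodule.span 𝕜 (range b)).topologicalClosure = ⊤) {K : Set G}
    (hK : TotallyBounded K) {ε : ℝ} (hε : 0 < ε) :
    ∃ N₀, ∀ N ≥ N₀, ∀ y ∈ K, ‖y - ∑ i ∈ Finset.range N, inner 𝕜 (b i) y • b i‖ ≤ ε := by
  obtain ⟨S, hS, hKS⟩ := Metric.totallyBounded_iff.1 hK (ε / 3) (by positivity)
  have h1 : ∀ y : G, ∃ N₀, ∀ N ≥ N₀,
      ‖y - ∑ i ∈ Finset.range N, inner 𝕜 (b i) y • b i‖ < ε / 3 := by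
    intro y
    have h2 := ((HilbertBasis.mk hb hspan.ge).hasSum_repr y).tendsto_sum_nat
    simp only [HilbertBasis.repr_apply_apply, HilbertBasis.coe_mk] at h2
    obtain ⟨N₀, h3⟩ := Metric.tendsto_atTop.1 h2 (ε / 3) (by positivity)
    exact ⟨N₀, fun N hN => by rw [← dist_eq_norm, dist_comm]; exact h3 N hN⟩
  choose N₀ hN₀ using h1
  refine ⟨hS.toFinset.sup N₀, fun N hN y hy => ?_⟩
  obtain ⟨z, hz, hyz⟩ := mem_iUnion₂.1 (hKS hy)
  rw [Metric.mem_ball, dist_eq_norm] at hyz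
  have h3 := hN₀ z N ((Finset.le_sup (by simpa using hz)).trans hN)
  have h4 := hb.norm_sum_smul_inner_le (Finset.range N) (d := fun _ => 1) (B := 1) zero_le_one
    (by simp) (y - z)
  simp only [one_mul, inner_sub_right, sub_smul, Finset.sum_sub_distrib] at h4
  have h5 : y - ∑ i ∈ Finset.range N, inner 𝕜 (b i) y • b i = (y - z) +
      (z - ∑ i ∈ Finset.range N, inner 𝕜 (b i) z • b i) -
      (∑ i ∈ Finset.range N, inner 𝕜 (b i) y • b i -
        ∑ i ∈ Finset.range N, inner 𝕜 (b i) z • b i) := by abel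
  rw [h5]
  refine (norm_sub_le _ _).trans ?_
  linarith [norm_add_le (y - z) (z - ∑ i ∈ Finset.range N, inner 𝕜 (b i) z • b i)]

namespace NestedBanach

variable {𝕜 : Type u} [RCLike 𝕜] {V : NestedBanach.{u, w} 𝕜}

/-- The coordinate functionals `v ↦ (eⱼ, v)` on `V_∞`, with the inner product of the first
space. -/
noncomputable def coord {H : Type w} [NormedAddCommGroup H] [InnerProductSpace 𝕜 H]
    (iso : V.X 0 ≃ₗᵢ[𝕜] H) (e : ℕ → V.Limit) (j : ℕ) : V.Limit →ₗ[𝕜] 𝕜 :=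
  (innerSL 𝕜 (iso (V.proj 0 (e j)))).toLinearMap ∘ₗ iso.toLinearEquiv.toLinearMap ∘ₗ V.proj 0

theorem coord_apply {H : Type w} [NormedAddCommGroup H] [InnerProductSpace 𝕜 H]
    (iso : V.X 0 ≃ₗᵢ[𝕜] H) (e : ℕ → V.Limit) (j : ℕ) (v : V.Limit) :
    coord iso e j v = inner 𝕜 (iso (V.proj 0 (e j))) (iso (V.proj 0 v)) := rfl

/-- A sequence `e` in `V_∞` with biorthogonal functionals `c` that determine a vector, for which
the bounded diagonal operators are bounded uniformly under truncation, and for which the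
partial sums of the expansions converge to the identity in operator norm. -/
structure IsDiagonalBasis (V : NestedBanach.{u, w} 𝕜) (e : ℕ → V.Limit)
    (c : ℕ → V.Limit →ₗ[𝕜] 𝕜) : Prop where
  coord_self : ∀ i j, c i (e j) = if i = j then 1 else 0
  ext_coord : ∀ v, (∀ j, c j v = 0) → v = 0
  coord_bounded : ∀ j, ∃ T : V.X 0 →L[𝕜] 𝕜, ∀ v, T (V.proj 0 v) = c j v
  diag_bound : ∀ l, ∃ k, ∃ C : ℝ, 0 ≤ C ∧ ∀ (N : ℕ) (d : ℕ → 𝕜) (B : ℝ), 0 ≤ B →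
    (∀ i, ‖d i‖ ≤ B) → ∀ x,
      ‖V.proj l (∑ i ∈ Finset.range N, (d i * c i x) • e i)‖ ≤ C * B * ‖V.proj k x‖
  tail_bound : ∀ l, ∃ k, ∀ ε : ℝ, 0 < ε → ∃ N₀, ∀ N ≥ N₀, ∀ x,
    ‖V.proj l (x - ∑ i ∈ Finset.range N, c i x • e i)‖ ≤ ε * ‖V.proj k x‖

/-- The eigenvectors form a basis of `V_∞`, as they do so orthogonally in a comparable sequence of
Hilbert spaces. Their expansions converge in operator norm because the spaces are compactly
nested. -/
theorem isDiagonalBasis (hV : V.CompactlyNested)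
    {H : Type w} [NormedAddCommGroup H] [InnerProductSpace 𝕜 H] (iso : V.X 0 ≃ₗᵢ[𝕜] H)
    {e : ℕ → V.Limit} (horth : Orthonormal 𝕜 fun j => iso (V.proj 0 (e j)))
    (hspan : (Submodule.span 𝕜 (range fun j => V.proj 0 (e j))).topologicalClosure = ⊤)
    (W : NestedBanach.{u, w} 𝕜) {G : ℕ → Type w} [∀ k, NormedAddCommGroup (G k)]
    [∀ k, InnerProductSpace 𝕜 (G k)] (isoW : ∀ k, W.X k ≃ₗᵢ[𝕜] G k)
    (Φ : V.Limit ≃ₗ[𝕜] W.Limit) (hcomp : NestedBanach.Comparable V W Φ)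
    (hWorth : ∀ k, Pairwise fun i j =>
      inner 𝕜 (isoW k (W.proj k (Φ (e i)))) (isoW k (W.proj k (Φ (e j)))) = 0)
    (hWspan : ∀ k,
      (Submodule.span 𝕜 (range fun j => W.proj k (Φ (e j)))).topologicalClosure = ⊤) :
    V.IsDiagonalBasis e (coord iso e) := by
  have hδ : ∀ i j, coord iso e i (e j) = if i = j then 1 else 0 := fun i j =>
    (orthonormal_iff_ite.1 horth) i j
  have he0 : ∀ i, e i ≠ 0 := fun i h => by simpa [h] using hδ i i
  -- the orthonormal basis of the `k`-th Hilbert space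
  set u : ∀ k, ℕ → G k := fun k j => isoW k (W.proj k (Φ (e j))) with hu
  have hu0 : ∀ k j, u k j ≠ 0 := fun k j h => he0 j <| by
    rw [hu] at h
    simp only [map_eq_zero_iff _ (isoW k).injective] at h
    exact Φ.injective ((W.proj_injective k (h.trans (map_zero _).symm)).trans (map_zero _).symm)
  set b : ∀ k, ℕ → G k := fun k j => ((‖u k j‖⁻¹ : ℝ) : 𝕜) • u k j with hb
  have hborth : ∀ k, Orthonormal 𝕜 (b k) := fun k => by
    refine ⟨fun j => ?_, fun i j hij => ?_⟩
    · simp only [hb, norm_smul, RCLike.norm_ofReal, abs_inv, abs_norm]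
      exact inv_mul_cancel₀ (norm_ne_zero_iff.2 (hu0 k j))
    · simp only [hb, inner_smul_left, inner_smul_right]
      rw [hWorth k hij, mul_zero, mul_zero]
  have hclosure : ∀ k, (Submodule.span 𝕜 (range (u k))).topologicalClosure = ⊤ := fun k => by
    have h1 : range (u k) = (isoW k).toLinearEquiv.toLinearMap ''
        range fun j => W.proj k (Φ (e j)) := by
      rw [← range_comp]; rfl
    rw [h1, Submodule.span_image]
    have h2 := hWspan k
    rw [← Submodule.dense_iff_topologicalClosure_eq_top] at h2 ⊢
    exact (isoW k).surjective.denseRange.dense_image (isoW k).continuous h2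
  have hbclosure : ∀ k, (Submodule.span 𝕜 (range (b k))).topologicalClosure = ⊤ := fun k => by
    rw [← top_le_iff, ← hclosure k]
    refine Submodule.topologicalClosure_mono (Submodule.span_le.2 ?_)
    rintro _ ⟨j, rfl⟩
    have h1 : u k j = ((‖u k j‖ : ℝ) : 𝕜) • b k j := by
      simp only [hb, smul_smul]
      rw [← RCLike.ofReal_mul, mul_inv_cancel₀ (norm_ne_zero_iff.2 (hu0 k j))]
      simp
    rw [h1]
    exact Submodule.smul_mem _ _ (Submodule.subset_span ⟨j, rfl⟩)
  -- the coefficients in all these bases are given by the coordinates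
  have hcoef : ∀ k j x, coord iso e j x • u k j =
      inner 𝕜 (b k j) (isoW k (W.proj k (Φ x))) • b k j := by
    intro k j x
    obtain ⟨l, T, _, hT⟩ := (hcomp k).2.1
    set T₁ : G k →L[𝕜] 𝕜 := (innerSL 𝕜 (iso (V.proj 0 (e j)))).comp
      ((iso.toContinuousLinearEquiv : V.X 0 →L[𝕜] H).comp ((V.inclOfLE (Nat.zero_le l)).comp
        (T.comp ((isoW k).symm.toContinuousLinearEquiv : G k →L[𝕜] W.X k)))) with hT₁
    have h1 : ∀ y, T₁ (isoW k (W.proj k (Φ y))) = coord iso e j y := by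
      intro y
      rw [coord_apply]
      simp [hT₁, hT]
    have h2 : T₁ = ((‖u k j‖⁻¹ : ℝ) : 𝕜) • innerSL 𝕜 (b k j) := by
      refine ContinuousLinearMap.ext_on (Submodule.dense_iff_topologicalClosure_eq_top.2
        (hclosure k)) ?_
      rintro _ ⟨i, rfl⟩
      refine (h1 (e i)).trans ?_
      rw [hδ]
      simp only [hb, smul_apply, innerSL_apply_apply, inner_smul_left,
        smul_eq_mul, RCLike.conj_ofReal]
      rcases eq_or_ne j i with rfl | hij
      · rw [if_pos rfl, inner_self_eq_norm_sq_to_K]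
        have := norm_ne_zero_iff.2 (hu0 k j)
        norm_cast
        field_simp
      · rw [if_neg hij, show inner 𝕜 (u k j) (u k i) = 0 from hWorth k hij]
        simp
    rw [← h1, h2]
    simp only [smul_apply, innerSL_apply_apply, smul_eq_mul]
    rw [mul_comm, mul_smul]
  -- diagonal operators, seen in the `k`-th Hilbert space
  have hdiag : ∀ k N (d : ℕ → 𝕜) x,
      isoW k (W.proj k (Φ (∑ i ∈ Finset.range N, (d i * coord iso e i x) • e i))) =
        ∑ i ∈ Finset.range N, (d i * inner 𝕜 (b k i) (isoW k (W.proj k (Φ x)))) • b k i := by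
    intro k N d x
    simp only [map_sum, map_smul]
    refine Finset.sum_congr rfl fun i _ => ?_
    rw [mul_smul, mul_smul, ← hcoef]
  refine ⟨hδ, fun v hv => ?_, fun j => ⟨(innerSL 𝕜 (iso (V.proj 0 (e j)))).comp
    (iso.toContinuousLinearEquiv : V.X 0 →L[𝕜] H), fun _ => rfl⟩, fun l => ?_, fun l => ?_⟩
  · refine V.proj_injective 0 (iso.injective ?_)
    rw [map_zero, map_zero]
    have h1 : innerSL 𝕜 (iso (V.proj 0 v)) ∘L
        (iso.toContinuousLinearEquiv : V.X 0 →L[𝕜] H) = 0 := by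
      refine ContinuousLinearMap.ext_on (Submodule.dense_iff_topologicalClosure_eq_top.2 hspan) ?_
      rintro _ ⟨i, rfl⟩
      exact inner_eq_zero_symm.1 (hv i)
    exact inner_self_eq_zero.1 (congrArg (fun T => T (V.proj 0 v)) h1)
  -- both bounds hold in a Hilbert space `W.X k` that lies between `X l` and a smaller `V.X m`
  · obtain ⟨k, T, _, hT⟩ := (hcomp l).2.2.1
    obtain ⟨m, S, _, hS⟩ := (hcomp k).1
    refine ⟨m, ‖T‖ * ‖S‖, by positivity, fun N d B hB hd x => ?_⟩
    rw [← hT]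
    refine (T.le_opNorm _).trans ?_
    have h1 := (hborth k).norm_sum_smul_inner_le (Finset.range N) hB hd
      (isoW k (W.proj k (Φ x)))
    rw [← hdiag, (isoW k).norm_map, (isoW k).norm_map, ← hS x] at h1
    calc _ ≤ ‖T‖ * (B * (‖S‖ * ‖V.proj m x‖)) := by
          gcongr
          refine h1.trans ?_
          gcongr
          exact S.le_opNorm _
      _ = _ := by ring
  · obtain ⟨k, T, _, hT⟩ := (hcomp l).2.2.1
    obtain ⟨m, S, _, hS⟩ := (hcomp k).1
    obtain ⟨m', hm'⟩ := hV m
    have : CompleteSpace (G k) := (isoW k).isometry.isUniformInducing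
      |>.completeSpace_congr (isoW k).surjective |>.1 inferInstance
    -- the unit ball of a still smaller space is precompact in the Hilbert space
    set S' : V.X (m + m') →L[𝕜] G k :=
      ((isoW k).toContinuousLinearEquiv : W.X k →L[𝕜] G k).comp (S.comp (V.inclAdd m m')) with hS'
    have h1 : IsCompactOperator S' := (hm'.clm_comp S).clm_comp
      ((isoW k).toContinuousLinearEquiv : W.X k →L[𝕜] G k)
    have h2 : TotallyBounded (S' '' Metric.closedBall 0 1) :=
      (h1.isCompact_closure_image_closedBall 1).totallyBounded.subset subset_closure
    refine ⟨m + m', fun ε hε => ?_⟩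
    obtain ⟨N₀, hN₀⟩ := (hborth k).exists_norm_sub_sum_le (hbclosure k) h2
      (ε := ε / (‖T‖ + 1)) (by positivity)
    refine ⟨N₀, fun N hN x => ?_⟩
    have h3 : ∀ x, S' (V.proj (m + m') x) = isoW k (W.proj k (Φ x)) := fun x => by
      rw [← hS, ← V.inclAdd_proj m m' x]; rfl
    have hdiag1 : isoW k (W.proj k (Φ (x - ∑ i ∈ Finset.range N, coord iso e i x • e i))) =
        isoW k (W.proj k (Φ x)) -
        ∑ i ∈ Finset.range N, inner 𝕜 (b k i) (isoW k (W.proj k (Φ x))) • b k i := by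
      have := hdiag k N (fun _ => 1) x
      simp only [one_mul] at this
      rw [map_sub, map_sub, map_sub, this]
    have h4 : ‖isoW k (W.proj k (Φ (x - ∑ i ∈ Finset.range N, coord iso e i x • e i)))‖ ≤
        ε / (‖T‖ + 1) * ‖V.proj (m + m') x‖ := by
      rcases eq_or_ne (V.proj (m + m') x) 0 with hx | hx
      · have : x = 0 := V.proj_injective _ (hx.trans (map_zero _).symm)
        subst this
        simp
      have hx' := norm_pos_iff.2 hx
      have h5 := hN₀ N hN (S' (((‖V.proj (m + m') x‖⁻¹ : ℝ) : 𝕜) • V.proj (m + m') x))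
        ⟨_, by simp [norm_smul, hx'.ne'], rfl⟩
      rw [map_smul, h3] at h5
      simp only [inner_smul_right, mul_smul, ← Finset.smul_sum, ← smul_sub] at h5
      rw [hdiag1, ← div_le_iff₀ hx', div_eq_inv_mul]
      simpa [norm_smul] using h5
    rw [← hT]
    calc _ ≤ ‖T‖ * (ε / (‖T‖ + 1) * ‖V.proj (m + m') x‖) := by
          refine (T.le_opNorm _).trans ?_
          rw [← (isoW k).norm_map]
          gcongr
      _ ≤ (‖T‖ + 1) * (ε / (‖T‖ + 1) * ‖V.proj (m + m') x‖) := by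
          gcongr
          linarith
      _ = _ := by field_simp

end NestedBanach

/-! ### Truncation of multilinear maps -/

namespace NestedBanach

variable {𝕜 : Type u} [RCLike 𝕜] {V : NestedBanach.{u, w} 𝕜} {I : Set ℝ}
  {e : ℕ → V.Limit} {c : ℕ → V.Limit →ₗ[𝕜] 𝕜}

/-- The operator `x ↦ ∑_{i < N} dᵢ cᵢ(x) eᵢ`. -/
noncomputable def diagOp (e : ℕ → V.Limit) (c : ℕ → V.Limit →ₗ[𝕜] 𝕜) (d : ℕ → 𝕜) (N : ℕ) :
    V.Limit →ₗ[𝕜] V.Limit :=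
  ∑ i ∈ Finset.range N, d i • (c i).smulRight (e i)

theorem diagOp_apply (d : ℕ → 𝕜) (N : ℕ) (x : V.Limit) :
    diagOp e c d N x = ∑ i ∈ Finset.range N, (d i * c i x) • e i := by
  simp [diagOp, mul_smul]

/-- The partial sums of the expansion in the basis `e`. -/
noncomputable abbrev trunc (e : ℕ → V.Limit) (c : ℕ → V.Limit →ₗ[𝕜] 𝕜) (N : ℕ) :
    V.Limit →ₗ[𝕜] V.Limit := diagOp e c 1 N

/-- The multilinear map with matrix `m i j`, where `i` are the indices of the arguments and `j` is
that of the value, all of them truncated to be less than `N`. -/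
noncomputable def multSum (e : ℕ → V.Limit) (c : ℕ → V.Limit →ₗ[𝕜] 𝕜) {n : ℕ} (N : ℕ)
    (m : (Fin n → ℕ) → ℕ → 𝕜) : V.Mult n :=
  ∑ i ∈ Fintype.piFinset fun _ : Fin n => Finset.range N, ∑ j ∈ Finset.range N,
    m i j • ((MultilinearMap.mkPiAlgebra 𝕜 (Fin n) 𝕜).compLinearMap fun a => c (i a)).smulRight (e j)

theorem multSum_apply {n : ℕ} (N : ℕ) (m : (Fin n → ℕ) → ℕ → 𝕜) (x : Fin n → V.Limit) :
    multSum e c N m x = ∑ i ∈ Fintype.piFinset fun _ : Fin n => Finset.range N,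
      ∑ j ∈ Finset.range N, (m i j * ∏ a, c (i a) (x a)) • e j := by
  simp [multSum, sum_apply, mul_smul]

/-- The matrix of a multilinear map. -/
def matrixCoeff (e : ℕ → V.Limit) (c : ℕ → V.Limit →ₗ[𝕜] 𝕜) {n : ℕ} (M : V.Mult n)
    (i : Fin n → ℕ) (j : ℕ) : 𝕜 :=
  c j (M fun a => e (i a))

theorem diagOp_mult_diagOp {n : ℕ} (M : V.Mult n) (d₀ : ℕ → 𝕜) (d : Fin n → ℕ → 𝕜) (N : ℕ)
    (x : Fin n → V.Limit) :
    diagOp e c d₀ N (M fun a => diagOp e c (d a) N (x a)) =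
      multSum e c N (fun i j => d₀ j * (∏ a, d a (i a)) * matrixCoeff e c M i j) x := by
  classical
  simp only [diagOp_apply, multSum_apply, matrixCoeff]
  rw [MultilinearMap.map_sum_finset]
  simp only [MultilinearMap.map_smul_univ, map_sum, map_smul, Finset.mul_sum, Finset.sum_smul,
    smul_eq_mul, Finset.prod_mul_distrib]
  rw [Finset.sum_comm]
  refine Finset.sum_congr rfl fun i _ => Finset.sum_congr rfl fun j _ => ?_
  congr 1
  ring

theorem trunc_mult_trunc {n : ℕ} (M : V.Mult n) (N : ℕ) (x : Fin n → V.Limit) :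
    trunc e c N (M fun a => trunc e c N (x a)) = multSum e c N (matrixCoeff e c M) x := by
  rw [diagOp_mult_diagOp]
  simp

theorem multSum_congr {n N : ℕ} {m m' : (Fin n → ℕ) → ℕ → 𝕜}
    (h : ∀ i, (∀ a, i a < N) → ∀ j < N, m i j = m' i j) :
    multSum e c N m = multSum e c N m' := by
  refine Finset.sum_congr rfl fun i hi => Finset.sum_congr rfl fun j hj => ?_
  rw [h i (by simpa using hi) j (by simpa using hj)]

theorem IsDiagonalBasis.matrixCoeff_multSum (hB : V.IsDiagonalBasis e c)
    {n N : ℕ} (m : (Fin n → ℕ) → ℕ → 𝕜) {i : Fin n → ℕ}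
    (hi : ∀ a, i a < N) {j : ℕ} (hj : j < N) :
    matrixCoeff e c (multSum e c N m) i j = m i j := by
  classical
  simp only [matrixCoeff, multSum_apply, map_sum, map_smul, hB.coord_self, smul_eq_mul]
  rw [Finset.sum_eq_single i, Finset.sum_eq_single j]
  · simp
  · intro j' _ hj'
    simp [hj'.symm]
  · simp [hj]
  · intro i' _ hi'
    obtain ⟨a, ha⟩ := Function.ne_iff.1 hi'
    refine Finset.sum_eq_zero fun j' _ => ?_
    rw [Finset.prod_eq_zero (Finset.mem_univ a) (if_neg ha)]
    simp
  · intro h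
    exact absurd (by simpa using hi) h

/-- The truncation of a longer sum is the shorter sum, which is why estimates for truncations show
that the sums form a Cauchy sequence. -/
theorem IsDiagonalBasis.trunc_multSum_trunc (hB : V.IsDiagonalBasis e c)
    {n N N' : ℕ} (hN : N ≤ N')
    (m : (Fin n → ℕ) → ℕ → 𝕜) (x : Fin n → V.Limit) :
    trunc e c N (multSum e c N' m fun a => trunc e c N (x a)) = multSum e c N m x := by
  rw [trunc_mult_trunc]
  exact congrArg (fun M : V.Mult n => M x) (multSum_congr fun i hi j hj =>
    hB.matrixCoeff_multSum m (fun a => (hi a).trans_le hN) (hj.trans_le hN))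

theorem IsDiagonalBasis.isBoundedOp_diagOp (hB : V.IsDiagonalBasis e c)
    (d : ℕ → 𝕜) {B : ℝ} (hd : ∀ i, ‖d i‖ ≤ B) (N : ℕ) :
    V.IsBoundedOp (diagOp e c d N) := by
  intro l
  obtain ⟨k, C, hC, h⟩ := hB.diag_bound l
  have h1 := h N d B ((norm_nonneg _).trans (hd 0)) hd
  obtain ⟨Λ, hΛ, -⟩ := V.exists_extension k
    (LinearMap.compMultilinearMap ((V.proj l) ∘ₗ diagOp e c d N)
      (MultilinearMap.ofSubsingleton 𝕜 V.Limit V.Limit (0 : Fin 1) LinearMap.id))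
    (C := C * B) (mul_nonneg hC ((norm_nonneg _).trans (hd 0))) fun x => by
      simpa [diagOp_apply] using h1 (x 0)
  refine ⟨k, (ContinuousMultilinearMap.ofSubsingleton 𝕜 (V.X k) (V.X l) (0 : Fin 1)).symm Λ,
    fun v => ?_⟩
  simpa using hΛ fun _ => v

/-- Truncation of the arguments is a small perturbation of a multilinear map, uniformly for
bounded families: the arguments are truncated one at a time. -/
theorem IsDiagonalBasis.exists_mult_trunc_sub_le (hB : V.IsDiagonalBasis e c)
    {κ : Type*} {n : ℕ} {M : κ → ℝ → V.Mult n}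
    (h : V.TameBound I (fun k (y : κ × (Fin n → V.Limit)) => ∏ a, ‖V.proj k (y.2 a)‖)
      fun y t => M y.1 t y.2) (l : ℕ) :
    ∃ k r : ℕ, ∀ ε : ℝ, 0 < ε → ∃ N₀, ∀ N ≥ N₀, ∀ y, ∀ t ∈ I, ∀ x,
      ‖V.proj l (M y t (fun a => trunc e c N (x a)) - M y t x)‖ ≤
        ε * (1 + |t|) ^ r * ∏ a, ‖V.proj k (x a)‖ := by
  classical
  obtain ⟨k₁, r, C, hC, h⟩ := h l
  obtain ⟨k₂, h₂⟩ := hB.tail_bound k₁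
  obtain ⟨k₃, D, hD, h₃⟩ := hB.diag_bound k₁
  obtain ⟨C₁, hC₁, hk₁⟩ := V.exists_norm_proj_le (le_max_left k₁ (max k₂ k₃))
  obtain ⟨C₂, hC₂, hk₂⟩ := V.exists_norm_proj_le
    ((le_max_left k₂ k₃).trans (le_max_right k₁ (max k₂ k₃)))
  obtain ⟨C₃, hC₃, hk₃⟩ := V.exists_norm_proj_le
    ((le_max_right k₂ k₃).trans (le_max_right k₁ (max k₂ k₃)))
  set k := max k₁ (max k₂ k₃)
  set E := max C₁ (D * C₃)
  have hE : 0 < E := by positivity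
  refine ⟨k, r, fun ε hε => ?_⟩
  -- there are `n` terms, in each of which the other arguments contribute factors `E`
  set ε' := ε / ((C * n * E ^ n + 1) * C₂) with hε'
  have hε'0 : 0 < ε' := by positivity
  obtain ⟨N₀, hN₀⟩ := h₂ (ε' * E) (by positivity)
  refine ⟨N₀, fun N hN y t ht x => ?_⟩
  obtain ⟨Λ, hΛ, hΛC⟩ := exists_extension_of_bound (M y t) (k := k₁) (l := l)
    (C := C * (1 + |t|) ^ r) (by positivity) fun x => h (y, x) t ht
  rw [map_sub, ← hΛ, ← hΛ]
  have h4 : ∀ a, ‖V.proj k₁ (trunc e c N (x a))‖ ≤ E * ‖V.proj k (x a)‖ := fun a => by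
    have := h₃ N 1 1 zero_le_one (by simp) (x a)
    rw [← diagOp_apply, mul_one] at this
    calc _ ≤ D * ‖V.proj k₃ (x a)‖ := this
      _ ≤ D * (C₃ * ‖V.proj k (x a)‖) := by gcongr; exact hk₃ _
      _ ≤ E * ‖V.proj k (x a)‖ := by
        rw [← mul_assoc]
        gcongr
        exact le_max_right _ _
  have h5 : ∀ a, ‖V.proj k₁ (x a)‖ ≤ E * ‖V.proj k (x a)‖ := fun a =>
    (hk₁ _).trans (by gcongr; exact le_max_left _ _)
  have h6 : ∀ a, ‖V.proj k₁ (trunc e c N (x a)) - V.proj k₁ (x a)‖ ≤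
      ε' * C₂ * E * ‖V.proj k (x a)‖ := fun a => by
    rw [norm_sub_rev, ← map_sub]
    have := hN₀ N hN (x a)
    simp only [diagOp_apply, Pi.one_apply, one_mul]
    calc _ ≤ ε' * E * ‖V.proj k₂ (x a)‖ := this
      _ ≤ ε' * E * (C₂ * ‖V.proj k (x a)‖) := by gcongr; exact hk₂ _
      _ = _ := by ring
  calc _ ≤ ‖Λ‖ * ∑ i, ∏ j, if j = i then ‖V.proj k₁ (trunc e c N (x i)) - V.proj k₁ (x i)‖
        else max ‖V.proj k₁ (trunc e c N (x j))‖ ‖V.proj k₁ (x j)‖ := Λ.norm_image_sub_le' _ _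
    _ ≤ (C * (1 + |t|) ^ r) * ∑ i : Fin n, ∏ j,
        ((if j = i then ε' * C₂ else 1) * (E * ‖V.proj k (x j)‖)) := by
      gcongr with i _ j _
      split_ifs with hij
      · subst hij
        simpa only [mul_assoc] using h6 j
      · rw [one_mul]
        exact max_le (h4 j) (h5 j)
    _ = (C * n * E ^ n) * (ε' * C₂) * (1 + |t|) ^ r * ∏ a, ‖V.proj k (x a)‖ := by
      simp only [Finset.prod_mul_distrib, Finset.prod_ite_eq', Finset.mem_univ, if_true,
        Finset.prod_const, Finset.card_univ, Fintype.card_fin, Finset.sum_const, nsmul_eq_mul]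
      ring
    _ ≤ (C * n * E ^ n + 1) * (ε' * C₂) * (1 + |t|) ^ r * ∏ a, ‖V.proj k (x a)‖ := by
      gcongr
      linarith
    _ = _ := by
      rw [hε']
      have : (C * n * E ^ n + 1) ≠ 0 := by positivity
      field_simp

/-- Truncation of the arguments and of the value is a small perturbation of a multilinear map. -/
theorem IsDiagonalBasis.exists_trunc_mult_trunc_sub_le (hB : V.IsDiagonalBasis e c)
    {κ : Type*} {n : ℕ}
    {M : κ → ℝ → V.Mult n}
    (h : V.TameBound I (fun k (y : κ × (Fin n → V.Limit)) => ∏ a, ‖V.proj k (y.2 a)‖)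
      fun y t => M y.1 t y.2) (l : ℕ) :
    ∃ k r : ℕ, ∀ ε : ℝ, 0 < ε → ∃ N₀, ∀ N ≥ N₀, ∀ y, ∀ t ∈ I, ∀ x,
      ‖V.proj l (trunc e c N (M y t (fun a => trunc e c N (x a))) - M y t x)‖ ≤
        ε * (1 + |t|) ^ r * ∏ a, ‖V.proj k (x a)‖ := by
  obtain ⟨k₁, D, hD, h₁⟩ := hB.diag_bound l
  obtain ⟨k₂, r₂, h₂⟩ := hB.exists_mult_trunc_sub_le h k₁
  obtain ⟨k₃, h₃⟩ := hB.tail_bound l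
  obtain ⟨k₄, r₄, C, hC, h₄⟩ := h k₃
  obtain ⟨C₂, hC₂, hk₂⟩ := V.exists_prod_norm_le (le_max_left k₂ k₄) n
  obtain ⟨C₄, hC₄, hk₄⟩ := V.exists_prod_norm_le (le_max_right k₂ k₄) n
  refine ⟨max k₂ k₄, max r₂ r₄, fun ε hε => ?_⟩
  obtain ⟨N₁, hN₁⟩ := h₂ (ε / 2 / ((D + 1) * C₂)) (by positivity)
  obtain ⟨N₂, hN₂⟩ := h₃ (ε / 2 / ((C + 1) * C₄)) (by positivity)
  refine ⟨max N₁ N₂, fun N hN y t ht x => ?_⟩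
  have h5 := hN₁ N ((le_max_left _ _).trans hN) y t ht x
  have h6 := hN₂ N ((le_max_right _ _).trans hN) (M y t x)
  have h7 := h₁ N 1 1 zero_le_one (by simp)
    (M y t (fun a => trunc e c N (x a)) - M y t x)
  rw [← diagOp_apply, mul_one] at h7
  have h8 : trunc e c N (M y t (fun a => trunc e c N (x a))) - M y t x =
      trunc e c N (M y t (fun a => trunc e c N (x a)) - M y t x) -
      (M y t x - ∑ i ∈ Finset.range N, c i (M y t x) • e i) := by
    rw [map_sub]
    have : ∑ i ∈ Finset.range N, c i (M y t x) • e i = trunc e c N (M y t x) := by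
      simp [diagOp_apply]
    rw [this]
    abel
  have ht1 : 1 ≤ 1 + |t| := by linarith [abs_nonneg t]
  have h9 : D * ‖V.proj k₁ (M y t (fun a => trunc e c N (x a)) - M y t x)‖ ≤
      ε / 2 * (1 + |t|) ^ max r₂ r₄ * ∏ a, ‖V.proj (max k₂ k₄) (x a)‖ := by
    calc _ ≤ (D + 1) * (ε / 2 / ((D + 1) * C₂) * (1 + |t|) ^ (max r₂ r₄) *
          (C₂ * ∏ a, ‖V.proj (max k₂ k₄) (x a)‖)) := by
          gcongr
          · linarith
          · refine h5.trans ?_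
            gcongr
            · exact le_max_left _ _
            · exact hk₂ x
      _ = _ := by field_simp
  have h10 : ε / 2 / ((C + 1) * C₄) * ‖V.proj k₃ (M y t x)‖ ≤
      ε / 2 * (1 + |t|) ^ max r₂ r₄ * ∏ a, ‖V.proj (max k₂ k₄) (x a)‖ := by
    calc _ ≤ ε / 2 / ((C + 1) * C₄) * ((C + 1) * (1 + |t|) ^ (max r₂ r₄) *
          (C₄ * ∏ a, ‖V.proj (max k₂ k₄) (x a)‖)) := by
          gcongr
          refine (h₄ (y, x) t ht).trans ?_
          gcongr
          · linarith
          · exact le_max_right _ _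
          · exact hk₄ x
      _ = _ := by field_simp
  rw [h8, map_sub]
  refine (norm_sub_le _ _).trans ?_
  linarith

/-- A bounded multilinear map is determined by its values on the basis. -/
theorem IsDiagonalBasis.mult_ext (hB : V.IsDiagonalBasis e c)
    {n : ℕ} {M M' : V.Mult n}
    (hM : ∀ l, ∃ k, ∃ C : ℝ, 0 ≤ C ∧ ∀ x, ‖V.proj l (M x)‖ ≤ C * ∏ a, ‖V.proj k (x a)‖)
    (hM' : ∀ l, ∃ k, ∃ C : ℝ, 0 ≤ C ∧ ∀ x, ‖V.proj l (M' x)‖ ≤ C * ∏ a, ‖V.proj k (x a)‖)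
    (h : ∀ i j, matrixCoeff e c M i j = matrixCoeff e c M' i j) : M = M' := by
  have lim : ∀ {M : V.Mult n},
      (∀ l, ∃ k, ∃ C : ℝ, 0 ≤ C ∧ ∀ x, ‖V.proj l (M x)‖ ≤ C * ∏ a, ‖V.proj k (x a)‖) →
      ∀ l x, Tendsto (fun N => V.proj l (multSum e c N (matrixCoeff e c M) x)) atTop
        (𝓝 (V.proj l (M x))) := by
    intro M hM l x
    have hb : V.TameBound {(0 : ℝ)}
        (fun k (y : Unit × (Fin n → V.Limit)) => ∏ a, ‖V.proj k (y.2 a)‖)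
        fun y _ => M y.2 := fun l => by
      obtain ⟨k, C, hC, h⟩ := hM l
      exact ⟨k, 0, C, hC, fun y t _ => by simpa using h y.2⟩
    obtain ⟨k, r, h1⟩ := hB.exists_trunc_mult_trunc_sub_le (M := fun _ _ => M) hb l
    rw [Metric.tendsto_atTop]
    intro ε hε
    obtain ⟨N₀, hN₀⟩ := h1 (ε / 2 / (1 + ∏ a, ‖V.proj k (x a)‖)) (by
      have : 0 ≤ ∏ a, ‖V.proj k (x a)‖ := Finset.prod_nonneg fun _ _ => norm_nonneg _
      positivity)
    refine ⟨N₀, fun N hN => ?_⟩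
    have h2 := hN₀ N hN () 0 rfl x
    rw [trunc_mult_trunc, map_sub, ← dist_eq_norm] at h2
    have h0 : 0 ≤ ∏ a, ‖V.proj k (x a)‖ := Finset.prod_nonneg fun _ _ => norm_nonneg _
    refine h2.trans_lt ?_
    simp only [abs_zero, add_zero, one_pow, mul_one]
    rw [div_mul_eq_mul_div, div_lt_iff₀ (by positivity)]
    nlinarith
  refine MultilinearMap.ext fun x => V.ext_proj fun l => ?_
  have h1 : matrixCoeff e c M = matrixCoeff e c M' := funext fun i => funext (h i)
  exact tendsto_nhds_unique (lim hM l x) (h1 ▸ lim hM' l x)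

end NestedBanach

/-! ### Multilinear maps with prescribed matrices -/

namespace NestedBanach

variable {𝕜 : Type u} [RCLike 𝕜] {V : NestedBanach.{u, w} 𝕜} {I : Set ℝ}
  {e : ℕ → V.Limit} {c : ℕ → V.Limit →ₗ[𝕜] 𝕜}

theorem IsBoundedOp.hasDerivAt {A : V.Limit →ₗ[𝕜] V.Limit} (hA : V.IsBoundedOp A)
    {x : ℝ → V.Limit} {x' : V.Limit} {t : ℝ}
    (hx : ∀ l, HasDerivAt (fun s => V.proj l (x s)) (V.proj l x') t) (l : ℕ) :
    HasDerivAt (fun s => V.proj l (A (x s))) (V.proj l (A x')) t := by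
  obtain ⟨k, T, hT⟩ := hA l
  simp only [← hT]
  exact (T.restrictScalars ℝ).hasFDerivAt.comp_hasDerivAt t (hx k)

/-- A time-dependent matrix for which the truncated multilinear maps are differentiable `m` times,
with estimates that are uniform with respect to the truncation. -/
def MatrixTame (I : Set ℝ) (e : ℕ → V.Limit) (c : ℕ → V.Limit →ₗ[𝕜] 𝕜) (m : ℕ) {n : ℕ}
    (b : (Fin n → ℕ) → ℕ → ℝ → 𝕜) : Prop :=
  V.Tame I (fun k (y : ℕ × (Fin n → V.Limit)) => ∏ a, ‖V.proj k (y.2 a)‖) m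
    fun y t => multSum e c y.1 (fun i j => b i j t) y.2

theorem isWeight_prod_snd (κ : Type*) (n : ℕ) :
    IsWeight fun (k : ℕ) (y : κ × (Fin n → V.Limit)) => ∏ a, ‖V.proj k (y.2 a)‖ :=
  ⟨fun _ _ => Finset.prod_nonneg fun _ _ => norm_nonneg _, fun _ _ h => by
    obtain ⟨C, hC, H⟩ := V.exists_prod_norm_le h n
    exact ⟨C, hC, fun y => H y.2⟩⟩

theorem MatrixTame.sum {ι : Type*} (S : Finset ι) {m n : ℕ}
    {b : ι → (Fin n → ℕ) → ℕ → ℝ → 𝕜} (h : ∀ r ∈ S, MatrixTame I e c m (b r)) :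
    MatrixTame I e c m fun i j t => ∑ r ∈ S, b r i j t := by
  have h1 := Tame.sum (isWeight_prod_snd ℕ n) S h
  have h2 : (fun (y : ℕ × (Fin n → V.Limit)) t =>
      multSum e c y.1 (fun i j => ∑ r ∈ S, b r i j t) y.2) =
      fun y t => ∑ r ∈ S, multSum e c y.1 (fun i j => b r i j t) y.2 := by
    funext y t
    simp only [multSum_apply, Finset.sum_mul, Finset.sum_smul]
    symm
    rw [Finset.sum_comm]
    exact Finset.sum_congr rfl fun i _ => Finset.sum_comm
  unfold MatrixTame
  rw [h2]
  exact h1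

theorem hasDerivAt_multSum {n : ℕ} {b b' : (Fin n → ℕ) → ℕ → ℝ → 𝕜} {t : ℝ}
    (h : ∀ i j, HasDerivAt (b i j) (b' i j t) t) (N : ℕ) (x : Fin n → V.Limit) (l : ℕ) :
    HasDerivAt (fun s => V.proj l (multSum e c N (fun i j => b i j s) x))
      (V.proj l (multSum e c N (fun i j => b' i j t) x)) t := by
  simp only [multSum_apply, map_sum, map_smul]
  exact HasDerivAt.fun_sum fun i _ => HasDerivAt.fun_sum fun j _ =>
    ((h i j).mul_const _).smul_const _

theorem IsDiagonalBasis.hasDerivAt_coord (hB : V.IsDiagonalBasis e c) (j : ℕ) {x : ℝ → V.Limit}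
    {x' : V.Limit} {t : ℝ} (hx : HasDerivAt (fun s => V.proj 0 (x s)) (V.proj 0 x') t) :
    HasDerivAt (fun s => c j (x s)) (c j x') t := by
  obtain ⟨T, hT⟩ := hB.coord_bounded j
  simp only [← hT]
  exact (T.restrictScalars ℝ).hasFDerivAt.comp_hasDerivAt t hx

/-- The matrix elements of a tame matrix are differentiable, as they are coordinates of the
truncated maps at basis vectors, and the matrix of their derivatives is tame. -/
theorem IsDiagonalBasis.exists_matrixTame_deriv (hB : V.IsDiagonalBasis e c) (hI : IsOpen I)
    {n : ℕ} {b : (Fin n → ℕ) → ℕ → ℝ → 𝕜} (h : ∀ m, MatrixTame I e c m b) :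
    ∃ b' : (Fin n → ℕ) → ℕ → ℝ → 𝕜, (∀ i j, ∀ t ∈ I, HasDerivAt (b i j) (b' i j t) t) ∧
      ∀ m, MatrixTame I e c m b' := by
  obtain ⟨_, d, hd, _⟩ := h 1
  have hN : ∀ (i : Fin n → ℕ) (j : ℕ), ∃ N, (∀ a, i a < N) ∧ j < N := fun i j =>
    ⟨Finset.univ.sup i + j + 1, fun a => by
      have := Finset.le_sup (f := i) (Finset.mem_univ a)
      omega, by omega⟩
  choose N hiN hjN using hN
  have h1 : ∀ i j, ∀ t ∈ I, HasDerivAt (b i j) (c j (d (N i j, fun a => e (i a)) t)) t := by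
    intro i j t ht
    have h2 := hB.hasDerivAt_coord j (hd (N i j, fun a => e (i a)) t ht 0)
    refine h2.congr_of_eventuallyEq (Eventually.of_forall fun s => ?_)
    exact (hB.matrixCoeff_multSum (fun i j => b i j s) (hiN i j) (hjN i j)).symm
  obtain ⟨b', hb'⟩ : ∃ b' : (Fin n → ℕ) → ℕ → ℝ → 𝕜,
      ∀ i j, ∀ t ∈ I, HasDerivAt (b i j) (b' i j t) t := ⟨_, h1⟩
  refine ⟨b', hb', fun m => ?_⟩
  have h3 : MatrixTame I e c (m + 1) b := h (m + 1)
  unfold MatrixTame at h3 ⊢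
  refine Tame.of_hasDerivAt hI h3 ?_
  rintro ⟨N', x⟩ t ht l
  exact hasDerivAt_multSum (b := b) (b' := b') (fun i j => hb' i j t ht) N' x l

/-- The truncated multilinear maps with a given matrix converge in norm, locally uniformly in
time. -/
theorem IsDiagonalBasis.exists_mult_of_matrixTame (hB : V.IsDiagonalBasis e c) {n : ℕ}
    {b : (Fin n → ℕ) → ℕ → ℝ → 𝕜} (h : MatrixTame I e c 0 b) :
    ∃ M : ℝ → V.Mult n, ∀ l, ∃ k r : ℕ, ∀ ε : ℝ, 0 < ε → ∃ N₀, ∀ N ≥ N₀, ∀ t ∈ I, ∀ x,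
      ‖V.proj l (multSum e c N (fun i j => b i j t) x - M t x)‖ ≤
        ε * (1 + |t|) ^ r * ∏ a, ‖V.proj k (x a)‖ := by
  classical
  have h1 : ∀ l, ∃ k r : ℕ, ∀ ε : ℝ, 0 < ε → ∃ N₀, ∀ N ≥ N₀, ∀ N' ≥ N, ∀ t ∈ I, ∀ x,
      ‖V.proj l (multSum e c N (fun i j => b i j t) x) -
        V.proj l (multSum e c N' (fun i j => b i j t) x)‖ ≤
        ε * (1 + |t|) ^ r * ∏ a, ‖V.proj k (x a)‖ := by
    intro l
    obtain ⟨k, r, h2⟩ := hB.exists_trunc_mult_trunc_sub_le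
      (M := fun N t => multSum e c N fun i j => b i j t) h l
    refine ⟨k, r, fun ε hε => ?_⟩
    obtain ⟨N₀, hN₀⟩ := h2 ε hε
    refine ⟨N₀, fun N hN N' hN' t ht x => ?_⟩
    have := hN₀ N hN N' t ht x
    rwa [hB.trunc_multSum_trunc hN', map_sub] at this
  have h3 : ∀ t, ∀ x : Fin n → V.Limit, ∃ v : V.Limit, t ∈ I → ∀ l, Tendsto
      (fun N => V.proj l (multSum e c N (fun i j => b i j t) x)) atTop (𝓝 (V.proj l v)) := by
    intro t x
    by_cases ht : t ∈ I
    · obtain ⟨v, hv⟩ := V.exists_limit_of_cauchySeq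
        (fun N => multSum e c N (fun i j => b i j t) x) fun l => by
          obtain ⟨k, r, h2⟩ := h1 l
          refine Metric.cauchySeq_iff'.2 fun ε hε => ?_
          set D := (1 + |t|) ^ r * ∏ a, ‖V.proj k (x a)‖ with hD
          have hD0 : 0 ≤ D := by positivity
          obtain ⟨N₀, hN₀⟩ := h2 (ε / (D + 1)) (by positivity)
          refine ⟨N₀, fun N hN => ?_⟩
          rw [dist_comm, dist_eq_norm]
          refine (hN₀ N₀ le_rfl N hN t ht x).trans_lt ?_
          rw [mul_assoc, ← hD, div_mul_eq_mul_div, div_lt_iff₀ (by positivity)]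
          nlinarith
      exact ⟨v, fun _ => hv⟩
    · exact ⟨0, fun h => absurd h ht⟩
  choose M hM using h3
  refine ⟨fun t => if ht : t ∈ I then
    { toFun := M t
      map_update_add' := fun x a y z => V.ext_proj fun l => ?_
      map_update_smul' := fun x a r y => V.ext_proj fun l => ?_ } else 0, fun l => ?_⟩
  · refine tendsto_nhds_unique (hM t _ ht l) ?_
    -- a structure field quantifies over all decidability instances
    have hd : ‹DecidableEq (Fin n)› = fun a b => instDecidableEqFin n a b :=
      Subsingleton.elim _ _
    subst hd
    simp only [MultilinearMap.map_update_add, map_add]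
    exact (hM t _ ht l).add (hM t _ ht l)
  · refine tendsto_nhds_unique (hM t _ ht l) ?_
    have hd : ‹DecidableEq (Fin n)› = fun a b => instDecidableEqFin n a b :=
      Subsingleton.elim _ _
    subst hd
    simp only [MultilinearMap.map_update_smul, map_smul]
    exact (hM t _ ht l).const_smul r
  · obtain ⟨k, r, h2⟩ := h1 l
    refine ⟨k, r, fun ε hε => ?_⟩
    obtain ⟨N₀, hN₀⟩ := h2 ε hε
    refine ⟨N₀, fun N hN t ht x => ?_⟩
    beta_reduce
    rw [dif_pos ht, map_sub]
    refine le_of_tendsto ((tendsto_const_nhds.sub (hM t x ht l)).norm) ?_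
    filter_upwards [eventually_ge_atTop N] with N' hN'
    exact hN₀ N hN N' hN' t ht x

/-- A matrix with uniformly bounded truncations is that of a tame multilinear map. -/
theorem IsDiagonalBasis.exists_tameMult (hB : V.IsDiagonalBasis e c) (hI : IsOpen I) {n : ℕ}
    {b : (Fin n → ℕ) → ℕ → ℝ → 𝕜} (h : ∀ m, MatrixTame I e c m b) :
    ∃ M : ℝ → V.Mult n, V.TameMult I M ∧
      ∀ t ∈ I, ∀ i j, matrixCoeff e c (M t) i j = b i j t := by
  -- a derivative of the limit is the limit of the derivatives, which converge locally uniformly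
  have key : ∀ m {b : (Fin n → ℕ) → ℕ → ℝ → 𝕜} {M : ℝ → V.Mult n},
      (∀ m, MatrixTame I e c m b) →
      (∀ l, ∃ k r : ℕ, ∀ ε : ℝ, 0 < ε → ∃ N₀, ∀ N ≥ N₀, ∀ t ∈ I, ∀ x,
        ‖V.proj l (multSum e c N (fun i j => b i j t) x - M t x)‖ ≤
          ε * (1 + |t|) ^ r * ∏ a, ‖V.proj k (x a)‖) →
      V.Tame I (fun k (x : Fin n → V.Limit) => ∏ a, ‖V.proj k (x a)‖) m fun x t => M t x := by
    intro m
    have bound : ∀ {b : (Fin n → ℕ) → ℕ → ℝ → 𝕜} {M : ℝ → V.Mult n},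
        (∀ m, MatrixTame I e c m b) →
        (∀ l, ∃ k r : ℕ, ∀ ε : ℝ, 0 < ε → ∃ N₀, ∀ N ≥ N₀, ∀ t ∈ I, ∀ x,
          ‖V.proj l (multSum e c N (fun i j => b i j t) x - M t x)‖ ≤
            ε * (1 + |t|) ^ r * ∏ a, ‖V.proj k (x a)‖) →
        V.TameBound I (fun k (x : Fin n → V.Limit) => ∏ a, ‖V.proj k (x a)‖)
          fun x t => M t x := by
      intro b M h hM
      have h1 : ∃ N : ℕ → ℕ, ∀ l, ∃ k r : ℕ, ∀ t ∈ I, ∀ x,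
          ‖V.proj l (multSum e c (N l) (fun i j => b i j t) x - M t x)‖ ≤
            1 * (1 + |t|) ^ r * ∏ a, ‖V.proj k (x a)‖ := by
        choose k r h1 using hM
        choose N hN using fun l => h1 l 1 one_pos
        exact ⟨N, fun l => ⟨k l, r l, fun t ht x => hN l (N l) le_rfl t ht x⟩⟩
      obtain ⟨N, h1⟩ := h1
      intro l
      obtain ⟨k₁, r₁, h1⟩ := h1 l
      obtain ⟨k₂, r₂, C, hC, h2⟩ := h 0 l
      obtain ⟨C₁, hC₁, hk₁⟩ := V.exists_prod_norm_le (le_max_left k₁ k₂) n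
      obtain ⟨C₂, hC₂, hk₂⟩ := V.exists_prod_norm_le (le_max_right k₁ k₂) n
      refine ⟨max k₁ k₂, max r₁ r₂, C₁ + C * C₂, by positivity, fun x t ht => ?_⟩
      have ht1 : 1 ≤ 1 + |t| := by linarith [abs_nonneg t]
      have h3 := h2 (N l, x) t ht
      have h4 := h1 t ht x
      have h5 : V.proj l (M t x) = V.proj l (multSum e c (N l) (fun i j => b i j t) x) -
          V.proj l (multSum e c (N l) (fun i j => b i j t) x - M t x) := by
        rw [map_sub, sub_sub_cancel]
      rw [h5]
      refine (norm_sub_le _ _).trans ((add_le_add h3 h4).trans ?_)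
      calc _ ≤ C * (1 + |t|) ^ (max r₁ r₂) * (C₂ * ∏ a, ‖V.proj (max k₁ k₂) (x a)‖) +
            1 * (1 + |t|) ^ (max r₁ r₂) * (C₁ * ∏ a, ‖V.proj (max k₁ k₂) (x a)‖) := by
            gcongr
            · exact le_max_right _ _
            · exact hk₂ x
            · exact le_max_left _ _
            · exact hk₁ x
        _ = _ := by ring
    induction m with
    | zero => intro b M h hM; exact bound h hM
    | succ m ih =>
      intro b M h hM
      obtain ⟨b', hb', h'⟩ := hB.exists_matrixTame_deriv hI h
      obtain ⟨M', hM'⟩ := hB.exists_mult_of_matrixTame (h' 0)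
      refine ⟨bound h hM, fun x t => M' t x, fun x t ht l => ?_, ih h' hM'⟩
      refine hasDerivAt_of_tendstoLocallyUniformlyOn hI
        (f := fun N s => V.proj l (multSum e c N (fun i j => b i j s) x))
        (f' := fun N s => V.proj l (multSum e c N (fun i j => b' i j s) x))
        (g' := fun s => V.proj l (M' s x)) (l := atTop) ?_
        (Eventually.of_forall fun N s hs =>
          hasDerivAt_multSum (fun i j => hb' i j s hs) N x l) (fun s hs => ?_) ht
      · rw [tendstoLocallyUniformlyOn_iff_forall_isCompact hI]
        intro K hK hKc
        obtain ⟨k, r, h2⟩ := hM' l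
        obtain ⟨B, hB0, hBK⟩ := exists_one_add_abs_pow_le hKc r
        rw [Metric.tendstoUniformlyOn_iff]
        intro ε hε
        have hx0 : 0 ≤ ∏ a, ‖V.proj k (x a)‖ := Finset.prod_nonneg fun _ _ => norm_nonneg _
        obtain ⟨N₀, hN₀⟩ := h2 (ε / 2 / (B * (1 + ∏ a, ‖V.proj k (x a)‖))) (by positivity)
        filter_upwards [eventually_ge_atTop N₀] with N hN s hs
        rw [dist_comm, dist_eq_norm, ← map_sub]
        calc _ ≤ ε / 2 / (B * (1 + ∏ a, ‖V.proj k (x a)‖)) * (1 + |s|) ^ r *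
              ∏ a, ‖V.proj k (x a)‖ := hN₀ N hN s (hK hs) x
          _ ≤ ε / 2 / (B * (1 + ∏ a, ‖V.proj k (x a)‖)) * B *
              (1 + ∏ a, ‖V.proj k (x a)‖) := by
              gcongr
              · exact hBK s hs
              · linarith
          _ = ε / 2 := by field_simp
          _ < ε := by linarith
      · obtain ⟨k, r, h2⟩ := hM l
        rw [Metric.tendsto_atTop]
        intro ε hε
        have hx0 : 0 ≤ (1 + |s|) ^ r * ∏ a, ‖V.proj k (x a)‖ := by positivity
        obtain ⟨N₀, hN₀⟩ := h2 (ε / (1 + (1 + |s|) ^ r * ∏ a, ‖V.proj k (x a)‖)) (by positivity)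
        refine ⟨N₀, fun N hN => ?_⟩
        rw [dist_eq_norm, ← map_sub]
        refine (hN₀ N hN s hs x).trans_lt ?_
        rw [mul_assoc, div_mul_eq_mul_div, div_lt_iff₀ (by positivity)]
        nlinarith
  obtain ⟨M, hM⟩ := hB.exists_mult_of_matrixTame (h 0)
  refine ⟨M, fun m => key m h hM, fun t ht i j => ?_⟩
  -- the `j`-th coordinate is continuous, and constant for large truncations
  obtain ⟨T, hT⟩ := hB.coord_bounded j
  obtain ⟨k, r, h2⟩ := hM 0
  have h3 : Tendsto (fun N => V.proj 0 (multSum e c N (fun i j => b i j t) fun a => e (i a))) atTop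
      (𝓝 (V.proj 0 (M t fun a => e (i a)))) := by
    rw [Metric.tendsto_atTop]
    intro ε hε
    have hx0 : 0 ≤ (1 + |t|) ^ r * ∏ a, ‖V.proj k (e (i a))‖ := by positivity
    obtain ⟨N₀, hN₀⟩ := h2 (ε / (1 + (1 + |t|) ^ r * ∏ a, ‖V.proj k (e (i a))‖)) (by positivity)
    refine ⟨N₀, fun N hN => ?_⟩
    rw [dist_eq_norm, ← map_sub]
    refine (hN₀ N hN t ht _).trans_lt ?_
    rw [mul_assoc, div_mul_eq_mul_div, div_lt_iff₀ (by positivity)]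
    nlinarith
  have h4 := (T.continuous.tendsto _).comp h3
  simp only [Function.comp_def, hT] at h4
  refine tendsto_nhds_unique h4 (tendsto_const_nhds.congr' ?_)
  filter_upwards [eventually_gt_atTop (max (Finset.univ.sup i) j)] with N hN
  refine (hB.matrixCoeff_multSum (fun i j => b i j t) (fun a => ?_) ?_).symm
  · exact ((Finset.le_sup (Finset.mem_univ a)).trans (le_max_left _ _)).trans_lt hN
  · exact (le_max_right _ _).trans_lt hN

/-- Tame multilinear maps remain tame when they are multiplied by bounded diagonal operators. -/
theorem IsDiagonalBasis.matrixTame_diag (hB : V.IsDiagonalBasis e c) {n : ℕ}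
    {M : ℝ → V.Mult n} (hI : IsOpen I) (hM : V.TameMult I M) {d₀ : ℕ → 𝕜} {d : Fin n → ℕ → 𝕜}
    (hd₀ : ∀ j, ‖d₀ j‖ ≤ 1) (hd : ∀ a i, ‖d a i‖ ≤ 1) (m : ℕ) :
    MatrixTame I e c m
      fun i j t => d₀ j * (∏ a, d a (i a)) * matrixCoeff e c (M t) i j := by
  have h0 : ∀ {M : ℝ → V.Mult n} {m : ℕ}, MatrixTame I e c m
      (fun i j t => d₀ j * (∏ a, d a (i a)) * matrixCoeff e c (M t) i j) ↔
      V.Tame I (fun k (y : ℕ × (Fin n → V.Limit)) => ∏ a, ‖V.proj k (y.2 a)‖) m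
        fun y t => diagOp e c d₀ y.1 (M t fun a => diagOp e c (d a) y.1 (y.2 a)) := by
    intro M m
    simp only [MatrixTame, diagOp_mult_diagOp]
  rw [h0]
  have bound : ∀ {M : ℝ → V.Mult n}, V.TameMult I M →
      V.TameBound I (fun k (y : ℕ × (Fin n → V.Limit)) => ∏ a, ‖V.proj k (y.2 a)‖)
        fun y t => diagOp e c d₀ y.1 (M t fun a => diagOp e c (d a) y.1 (y.2 a)) := by
    intro M hM l
    obtain ⟨k₁, C₁, hC₁, h₁⟩ := hB.diag_bound l
    obtain ⟨k₂, r, C₂, hC₂, h₂⟩ := hM 0 k₁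
    obtain ⟨k₃, C₃, hC₃, h₃⟩ := hB.diag_bound k₂
    refine ⟨k₃, r, C₁ * C₂ * C₃ ^ n, by positivity, fun y t ht => ?_⟩
    beta_reduce
    rw [diagOp_apply]
    calc _ ≤ C₁ * 1 * ‖V.proj k₁ (M t fun a => diagOp e c (d a) y.1 (y.2 a))‖ :=
          h₁ y.1 d₀ 1 zero_le_one hd₀ _
      _ ≤ C₁ * 1 * (C₂ * (1 + |t|) ^ r * ∏ a, (C₃ * 1 * ‖V.proj k₃ (y.2 a)‖)) := by
          gcongr
          refine (h₂ _ t ht).trans ?_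
          beta_reduce
          gcongr with a _
          rw [diagOp_apply]
          exact h₃ y.1 (d a) 1 zero_le_one (hd a) _
      _ = _ := by
          rw [Finset.prod_mul_distrib, Finset.prod_const, Finset.card_univ, Fintype.card_fin]
          ring
  induction m generalizing M with
  | zero => exact bound hM
  | succ m ih =>
    obtain ⟨M', hM', hM'T⟩ := hM.exists_tameMult_deriv hI
    exact ⟨bound hM, _, fun y t ht l =>
      (hB.isBoundedOp_diagOp d₀ hd₀ y.1).hasDerivAt (hM' t ht _) l, ih hM'T⟩

/-- Time derivatives commute with operations on multilinear maps that commute with the first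
derivative. -/
theorem TameMult.exists_iteratedDeriv (hI : IsOpen I) {n : ℕ} (m : ℕ) {M : ℝ → V.Mult n}
    (hM : V.TameMult I M) : ∃ D : ℝ → V.Mult n, V.TameMult I D ∧
      ∀ Q : V.Mult n → V.Limit, (∀ M M' : ℝ → V.Mult n, ∀ t ∈ I,
        (∀ x l, HasDerivAt (fun s => V.proj l (M s x)) (V.proj l (M' t x)) t) →
        ∀ l, HasDerivAt (fun s => V.proj l (Q (M s))) (V.proj l (Q (M' t))) t) →
      ∀ t ∈ I, ∀ l, iteratedDeriv m (fun s => V.proj l (Q (M s))) t = V.proj l (Q (D t)) := by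
  induction m generalizing M with
  | zero => exact ⟨M, hM, fun Q _ t _ l => by simp⟩
  | succ m ih =>
    obtain ⟨M', hM', hM'T⟩ := hM.exists_tameMult_deriv hI
    obtain ⟨D, hD, h⟩ := ih hM'T
    refine ⟨D, hD, fun Q hQ t ht l => ?_⟩
    rw [iteratedDeriv_succ', ← h Q hQ t ht l]
    refine Filter.EventuallyEq.iteratedDeriv_eq _ ?_
    filter_upwards [hI.mem_nhds ht] with s hs
    exact (hQ M M' s hs (hM' s hs) l).deriv

/-- Approximations `Q N` of a tame multilinear map `M` converge as polynomials differentiably in time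
if they commute with time derivatives and approximate every tame map in norm, since then the
estimate can be applied to the time derivatives of `M`. -/
theorem polTendsto_of_le (hI : IsOpen I) {n : ℕ} {M : ℝ → V.Mult n}
    (hM : V.TameMult I M) {Q : ℕ → V.Mult n → V.Limit → V.Limit}
    (hQs : ∀ N v, V.SmoothCurve I fun t => Q N (M t) v)
    (hQ : ∀ N v, ∀ M M' : ℝ → V.Mult n, ∀ t ∈ I,
      (∀ x l, HasDerivAt (fun s => V.proj l (M s x)) (V.proj l (M' t x)) t) →
        ∀ l, HasDerivAt (fun s => V.proj l (Q N (M s) v)) (V.proj l (Q N (M' t) v)) t)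
    (hQl : ∀ D : ℝ → V.Mult n, V.TameMult I D → ∀ l, ∃ k r : ℕ, ∀ ε : ℝ, 0 < ε → ∃ N₀, ∀ N ≥ N₀,
      ∀ t ∈ I, ∀ v, ‖V.proj l (Q N (D t) v - D t fun _ => v)‖ ≤
        ε * (1 + |t|) ^ r * ‖V.proj k v‖ ^ n) :
    V.PolTendsto I (fun N t v => Q N (M t) v) fun t v => M t fun _ => v := by
  refine ⟨hQs, fun v => hM.smoothCurve hI _, fun m l => ?_⟩
  obtain ⟨D, hD, h⟩ := hM.exists_iteratedDeriv hI m
  obtain ⟨k, r, h1⟩ := hQl D hD l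
  refine ⟨k, fun K hK hKc ε hε => ?_⟩
  obtain ⟨B, hB0, hBK⟩ := exists_one_add_abs_pow_le hKc r
  obtain ⟨N₀, hN₀⟩ := h1 (ε / B) (by positivity)
  refine ⟨N₀, fun N hN t ht v hv => ?_⟩
  rw [h (fun M => Q N M v - M fun _ => v) (fun M M' t ht hMM' l => by
    simp only [map_sub]
    exact (hQ N v M M' t ht hMM' l).sub (hMM' _ l)) t (hK ht) l]
  refine (hN₀ N hN t (hK ht) v).trans ?_
  calc _ ≤ ε / B * B * 1 := by
        gcongr
        · exact hBK t ht
        · exact pow_le_one₀ (norm_nonneg _) hv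
    _ = ε := by field_simp

/-- The expansion of a multilinear map in all coordinates. -/
theorem IsDiagonalBasis.polTendsto_multSum (hB : V.IsDiagonalBasis e c) (hI : IsOpen I) {n : ℕ}
    {M : ℝ → V.Mult n} (hM : V.TameMult I M) :
    V.PolTendsto I (fun N t v => multSum e c N (matrixCoeff e c (M t)) fun _ => v)
      fun t v => M t fun _ => v := by
  have hb : ∀ N, V.IsBoundedOp (trunc e c N) := hB.isBoundedOp_diagOp 1 (B := 1) (by simp)
  simp only [← trunc_mult_trunc]
  refine polTendsto_of_le hI hM
    (Q := fun N M v => trunc e c N (M fun _ => trunc e c N v)) (fun N v => ?_)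
    (fun N v M M' t _ hM' => (hb N).hasDerivAt (hM' _)) fun D hD l => ?_
  · exact ((hM.tameCurve hI fun _ => tameCurve_const _).map (hb N)).smoothCurve hI
  · have h0 : V.TameBound I (fun k (y : Unit × (Fin n → V.Limit)) => ∏ a, ‖V.proj k (y.2 a)‖)
        fun y t => D t y.2 := TameBound.reindex (hD 0) Prod.snd fun k => ⟨k, 1, by simp⟩
    obtain ⟨k, r, h1⟩ := hB.exists_trunc_mult_trunc_sub_le (M := fun _ => D) h0 l
    refine ⟨k, r, fun ε hε => ?_⟩
    obtain ⟨N₀, hN₀⟩ := h1 ε hε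
    exact ⟨N₀, fun N hN t ht v => by simpa using hN₀ N hN () t ht fun _ => v⟩

end NestedBanach

/-! ### Integrals with exponential kernels -/

theorem RCLike.norm_normedSpace_exp {𝕜 : Type*} [RCLike 𝕜] (x : 𝕜) :
    ‖NormedSpace.exp x‖ = Real.exp (RCLike.re x) := by
  have h1 : NormedSpace.exp ((2 * RCLike.re x : ℝ) : 𝕜) =
      ((Real.exp (2 * RCLike.re x) : ℝ) : 𝕜) := by
    rw [Real.exp_eq_exp_ℝ]
    exact (NormedSpace.algebraMap_exp_comm (𝕂 := ℝ) (𝔸 := 𝕜) _).symm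
  have h2 : star (NormedSpace.exp x) * NormedSpace.exp x =
      ((Real.exp (2 * RCLike.re x) : ℝ) : 𝕜) := by
    rw [NormedSpace.star_exp, ← NormedSpace.exp_add, ← h1]
    congr 1
    rw [add_comm, RCLike.star_def, RCLike.add_conj]
    push_cast
    rfl
  rw [RCLike.star_def, RCLike.conj_mul] at h2
  have h3 : ‖NormedSpace.exp x‖ ^ 2 = Real.exp (RCLike.re x) ^ 2 := by
    rw [← Real.exp_nat_mul]
    exact_mod_cast h2
  exact (pow_left_inj₀ (norm_nonneg _) (Real.exp_pos _).le two_ne_zero).1 h3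

theorem hasDerivAt_exp_neg_mul_ofReal {𝕜 : Type*} [RCLike 𝕜] (μ : 𝕜) (t : ℝ) :
    HasDerivAt (fun s : ℝ => NormedSpace.exp (-(μ * (s : 𝕜))))
      (-μ * NormedSpace.exp (-(μ * (t : 𝕜)))) t := by
  have := hasDerivAt_exp_smul_const' (𝕂 := ℝ) (-μ) t
  simpa [Algebra.smul_def, mul_comm] using this

/-- Convolution of a power of `1 + |t|` with a decaying exponential. It grows no faster than the same
power, because `1 + |τ| ≤ (1 + |t|) (1 + |t - τ|)` and half of the exponential absorbs the power of
the second factor. -/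
theorem exists_integral_exp_mul_pow_le {δ : ℝ} (hδ : 0 < δ) (r : ℕ) : ∃ K : ℝ, 0 ≤ K ∧ ∀ t : ℝ,
    MeasureTheory.Integrable (fun τ : ℝ => Real.exp (-(δ * |t - τ|)) * (1 + |τ|) ^ r) ∧
    ∫ τ : ℝ, Real.exp (-(δ * |t - τ|)) * (1 + |τ|) ^ r ≤ K * (1 + |t|) ^ r := by
  have h1 : MeasureTheory.Integrable fun s : ℝ => Real.exp (-(δ / 2 * |s|)) := by
    rw [← MeasureTheory.integrableOn_univ, ← Iic_union_Ioi (a := (0 : ℝ))]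
    refine MeasureTheory.IntegrableOn.union ?_ ?_
    · refine (integrableOn_exp_mul_Iic (a := δ / 2) (by positivity) 0).congr_fun
        (fun s hs => ?_) measurableSet_Iic
      simp only [abs_of_nonpos (mem_Iic.1 hs)]
      ring_nf
    · refine (integrableOn_exp_mul_Ioi (a := -(δ / 2)) (by linarith) 0).congr_fun
        (fun s hs => ?_) measurableSet_Ioi
      simp only [abs_of_pos (mem_Ioi.1 hs)]
      ring_nf
  set D : ℝ := r.factorial * (2 / δ) ^ r * Real.exp (δ / 2) with hD
  have h2 : ∀ s : ℝ, (1 + |s|) ^ r * Real.exp (-(δ * |s|)) ≤ D * Real.exp (-(δ / 2 * |s|)) := by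
    intro s
    have h3 := Real.pow_div_factorial_le_exp (x := δ / 2 * (1 + |s|)) (by positivity) r
    rw [div_le_iff₀ (by positivity), mul_pow] at h3
    have h4 : (1 + |s|) ^ r = (2 / δ) ^ r * ((δ / 2) ^ r * (1 + |s|) ^ r) := by
      rw [← mul_assoc, ← mul_pow]
      field_simp
      simp
    calc (1 + |s|) ^ r * Real.exp (-(δ * |s|))
        ≤ ((2 / δ) ^ r * (Real.exp (δ / 2 * (1 + |s|)) * r.factorial)) *
          Real.exp (-(δ * |s|)) := by
          rw [h4]
          gcongr
      _ = r.factorial * (2 / δ) ^ r * (Real.exp (δ / 2 * (1 + |s|)) * Real.exp (-(δ * |s|))) := by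
          ring
      _ = r.factorial * (2 / δ) ^ r * (Real.exp (δ / 2) * Real.exp (-(δ / 2 * |s|))) := by
          rw [← Real.exp_add, ← Real.exp_add]
          ring_nf
      _ = _ := by rw [hD]; ring
  have hD0 : 0 ≤ D := by positivity
  refine ⟨D * ∫ s : ℝ, Real.exp (-(δ / 2 * |s|)),
    mul_nonneg hD0 (MeasureTheory.integral_nonneg fun s => (Real.exp_pos _).le), fun t => ?_⟩
  have h5 : ∀ τ : ℝ, Real.exp (-(δ * |t - τ|)) * (1 + |τ|) ^ r ≤
      (1 + |t|) ^ r * D * Real.exp (-(δ / 2 * |t - τ|)) := by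
    intro τ
    have h6 : 1 + |τ| ≤ (1 + |t|) * (1 + |t - τ|) := by
      have h7 : |τ| ≤ |t| + |t - τ| := by
        calc |τ| = |t - (t - τ)| := by ring_nf
          _ ≤ _ := abs_sub _ _
      nlinarith [abs_nonneg t, abs_nonneg (t - τ), mul_nonneg (abs_nonneg t) (abs_nonneg (t - τ))]
    calc _ ≤ Real.exp (-(δ * |t - τ|)) * ((1 + |t|) * (1 + |t - τ|)) ^ r := by gcongr
      _ = (1 + |t|) ^ r * ((1 + |t - τ|) ^ r * Real.exp (-(δ * |t - τ|))) := by
          rw [mul_pow]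
          ring
      _ ≤ (1 + |t|) ^ r * (D * Real.exp (-(δ / 2 * |t - τ|))) :=
          mul_le_mul_of_nonneg_left (h2 _) (by positivity)
      _ = _ := by ring
  have h8 : MeasureTheory.Integrable fun τ : ℝ =>
      (1 + |t|) ^ r * D * Real.exp (-(δ / 2 * |t - τ|)) :=
    ((h1.comp_sub_left t).const_mul _)
  have h9 : MeasureTheory.Integrable fun τ : ℝ => Real.exp (-(δ * |t - τ|)) * (1 + |τ|) ^ r := by
    refine h8.mono' (Continuous.aestronglyMeasurable (by fun_prop))
      (Eventually.of_forall fun τ => ?_)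
    rw [Real.norm_of_nonneg (by positivity)]
    exact h5 τ
  refine ⟨h9, (MeasureTheory.integral_mono h9 h8 h5).trans_eq ?_⟩
  rw [MeasureTheory.integral_const_mul,
    MeasureTheory.integral_sub_left_eq_self (fun s : ℝ => Real.exp (-(δ / 2 * |s|)))]
  ring

section MuIntegral

variable {𝕜 : Type u} [RCLike 𝕜] {I : Set ℝ}

/-- The integrand of `muIntegral` is integrable on a half-line in which the exponential decays. -/
theorem integrableOn_exp_mul {S : Set ℝ} (hS : MeasurableSet S) (hSI : S ⊆ I) {μ : 𝕜} {t δ : ℝ}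
    (hδ : 0 < δ) (hμ : ∀ τ ∈ S, δ * |t - τ| ≤ RCLike.re μ * (t - τ)) {u : ℝ → 𝕜}
    (hu : ContinuousOn u I) {C : ℝ} {r : ℕ}
    (hb : ∀ τ ∈ I, ‖u τ‖ ≤ C * (1 + |τ|) ^ r) :
    MeasureTheory.IntegrableOn
      (fun τ => NormedSpace.exp (-(μ * ((t - τ : ℝ) : 𝕜))) * u τ) S := by
  obtain ⟨K, -, hK⟩ := exists_integral_exp_mul_pow_le hδ r
  have hexp : Continuous fun τ : ℝ => NormedSpace.exp (-(μ * ((t - τ : ℝ) : 𝕜))) :=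
    (continuous_iff_continuousAt.2 fun s => (hasDerivAt_exp_neg_mul_ofReal μ s).continuousAt).comp
      (continuous_const.sub continuous_id)
  refine MeasureTheory.Integrable.mono' ((hK t).1.const_mul C).integrableOn
    ((hexp.continuousOn.mul (hu.mono hSI)).aestronglyMeasurable hS) ?_
  refine (MeasureTheory.ae_restrict_iff' hS).2 (Eventually.of_forall fun τ hτ => ?_)
  rw [norm_mul, RCLike.norm_normedSpace_exp]
  have h1 : RCLike.re (-(μ * ((t - τ : ℝ) : 𝕜))) = -(RCLike.re μ * (t - τ)) := by
    rw [map_neg, mul_comm, RCLike.re_ofReal_mul, mul_comm]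
  rw [h1]
  calc _ ≤ Real.exp (-(δ * |t - τ|)) * (C * (1 + |τ|) ^ r) :=
        mul_le_mul (Real.exp_le_exp.2 (neg_le_neg (hμ τ hτ))) (hb τ (hSI hτ)) (norm_nonneg _)
          (Real.exp_pos _).le
    _ = _ := by ring

theorem re_mul_sub_of_mem_Iic {μ : 𝕜} {t τ : ℝ} (hτ : τ ∈ Iic t) :
    RCLike.re μ * |t - τ| ≤ RCLike.re μ * (t - τ) := by
  rw [abs_of_nonneg (sub_nonneg.2 hτ)]

theorem re_mul_sub_of_mem_Ici {μ : 𝕜} {t τ : ℝ} (hτ : τ ∈ Ici t) :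
    -RCLike.re μ * |t - τ| ≤ RCLike.re μ * (t - τ) := by
  rw [abs_of_nonpos (sub_nonpos.2 hτ)]
  exact (by ring : _ = _).le

theorem muIntegral_sum (hI : IsOpen I) {μ : 𝕜} (hμ : RCLike.re μ ≠ 0) {ι : Type*} (s : Finset ι)
    {u : ι → ℝ → 𝕜} (hu : ∀ i ∈ s, ContinuousOn (u i) I)
    (hb : ∀ i ∈ s, ∃ C : ℝ, ∃ r : ℕ, ∀ τ ∈ I, ‖u i τ‖ ≤ C * (1 + |τ|) ^ r) (t : ℝ) :
    muIntegral I μ (fun τ => ∑ i ∈ s, u i τ) t = ∑ i ∈ s, muIntegral I μ (u i) t := by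
  unfold muIntegral
  simp only [Finset.mul_sum]
  split_ifs with h
  · refine MeasureTheory.integral_finsetSum _ fun i hi => ?_
    obtain ⟨C, r, hb⟩ := hb i hi
    exact integrableOn_exp_mul (hI.measurableSet.inter measurableSet_Iic) inter_subset_left h
      (fun τ hτ => re_mul_sub_of_mem_Iic hτ.2) (hu i hi) hb
  · rw [Finset.sum_neg_distrib]
    refine congrArg _ (MeasureTheory.integral_finsetSum _ fun i hi => ?_)
    obtain ⟨C, r, hb⟩ := hb i hi
    exact integrableOn_exp_mul (hI.measurableSet.inter measurableSet_Ici) inter_subset_left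
      (neg_pos.2 (lt_of_le_of_ne (not_lt.1 h) hμ))
      (fun τ hτ => re_mul_sub_of_mem_Ici hτ.2) (hu i hi) hb

theorem exp_neg_mul_sub (μ : 𝕜) (s τ : ℝ) : NormedSpace.exp (-(μ * ((s - τ : ℝ) : 𝕜))) =
    NormedSpace.exp (-(μ * (s : 𝕜))) * NormedSpace.exp (-(-μ * (τ : 𝕜))) := by
  rw [← NormedSpace.exp_add]
  congr 1
  push_cast
  ring

/-- The function `muIntegral I μ u` solves `y' = u - μ y`. -/
theorem hasDerivAt_muIntegral (hI : IsOpen I) {μ : 𝕜} (hμ : RCLike.re μ ≠ 0) {u : ℝ → 𝕜}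
    (hu : ContinuousOn u I)
    (hb : ∃ C : ℝ, ∃ r : ℕ, ∀ τ ∈ I, ‖u τ‖ ≤ C * (1 + |τ|) ^ r) {t : ℝ} (ht : t ∈ I) :
    HasDerivAt (muIntegral I μ u) (u t - μ * muIntegral I μ u t) t := by
  obtain ⟨C, r, hb⟩ := hb
  -- split the kernel into `exp (-μ s) * exp (μ τ)`, so that `s` is left only in the domain of
  -- integration and in a factor outside the integral
  set g : ℝ → 𝕜 := fun τ => NormedSpace.exp (-(-μ * (τ : 𝕜))) * u τ with hg
  have hgc : ContinuousOn g I := (continuous_iff_continuousAt.2 fun s =>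
    (hasDerivAt_exp_neg_mul_ofReal (-μ) s).continuousAt).continuousOn.mul hu
  have hgc' : ContinuousOn (I.indicator g) I := hgc.congr fun τ hτ => indicator_of_mem hτ g
  have hcancel : ∀ s : ℝ, NormedSpace.exp (-(μ * (s : 𝕜))) *
      NormedSpace.exp (-(-μ * (s : 𝕜))) = 1 := fun s => by
    rw [← NormedSpace.exp_add]
    simp
  -- the integral of the indicator function over a half-line, and its integrability
  have hint : ∀ S : Set ℝ, MeasurableSet S → ∀ s : ℝ,
      ∫ τ in I ∩ S, NormedSpace.exp (-(μ * ((s - τ : ℝ) : 𝕜))) * u τ =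
        NormedSpace.exp (-(μ * (s : 𝕜))) * ∫ τ in S, I.indicator g τ := fun S hS s => by
    rw [MeasureTheory.setIntegral_indicator hI.measurableSet, inter_comm,
      ← MeasureTheory.integral_const_mul]
    simp only [exp_neg_mul_sub, hg, mul_assoc]
  have hintg : ∀ S : Set ℝ, MeasurableSet S → ∀ (s δ : ℝ), 0 < δ →
      (∀ τ ∈ S, δ * |s - τ| ≤ RCLike.re μ * (s - τ)) →
      MeasureTheory.IntegrableOn (I.indicator g) S := fun S hS s δ hδ h => by
    have h1 := (integrableOn_exp_mul (hI.measurableSet.inter hS) inter_subset_left hδ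
      (fun τ hτ => h τ hτ.2) hu hb).const_mul (NormedSpace.exp (-(-μ * (s : 𝕜))))
    rw [MeasureTheory.IntegrableOn, MeasureTheory.integrable_indicator_iff hI.measurableSet,
      MeasureTheory.IntegrableOn, MeasureTheory.Measure.restrict_restrict hI.measurableSet]
    refine h1.congr (Eventually.of_forall fun τ => ?_)
    simp only [exp_neg_mul_sub, hg]
    rw [← mul_assoc, ← mul_assoc, mul_comm (NormedSpace.exp (-(-μ * (s : 𝕜)))), hcancel, one_mul]
  have hmain : HasDerivAt (fun s => ∫ τ in t..s, I.indicator g τ) (g t) t := by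
    have h1 := intervalIntegral.integral_hasDerivAt_right (f := I.indicator g) (a := t) (b := t)
      IntervalIntegrable.refl (hgc'.stronglyMeasurableAtFilter hI t ht)
      (hgc'.continuousAt (hI.mem_nhds ht))
    rwa [indicator_of_mem ht] at h1
  have hfinal : ∀ Γ : ℝ → 𝕜, (∀ s, muIntegral I μ u s = NormedSpace.exp (-(μ * (s : 𝕜))) * Γ s) →
      (∀ s, Γ s = Γ t + ∫ τ in t..s, I.indicator g τ) →
      HasDerivAt (muIntegral I μ u) (u t - μ * muIntegral I μ u t) t := by
    intro Γ h1 h2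
    have h3 : HasDerivAt Γ (g t) t := by
      rw [funext h2]
      exact hmain.const_add _
    have h4 : NormedSpace.exp (-(μ * (t : 𝕜))) * g t = u t := by
      simp only [hg]
      rw [← mul_assoc, hcancel, one_mul]
    refine (((hasDerivAt_exp_neg_mul_ofReal μ t).mul h3).congr_of_eventuallyEq
      (Eventually.of_forall h1)).congr_deriv ?_
    rw [h4, h1 t]
    ring
  by_cases h : 0 < RCLike.re μ
  · have h1 : ∀ s, MeasureTheory.IntegrableOn (I.indicator g) (Iic s) := fun s =>
      hintg _ measurableSet_Iic s _ h fun τ hτ => re_mul_sub_of_mem_Iic hτ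
    refine hfinal (fun s => ∫ τ in Iic s, I.indicator g τ) (fun s => ?_) fun s => ?_
    · rw [muIntegral, if_pos h, hint _ measurableSet_Iic]
    · rw [← intervalIntegral.integral_Iic_sub_Iic (h1 t) (h1 s)]
      ring
  · have h1 : ∀ s, MeasureTheory.IntegrableOn (I.indicator g) (Ioi s) := fun s =>
      (hintg _ measurableSet_Ici s _ (neg_pos.2 (lt_of_le_of_ne (not_lt.1 h) hμ))
        fun τ hτ => re_mul_sub_of_mem_Ici hτ).mono_set Ioi_subset_Ici_self
    refine hfinal (fun s => -∫ τ in Ioi s, I.indicator g τ) (fun s => ?_) fun s => ?_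
    · rw [muIntegral, if_neg h, hint _ measurableSet_Ici,
        MeasureTheory.integral_Ici_eq_integral_Ioi, mul_neg]
    · rw [← intervalIntegral.integral_Ioi_sub_Ioi' (h1 t) (h1 s)]
      ring

end MuIntegral

/-! ### The homological equation -/

namespace NestedBanach

variable {𝕜 : Type u} [RCLike 𝕜] {V : NestedBanach.{u, w} 𝕜} {I : Set ℝ}
  {e : ℕ → V.Limit} {c : ℕ → V.Limit →ₗ[𝕜] 𝕜}

/-- The coordinates of an eigenvector expansion are eigenfunctionals. -/
theorem IsDiagonalBasis.coord_apply_eigen (hB : V.IsDiagonalBasis e c)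
    {A : V.Limit →ₗ[𝕜] V.Limit} (hA : V.IsBoundedOp A) {ev : ℕ → 𝕜}
    (he : ∀ j, A (e j) = ev j • e j) (j : ℕ) (v : V.Limit) : c j (A v) = ev j * c j v := by
  have lim : ∀ l v, Tendsto (fun N => V.proj l (trunc e c N v)) atTop (𝓝 (V.proj l v)) := by
    intro l v
    obtain ⟨k, h⟩ := hB.tail_bound l
    rw [Metric.tendsto_atTop]
    intro ε hε
    obtain ⟨N₀, hN₀⟩ := h (ε / (1 + ‖V.proj k v‖)) (by positivity)
    refine ⟨N₀, fun N hN => ?_⟩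
    have h1 := hN₀ N hN v
    rw [dist_comm, dist_eq_norm, ← map_sub, diagOp_apply]
    simp only [Pi.one_apply, one_mul]
    refine h1.trans_lt ?_
    rw [div_mul_eq_mul_div, div_lt_iff₀ (by positivity)]
    nlinarith [norm_nonneg (V.proj k v)]
  obtain ⟨T, hT⟩ := hB.coord_bounded j
  obtain ⟨k, S, hS⟩ := hA 0
  have h1 : Tendsto (fun N => c j (A (trunc e c N v))) atTop (𝓝 (c j (A v))) := by
    simp only [← hT, ← hS]
    exact ((T.comp S).continuous.tendsto _).comp (lim k v)
  refine tendsto_nhds_unique h1 (tendsto_const_nhds.congr' ?_)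
  filter_upwards [eventually_gt_atTop j] with N hN
  simp only [diagOp_apply, Pi.one_apply, one_mul, map_sum, map_smul, he, hB.coord_self,
    smul_eq_mul]
  rw [Finset.sum_eq_single j (fun i _ hi => by simp [hi.symm]) (by simp [hN])]
  simp
  ring

/-- The coordinates of a tame curve are smooth and, with all their derivatives, grow at most
polynomially. -/
theorem IsDiagonalBasis.coord_tameCurve (hB : V.IsDiagonalBasis e c) (hI : IsOpen I) (j : ℕ)
    {x : ℝ → V.Limit} (hx : V.TameCurve I x) :
    ContDiffOn ℝ ∞ (fun t => c j (x t)) I ∧ ∀ m, ∃ C : ℝ, ∃ r : ℕ, 0 ≤ C ∧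
      ∀ t ∈ I, ‖iteratedDeriv m (fun t => c j (x t)) t‖ ≤ C * (1 + |t|) ^ r := by
  obtain ⟨T, hT⟩ := hB.coord_bounded j
  refine ⟨?_, fun m => ?_⟩
  · simp only [← hT]
    exact (T.restrictScalars ℝ).contDiff.comp_contDiffOn (hx.smoothCurve hI 0)
  · induction m generalizing x with
    | zero =>
      obtain ⟨k, r, C, hC, h⟩ := (hx 0).bound 0
      refine ⟨‖T‖ * C, r, by positivity, fun t ht => ?_⟩
      rw [iteratedDeriv_zero, ← hT, mul_assoc]
      refine (T.le_opNorm _).trans (mul_le_mul_of_nonneg_left ?_ (norm_nonneg _))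
      simpa using h () t ht
    | succ m ih =>
      obtain ⟨x', hx', hx'T⟩ := hx.exists_deriv hI
      obtain ⟨C, r, hC, h⟩ := ih hx'T
      refine ⟨C, r, hC, fun t ht => ?_⟩
      rw [iteratedDeriv_succ']
      refine (congrArg norm (Filter.EventuallyEq.iteratedDeriv_eq m ?_)).trans_le (h t ht)
      filter_upwards [hI.mem_nhds ht] with s hs
      exact (hB.hasDerivAt_coord j (hx' s hs 0)).deriv

theorem IsDiagonalBasis.matrixCoeff_growth (hB : V.IsDiagonalBasis e c) (hI : IsOpen I) {n : ℕ}
    {T : ℝ → V.Mult n} (hT : V.TameMult I T) (i : Fin n → ℕ) (j : ℕ) :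
    ContinuousOn (fun t => matrixCoeff e c (T t) i j) I ∧ ∃ C : ℝ, ∃ r : ℕ,
      ∀ t ∈ I, ‖matrixCoeff e c (T t) i j‖ ≤ C * (1 + |t|) ^ r := by
  have h := hB.coord_tameCurve hI j (hT.tameCurve hI fun a => tameCurve_const (e (i a)))
  refine ⟨h.1.continuousOn, ?_⟩
  obtain ⟨C, r, -, h1⟩ := h.2 0
  exact ⟨C, r, fun t ht => by simpa using! h1 t ht⟩

section Block

variable {Γ : Type} [DecidableEq Γ]

/-- The indicator function of the block of the matrices of `n`-linear maps in which the indices of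
the arguments have the classes `κ`, and that of the value has the class `κ₀`. -/
def blockInd (𝕜 : Type u) [RCLike 𝕜] (cls : ℕ → Γ) {n : ℕ} (κ₀ : Γ) (κ : Fin n → Γ)
    (i : Fin n → ℕ) (j : ℕ) : 𝕜 :=
  (if cls j = κ₀ then 1 else 0) * ∏ a, if cls (i a) = κ a then 1 else 0

theorem blockInd_eq (cls : ℕ → Γ) {n : ℕ} (κ₀ : Γ) (κ : Fin n → Γ) (i : Fin n → ℕ) (j : ℕ) :
    blockInd 𝕜 cls κ₀ κ i j = if κ₀ = cls j ∧ κ = fun a => cls (i a) then 1 else 0 := by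
  unfold blockInd
  split_ifs with h1 h2 h2
  · rw [one_mul, Finset.prod_eq_one]
    exact fun a _ => if_pos (by rw [h2.2])
  · have : ∃ a, cls (i a) ≠ κ a := by
      by_contra! h
      exact h2 ⟨h1.symm, funext fun a => (h a).symm⟩
    obtain ⟨a, ha⟩ := this
    rw [one_mul, Finset.prod_eq_zero (Finset.mem_univ a) (if_neg ha)]
  · exact absurd h2.1.symm h1
  · rw [zero_mul]

/-- A sum over blocks has only one nonzero term, that of the block to which the entry belongs. -/
theorem sum_blockInd [Fintype Γ] (cls : ℕ → Γ) {n : ℕ} (i : Fin n → ℕ) (j : ℕ)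
    (b : Γ × (Fin n → Γ) → 𝕜) (Rem : Γ × (Fin n → Γ) → Prop) [DecidablePred Rem] :
    ∑ κ with Rem κ, blockInd 𝕜 cls κ.1 κ.2 i j * b κ =
      if Rem (cls j, fun a => cls (i a)) then b (cls j, fun a => cls (i a)) else 0 := by
  have h1 : ∀ κ : Γ × (Fin n → Γ), blockInd 𝕜 cls κ.1 κ.2 i j * b κ =
      if κ = (cls j, fun a => cls (i a)) then b κ else 0 := fun κ => by
    rw [blockInd_eq, ite_mul, one_mul, zero_mul]
    exact if_congr (by rw [Prod.ext_iff]) rfl rfl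
  simp only [h1]
  rw [Finset.sum_ite_eq']
  simp

/-- In a basis of eigenvectors, multiplication of the matrix elements by the exponents
`∑ a, ev (i a) - ev j` is the derivation of the multilinear map along `A`, minus composition
with `A`. -/
theorem multSum_eigen {A : V.Limit →ₗ[𝕜] V.Limit} {ev : ℕ → 𝕜}
    (he : ∀ j, A (e j) = ev j • e j) (hc : ∀ j v, c j (A v) = ev j * c j v) {n : ℕ} (N : ℕ)
    (b : (Fin n → ℕ) → ℕ → 𝕜) (x : Fin n → V.Limit) :
    multSum e c N (fun i j => (∑ a, ev (i a) - ev j) * b i j) x =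
      ∑ a, multSum e c N b (Function.update x a (A (x a))) - A (multSum e c N b x) := by
  have h1 : ∀ a (i : Fin n → ℕ), ∏ a', c (i a') (Function.update x a (A (x a)) a') =
      ev (i a) * ∏ a', c (i a') (x a') := by
    intro a i
    have h2 : ∀ a', c (i a') (Function.update x a (A (x a)) a') =
        (if a' = a then ev (i a') else 1) * c (i a') (x a') := by
      intro a'
      rcases eq_or_ne a' a with rfl | h
      · simp [hc]
      · simp [h]
    simp only [h2, Finset.prod_mul_distrib, Finset.prod_ite_eq', Finset.mem_univ, if_true]
  simp only [multSum_apply, h1, map_sum, map_smul, he, smul_smul]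
  rw [Finset.sum_comm (s := Finset.univ), ← Finset.sum_sub_distrib]
  refine Finset.sum_congr rfl fun i _ => ?_
  rw [Finset.sum_comm (s := Finset.univ), ← Finset.sum_sub_distrib]
  refine Finset.sum_congr rfl fun j _ => ?_
  rw [← Finset.sum_smul, ← sub_smul]
  congr 1
  simp only [sub_mul, Finset.sum_mul]
  congr 1
  · exact Finset.sum_congr rfl fun a _ => by ring
  · ring

/-- A product of norms, where a bounded operator is applied to one of the arguments. -/
theorem exists_prod_update_le {A : V.Limit →ₗ[𝕜] V.Limit} (hA : V.IsBoundedOp A) {n : ℕ} (k : ℕ)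
    (a : Fin n) : ∃ k', ∃ C : ℝ, 0 ≤ C ∧ ∀ y : ℕ × (Fin n → V.Limit),
      ∏ b, ‖V.proj k (Function.update y.2 a (A (y.2 a)) b)‖ ≤ C * ∏ b, ‖V.proj k' (y.2 b)‖ := by
  obtain ⟨k₁, S, hS⟩ := hA k
  obtain ⟨C₁, hC₁, h₁⟩ := V.exists_norm_proj_le (le_max_left k k₁)
  obtain ⟨C₂, hC₂, h₂⟩ := V.exists_norm_proj_le (le_max_right k k₁)
  refine ⟨max k k₁, (C₁ + ‖S‖ * C₂) ^ n, by positivity, fun y => ?_⟩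
  calc _ ≤ ∏ b, (C₁ + ‖S‖ * C₂) * ‖V.proj (max k k₁) (y.2 b)‖ := by
        gcongr with b _
        have h0 := norm_nonneg (V.proj (max k k₁) (y.2 b))
        rcases eq_or_ne b a with rfl | hb
        · rw [Function.update_self, ← hS]
          refine (S.le_opNorm _).trans ?_
          nlinarith [mul_le_mul_of_nonneg_left (h₂ (y.2 b)) (norm_nonneg S)]
        · rw [Function.update_of_ne hb]
          refine (h₁ _).trans ?_
          have : 0 ≤ ‖S‖ * C₂ := by positivity
          nlinarith
    _ = _ := by rw [Finset.prod_mul_distrib, Finset.prod_const, Finset.card_univ, Fintype.card_fin]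

/-- In a block in which the exponents all have a real part of the same sign, bounded away from `0`,
the integrals `muIntegral` of the matrix entries of a tame multilinear map are again the matrix
entries of a bounded multilinear map. The integral may be taken after the multilinear map has been
composed with diagonal operators that consist of exponentials. -/
theorem IsDiagonalBasis.tameBound_muIntegral (hB : V.IsDiagonalBasis e c) (hI : IsOpen I)
    {ev : ℕ → 𝕜} {cls : ℕ → Γ} {n : ℕ} {T : ℝ → V.Mult n} (hT : V.TameMult I T) {κ₀ : Γ}
    {κ : Fin n → Γ} {σ θ₀ : ℝ} {θ : Fin n → ℝ} (hσ : σ = 1 ∨ σ = -1)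
    (hθ₀ : ∀ j, cls j = κ₀ → σ * RCLike.re (ev j) ≤ θ₀)
    (hθ : ∀ a i, cls i = κ a → -σ * RCLike.re (ev i) ≤ θ a) (hneg : θ₀ + ∑ a, θ a < 0) :
    MatrixTame I e c 0 fun i j t => blockInd 𝕜 cls κ₀ κ i j *
      muIntegral I (∑ a, ev (i a) - ev j) (fun τ => matrixCoeff e c (T τ) i j) t := by
  set δ := -(θ₀ + ∑ a, θ a) with hδ
  have hδ0 : 0 < δ := by linarith
  -- the half-line over which one integrates
  set S : ℝ → Set ℝ := fun t => I ∩ if σ = 1 then Iic t else Ici t with hS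
  have hSm : ∀ t, MeasurableSet (S t) := fun t => by
    refine hI.measurableSet.inter ?_
    split_ifs
    exacts [measurableSet_Iic, measurableSet_Ici]
  have hSσ : ∀ t, ∀ τ ∈ S t, t - τ = σ * |t - τ| := by
    intro t τ hτ
    rcases hσ with rfl | rfl
    · have h1 := hτ.2
      rw [if_pos rfl] at h1
      rw [abs_of_nonneg (sub_nonneg.2 h1), one_mul]
    · have h1 := hτ.2
      rw [if_neg (by norm_num)] at h1
      rw [abs_of_nonpos (sub_nonpos.2 h1)]
      ring
  have hχ : ∀ i j, blockInd 𝕜 cls κ₀ κ i j = 0 ∨ (cls j = κ₀ ∧ ∀ a, cls (i a) = κ a) := by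
    intro i j
    rw [blockInd_eq]
    split_ifs with h
    · exact Or.inr ⟨h.1.symm, fun a => by rw [h.2]⟩
    · exact Or.inl rfl
  have hμ : ∀ (i : Fin n → ℕ) j, (cls j = κ₀ ∧ ∀ a, cls (i a) = κ a) →
      δ ≤ σ * RCLike.re (∑ a, ev (i a) - ev j) := by
    intro i j h
    rw [map_sub, map_sum, mul_sub, Finset.mul_sum]
    have h1 := hθ₀ j h.1
    have h2 : ∑ a, -σ * RCLike.re (ev (i a)) ≤ ∑ a, θ a :=
      Finset.sum_le_sum fun a _ => hθ a (i a) (h.2 a)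
    simp only [neg_mul, Finset.sum_neg_distrib] at h2
    linarith
  -- the integral of a block, as a set integral
  have hint : ∀ (i : Fin n → ℕ) j t, blockInd 𝕜 cls κ₀ κ i j *
      muIntegral I (∑ a, ev (i a) - ev j) (fun τ => matrixCoeff e c (T τ) i j) t =
      (σ : 𝕜) * ∫ τ in S t, blockInd 𝕜 cls κ₀ κ i j *
        NormedSpace.exp (-((∑ a, ev (i a) - ev j) * ((t - τ : ℝ) : 𝕜))) *
          matrixCoeff e c (T τ) i j := by
    intro i j t
    rcases hχ i j with h | h
    · simp [h]
    simp only [mul_assoc, MeasureTheory.integral_const_mul]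
    rw [mul_left_comm]
    congr 1
    have h1 := hμ i j h
    rcases hσ with rfl | rfl
    · rw [one_mul] at h1
      simp only [muIntegral, hS, if_true]
      rw [if_pos (hδ0.trans_le h1)]
      simp
    · simp only [muIntegral, hS]
      rw [if_neg (by linarith), if_neg (by norm_num : ¬ (-1 : ℝ) = 1)]
      simp
  have hintegrable : ∀ (i : Fin n → ℕ) j t, MeasureTheory.IntegrableOn (fun τ =>
      blockInd 𝕜 cls κ₀ κ i j *
        NormedSpace.exp (-((∑ a, ev (i a) - ev j) * ((t - τ : ℝ) : 𝕜))) *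
          matrixCoeff e c (T τ) i j) (S t) := by
    intro i j t
    rcases hχ i j with h | h
    · simp [h]
    simp only [mul_assoc]
    obtain ⟨h1, C, r, h2⟩ := hB.matrixCoeff_growth hI hT i j
    refine (integrableOn_exp_mul (hSm t) inter_subset_left hδ0 (fun τ hτ => ?_) h1 h2).const_mul _
    calc δ * |t - τ| ≤ σ * RCLike.re (∑ a, ev (i a) - ev j) * |t - τ| :=
          mul_le_mul_of_nonneg_right (hμ i j h) (abs_nonneg _)
      _ = RCLike.re (∑ a, ev (i a) - ev j) * (σ * |t - τ|) := by ring
      _ = _ := by rw [← hSσ t τ hτ]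
  -- the exponential `exp (-(∑ a, ev (i a) - ev j) s)` is a product of factors that depend on single
  -- indices, so it acts by diagonal operators; the norms of these may grow, but their product decays
  set d₀ : ℝ → ℕ → 𝕜 := fun s j =>
    (if cls j = κ₀ then 1 else 0) * NormedSpace.exp (ev j * (s : 𝕜)) with hd₀
  set d : ℝ → Fin n → ℕ → 𝕜 := fun s a i =>
    (if cls i = κ a then 1 else 0) * NormedSpace.exp (-(ev i * (s : 𝕜))) with hd
  have hprod : ∀ s i j, d₀ s j * ∏ a, d s a (i a) = blockInd 𝕜 cls κ₀ κ i j *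
      NormedSpace.exp (-((∑ a, ev (i a) - ev j) * (s : 𝕜))) := by
    intro s i j
    simp only [hd₀, hd, blockInd, Finset.prod_mul_distrib]
    rw [mul_mul_mul_comm, ← NormedSpace.exp_sum, ← NormedSpace.exp_add]
    congr 2
    rw [Finset.sum_neg_distrib, ← Finset.sum_mul]
    ring
  -- the integral formula for the whole truncated multilinear map
  have hvec : ∀ N t (y : Fin n → V.Limit) l, V.proj l (multSum e c N (fun i j =>
      blockInd 𝕜 cls κ₀ κ i j *
        muIntegral I (∑ a, ev (i a) - ev j) (fun τ => matrixCoeff e c (T τ) i j) t) y) =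
      (σ : 𝕜) • ∫ τ in S t, V.proj l (diagOp e c (d₀ (t - τ)) N
        (T τ fun a => diagOp e c (d (t - τ) a) N (y a))) := by
    intro N t y l
    simp only [diagOp_mult_diagOp, hprod]
    simp only [multSum_apply, map_sum, map_smul, hint]
    rw [MeasureTheory.integral_finsetSum _ fun i _ =>
      MeasureTheory.integrable_finsetSum _ fun j _ => ((hintegrable i j t).mul_const _).smul_const _,
      Finset.smul_sum]
    refine Finset.sum_congr rfl fun i _ => ?_
    rw [MeasureTheory.integral_finsetSum _ fun j _ =>
      ((hintegrable i j t).mul_const _).smul_const _, Finset.smul_sum]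
    refine Finset.sum_congr rfl fun j _ => ?_
    rw [integral_smul_const, MeasureTheory.integral_mul_const, smul_smul, mul_assoc]
  have hd₀b : ∀ t, ∀ τ ∈ S t, ∀ j, ‖d₀ (t - τ) j‖ ≤ Real.exp (θ₀ * |t - τ|) := by
    intro t τ hτ j
    simp only [hd₀]
    split_ifs with h
    · rw [one_mul, RCLike.norm_normedSpace_exp, mul_comm, RCLike.re_ofReal_mul]
      refine Real.exp_le_exp.2 ?_
      calc _ = σ * RCLike.re (ev j) * |t - τ| := by
            linear_combination RCLike.re (ev j) * hSσ t τ hτ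
        _ ≤ _ := mul_le_mul_of_nonneg_right (hθ₀ j h) (abs_nonneg _)
    · rw [zero_mul, norm_zero]
      exact (Real.exp_pos _).le
  have hdb : ∀ t, ∀ τ ∈ S t, ∀ a i, ‖d (t - τ) a i‖ ≤ Real.exp (θ a * |t - τ|) := by
    intro t τ hτ a i
    simp only [hd]
    split_ifs with h
    · rw [one_mul, RCLike.norm_normedSpace_exp, map_neg, mul_comm, RCLike.re_ofReal_mul]
      refine Real.exp_le_exp.2 ?_
      calc _ = -σ * RCLike.re (ev i) * |t - τ| := by
            linear_combination -RCLike.re (ev i) * hSσ t τ hτ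
        _ ≤ _ := mul_le_mul_of_nonneg_right (hθ a i h) (abs_nonneg _)
    · rw [zero_mul, norm_zero]
      exact (Real.exp_pos _).le
  intro l
  obtain ⟨k₁, C₁, hC₁, h₁⟩ := hB.diag_bound l
  obtain ⟨k₂, r, C₂, hC₂, h₂⟩ := hT 0 k₁
  obtain ⟨k₃, C₃, hC₃, h₃⟩ := hB.diag_bound k₂
  obtain ⟨K, hK0, hK⟩ := exists_integral_exp_mul_pow_le hδ0 r
  refine ⟨k₃, r, C₁ * C₂ * C₃ ^ n * K, by positivity, fun y t _ => ?_⟩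
  beta_reduce
  rw [hvec, norm_smul]
  have hσn : ‖(σ : 𝕜)‖ = 1 := by rcases hσ with rfl | rfl <;> simp
  rw [hσn, one_mul]
  set D := C₁ * C₂ * C₃ ^ n * ∏ a, ‖V.proj k₃ (y.2 a)‖ with hD
  have hD0 : 0 ≤ D := by positivity
  have hbound : ∀ τ ∈ S t, ‖V.proj l (diagOp e c (d₀ (t - τ)) y.1
      (T τ fun a => diagOp e c (d (t - τ) a) y.1 (y.2 a)))‖ ≤
      D * (Real.exp (-(δ * |t - τ|)) * (1 + |τ|) ^ r) := by
    intro τ hτ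
    rw [diagOp_apply]
    calc _ ≤ C₁ * Real.exp (θ₀ * |t - τ|) *
          ‖V.proj k₁ (T τ fun a => diagOp e c (d (t - τ) a) y.1 (y.2 a))‖ :=
          h₁ y.1 _ _ (Real.exp_pos _).le (hd₀b t τ hτ) _
      _ ≤ C₁ * Real.exp (θ₀ * |t - τ|) * (C₂ * (1 + |τ|) ^ r *
          ∏ a, (C₃ * Real.exp (θ a * |t - τ|) * ‖V.proj k₃ (y.2 a)‖)) := by
          gcongr
          refine (h₂ _ τ hτ.1).trans ?_
          beta_reduce
          gcongr with a _
          rw [diagOp_apply]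
          exact h₃ y.1 _ _ (Real.exp_pos _).le (hdb t τ hτ a) _
      _ = C₁ * C₂ * C₃ ^ n * (∏ a, ‖V.proj k₃ (y.2 a)‖) * ((Real.exp (θ₀ * |t - τ|) *
          ∏ a, Real.exp (θ a * |t - τ|)) * (1 + |τ|) ^ r) := by
          rw [Finset.prod_mul_distrib, Finset.prod_mul_distrib, Finset.prod_const,
            Finset.card_univ, Fintype.card_fin]
          ring
      _ = _ := by
          rw [← Real.exp_sum, ← Real.exp_add, ← Finset.sum_mul, ← add_mul, hD, hδ, neg_mul, neg_neg]
  calc _ ≤ ∫ τ in S t, D * (Real.exp (-(δ * |t - τ|)) * (1 + |τ|) ^ r) :=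
        MeasureTheory.norm_integral_le_of_norm_le ((hK t).1.const_mul D).integrableOn
          ((MeasureTheory.ae_restrict_iff' (hSm t)).2 (Eventually.of_forall hbound))
    _ ≤ ∫ τ, D * (Real.exp (-(δ * |t - τ|)) * (1 + |τ|) ^ r) :=
        MeasureTheory.setIntegral_le_integral ((hK t).1.const_mul D)
          (Eventually.of_forall fun τ => by positivity)
    _ ≤ D * (K * (1 + |t|) ^ r) := by
        rw [MeasureTheory.integral_const_mul]
        exact mul_le_mul_of_nonneg_left (hK t).2 hD0
    _ = _ := by rw [hD]; ring

/-- The matrix of integrals `b` over a block is tame. Its derivative is the block of `T` minus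
`(∑ a, ev (i a) - ev j) b`; by `multSum_eigen`, the second term is expressed by bounded operators
that are applied to the multilinear map with matrix `b`, so differentiability follows by induction
on its order. -/
theorem IsDiagonalBasis.matrixTame_muIntegral (hB : V.IsDiagonalBasis e c) (hI : IsOpen I)
    {A : V.Limit →ₗ[𝕜] V.Limit} (hA : V.IsBoundedOp A) {ev : ℕ → 𝕜}
    (he : ∀ j, A (e j) = ev j • e j)
    {cls : ℕ → Γ} {n : ℕ} {T : ℝ → V.Mult n} (hT : V.TameMult I T) {κ₀ : Γ}
    {κ : Fin n → Γ} {σ θ₀ : ℝ} {θ : Fin n → ℝ} (hσ : σ = 1 ∨ σ = -1)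
    (hθ₀ : ∀ j, cls j = κ₀ → σ * RCLike.re (ev j) ≤ θ₀)
    (hθ : ∀ a i, cls i = κ a → -σ * RCLike.re (ev i) ≤ θ a) (hneg : θ₀ + ∑ a, θ a < 0) (m : ℕ) :
    MatrixTame I e c m fun i j t => blockInd 𝕜 cls κ₀ κ i j *
      muIntegral I (∑ a, ev (i a) - ev j) (fun τ => matrixCoeff e c (T τ) i j) t := by
  have hbound := hB.tameBound_muIntegral hI hT hσ hθ₀ hθ hneg
  induction m with
  | zero => exact hbound
  | succ m ih =>
    set b : (Fin n → ℕ) → ℕ → ℝ → 𝕜 := fun i j t => blockInd 𝕜 cls κ₀ κ i j *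
      muIntegral I (∑ a, ev (i a) - ev j) (fun τ => matrixCoeff e c (T τ) i j) t with hb
    have hder : ∀ i j, ∀ t ∈ I, HasDerivAt (b i j)
        (blockInd 𝕜 cls κ₀ κ i j * matrixCoeff e c (T t) i j -
          (∑ a, ev (i a) - ev j) * b i j t) t := by
      intro i j t ht
      by_cases h : κ₀ = cls j ∧ κ = fun a => cls (i a)
      · have hμ : RCLike.re (∑ a, ev (i a) - ev j) ≠ 0 := by
          intro h0
          have h1 := hθ₀ j h.1.symm
          have h2 : ∑ a, -σ * RCLike.re (ev (i a)) ≤ ∑ a, θ a :=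
            Finset.sum_le_sum fun a _ => hθ a (i a) (by rw [h.2])
          rw [map_sub, map_sum, sub_eq_zero] at h0
          rw [← Finset.mul_sum, h0] at h2
          linarith
        obtain ⟨h1, h2⟩ := hB.matrixCoeff_growth hI hT i j
        simp only [hb]
        refine ((hasDerivAt_muIntegral hI hμ h1 h2 ht).const_mul _).congr_deriv ?_
        ring
      · simp only [hb, blockInd_eq, if_neg h, zero_mul, mul_zero, sub_zero]
        exact hasDerivAt_const t 0
    have hT' : MatrixTame I e c m fun i j t =>
        blockInd 𝕜 cls κ₀ κ i j * matrixCoeff e c (T t) i j :=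
      hB.matrixTame_diag hI hT (d₀ := fun j => if cls j = κ₀ then 1 else 0)
        (d := fun a i => if cls i = κ a then 1 else 0)
        (fun j => by split_ifs <;> simp)
        (fun a i => by split_ifs <;> simp) m
    have hw := isWeight_prod_snd (V := V) ℕ n
    have hAb : V.Tame I (fun k (y : ℕ × (Fin n → V.Limit)) => ∏ a, ‖V.proj k (y.2 a)‖) m
        fun y t => A (multSum e c y.1 (fun i j => b i j t) y.2) := Tame.map ih hA
    have hbA : ∀ a, V.Tame I (fun k (y : ℕ × (Fin n → V.Limit)) => ∏ a, ‖V.proj k (y.2 a)‖) m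
        fun y t => multSum e c y.1 (fun i j => b i j t) (Function.update y.2 a (A (y.2 a))) :=
      fun a => Tame.reindex (ρ' := fun k (y : ℕ × (Fin n → V.Limit)) => ∏ a, ‖V.proj k (y.2 a)‖) ih
        (fun y : ℕ × (Fin n → V.Limit) => (y.1, Function.update y.2 a (A (y.2 a))))
        fun k => exists_prod_update_le hA k a
    have hsub := Tame.sub hw hT' (Tame.sub hw (Tame.sum hw Finset.univ fun a _ => hbA a) hAb)
    refine ⟨hbound, _, fun y t ht l => ?_, hsub⟩
    have h1 := hasDerivAt_multSum (e := e) (c := c) (b := b)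
      (b' := fun i j t => blockInd 𝕜 cls κ₀ κ i j * matrixCoeff e c (T t) i j -
          (∑ a, ev (i a) - ev j) * b i j t) (fun i j => hder i j t ht) y.1 y.2 l
    refine h1.congr_deriv (congrArg _ ?_)
    rw [← multSum_eigen he (hB.coord_apply_eigen hA he)]
    simp only [multSum_apply, ← Finset.sum_sub_distrib, sub_mul]
    refine Finset.sum_congr rfl fun i _ => Finset.sum_congr rfl fun j _ =>
      V.ext_proj fun l => ?_
    simp only [map_sub, map_smul, sub_smul]

end Block

end NestedBanach

namespace NestedBanach

variable {𝕜 : Type u} [RCLike 𝕜] {V : NestedBanach.{u, w} 𝕜} {I : Set ℝ}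
  {e : ℕ → V.Limit} {c : ℕ → V.Limit →ₗ[𝕜] 𝕜}

theorem TameMult.exists_bound {n : ℕ} {M : ℝ → V.Mult n} (hM : V.TameMult I M) {t : ℝ}
    (ht : t ∈ I) (l : ℕ) :
    ∃ k, ∃ C : ℝ, 0 ≤ C ∧ ∀ x, ‖V.proj l (M t x)‖ ≤ C * ∏ a, ‖V.proj k (x a)‖ := by
  obtain ⟨k, r, C, hC, h⟩ := (hM 0).bound l
  exact ⟨k, C * (1 + |t|) ^ r, by positivity, fun x => h x t ht⟩

/-- The derivation of the `n`-linear map `M` along the linear map `A`. -/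
def multDeriv (A : V.Limit →ₗ[𝕜] V.Limit) {n : ℕ} (M : V.Mult n) : V.Mult n :=
  ∑ a, M.compLinearMap (Function.update (fun _ => LinearMap.id) a A)

theorem multDeriv_apply (A : V.Limit →ₗ[𝕜] V.Limit) {n : ℕ} (M : V.Mult n)
    (x : Fin n → V.Limit) :
    multDeriv A M x = ∑ a, M (Function.update x a (A (x a))) := by
  rw [multDeriv, sum_apply]
  refine Finset.sum_congr rfl fun a _ => ?_
  rw [MultilinearMap.compLinearMap_apply]
  congr 1
  funext b
  rcases eq_or_ne b a with rfl | h <;> simp_all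

theorem TameMult.multDeriv {A : V.Limit →ₗ[𝕜] V.Limit} (hA : V.IsBoundedOp A) (hI : IsOpen I)
    {n : ℕ} {M : ℝ → V.Mult n} (hM : V.TameMult I M) :
    V.TameMult I fun t => NestedBanach.multDeriv A (M t) := by
  intro m
  have h : ∀ a, V.Tame I (fun k (x : Fin n → V.Limit) => ∏ a, ‖V.proj k (x a)‖) m
      fun x t => M t (Function.update x a (A (x a))) := fun a =>
    Tame.reindex (hM m) (fun x => Function.update x a (A (x a))) fun k => by
      obtain ⟨k', C, hC, h⟩ := exists_prod_update_le hA k a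
      exact ⟨k', C, hC, fun y => h (0, y)⟩
  exact (Tame.sum (V.isWeight_prod n) Finset.univ fun a _ => h a).congr hI
    fun y t _ => (multDeriv_apply A (M t) y).symm

theorem TameMult.add {n : ℕ} {M M' : ℝ → V.Mult n} (hM : V.TameMult I M)
    (hM' : V.TameMult I M') : V.TameMult I fun t => M t + M' t := fun m =>
  Tame.add (V.isWeight_prod n) (hM m) (hM' m)

theorem TameMult.sub {n : ℕ} {M M' : ℝ → V.Mult n} (hM : V.TameMult I M)
    (hM' : V.TameMult I M') : V.TameMult I fun t => M t - M' t := fun m =>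
  Tame.sub (V.isWeight_prod n) (hM m) (hM' m)

theorem TameMult.neg {n : ℕ} {M : ℝ → V.Mult n} (hI : IsOpen I) (hM : V.TameMult I M) :
    V.TameMult I fun t => -M t := fun m => by
  have h := Tame.sub (V.isWeight_prod n) (tame_zero (m := m)) (hM m)
  exact h.congr hI fun y t _ => zero_sub (M t y)

theorem TameMult.map {A : V.Limit →ₗ[𝕜] V.Limit} (hA : V.IsBoundedOp A) {n : ℕ}
    {M : ℝ → V.Mult n} (hM : V.TameMult I M) :
    V.TameMult I fun t => A.compMultilinearMap (M t) := fun m =>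
  Tame.map (hM m) hA

section Block

variable {Γ : Type} [DecidableEq Γ] [Fintype Γ]

/-- The blocks of a smooth `n`-linear map that satisfy a condition form again such a map. -/
theorem IsDiagonalBasis.exists_tameMult_mask (hB : V.IsDiagonalBasis e c) (hI : IsOpen I)
    (cls : ℕ → Γ) {n : ℕ} {T : ℝ → V.Mult n} (hT : V.TameMult I T)
    (Rem : Γ × (Fin n → Γ) → Prop) [DecidablePred Rem] :
    ∃ Y : ℝ → V.Mult n, V.TameMult I Y ∧ ∀ t ∈ I, ∀ i j, matrixCoeff e c (Y t) i j =
      if Rem (cls j, fun a => cls (i a)) then matrixCoeff e c (T t) i j else 0 := by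
  have h : ∀ m, MatrixTame I e c m fun i j t =>
      ∑ κ with Rem κ, blockInd 𝕜 cls κ.1 κ.2 i j * matrixCoeff e c (T t) i j := fun m =>
    MatrixTame.sum _ fun κ _ =>
      hB.matrixTame_diag hI hT (d₀ := fun j => if cls j = κ.1 then 1 else 0)
        (d := fun a i => if cls i = κ.2 a then 1 else 0)
        (fun j => by split_ifs <;> simp) (fun a i => by split_ifs <;> simp) m
  obtain ⟨Y, hY, hYc⟩ := hB.exists_tameMult hI h
  refine ⟨Y, hY, fun t ht i j => (hYc t ht i j).trans ?_⟩
  exact sum_blockInd cls i j (fun _ => matrixCoeff e c (T t) i j) Rem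

/-- The homological equation `∂ₜX + X'A - AX + Y = T`: the blocks of `T` that satisfy `Rem`
are removed by `X`, the other blocks are kept in `Y`. -/
theorem IsDiagonalBasis.exists_homological (hB : V.IsDiagonalBasis e c) (hI : IsOpen I)
    {A : V.Limit →ₗ[𝕜] V.Limit} (hA : V.IsBoundedOp A) {ev : ℕ → 𝕜}
    (he : ∀ j, A (e j) = ev j • e j) {cls : ℕ → Γ} {n : ℕ} {T : ℝ → V.Mult n}
    (hT : V.TameMult I T) (Rem : Γ × (Fin n → Γ) → Prop) [DecidablePred Rem]
    (hRem : ∀ κ, Rem κ → ∃ σ θ₀ : ℝ, ∃ θ : Fin n → ℝ, (σ = 1 ∨ σ = -1) ∧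
      (∀ j, cls j = κ.1 → σ * RCLike.re (ev j) ≤ θ₀) ∧
      (∀ a i, cls i = κ.2 a → -σ * RCLike.re (ev i) ≤ θ a) ∧ θ₀ + ∑ a, θ a < 0) :
    ∃ X X' Y : ℝ → V.Mult n, V.TameMult I X ∧ V.TameMult I X' ∧ V.TameMult I Y ∧
      (∀ t ∈ I, ∀ x l, HasDerivAt (fun s => V.proj l (X s x)) (V.proj l (X' t x)) t) ∧
      (∀ t ∈ I, ∀ i j, matrixCoeff e c (X t) i j =
        if Rem (cls j, fun a => cls (i a)) then
          muIntegral I (∑ a, ev (i a) - ev j) (fun τ => matrixCoeff e c (T τ) i j) t else 0) ∧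
      (∀ t ∈ I, ∀ i j, matrixCoeff e c (Y t) i j =
        if Rem (cls j, fun a => cls (i a)) then 0 else matrixCoeff e c (T t) i j) ∧
      ∀ t ∈ I, X' t + multDeriv A (X t) - A.compMultilinearMap (X t) + Y t = T t := by
  have h : ∀ m, MatrixTame I e c m fun i j t => ∑ κ with Rem κ, blockInd 𝕜 cls κ.1 κ.2 i j *
      muIntegral I (∑ a, ev (i a) - ev j) (fun τ => matrixCoeff e c (T τ) i j) t := fun m =>
    MatrixTame.sum _ fun κ hκ => by
      obtain ⟨σ, θ₀, θ, hσ, hθ₀, hθ, hneg⟩ := hRem κ (Finset.mem_filter.1 hκ).2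
      exact hB.matrixTame_muIntegral hI hA he hT hσ hθ₀ hθ hneg m
  obtain ⟨X, hX, hXc⟩ := hB.exists_tameMult hI h
  replace hXc : ∀ t ∈ I, ∀ i j, matrixCoeff e c (X t) i j =
      if Rem (cls j, fun a => cls (i a)) then
        muIntegral I (∑ a, ev (i a) - ev j) (fun τ => matrixCoeff e c (T τ) i j) t else 0 :=
    fun t ht i j => (hXc t ht i j).trans (sum_blockInd cls i j (fun _ =>
      muIntegral I (∑ a, ev (i a) - ev j) (fun τ => matrixCoeff e c (T τ) i j) t) Rem)
  obtain ⟨X', hXX', hX'⟩ := hX.exists_tameMult_deriv hI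
  obtain ⟨Y, hY, hYc⟩ := hB.exists_tameMult_mask hI cls hT fun κ => ¬ Rem κ
  replace hYc : ∀ t ∈ I, ∀ i j, matrixCoeff e c (Y t) i j =
      if Rem (cls j, fun a => cls (i a)) then 0 else matrixCoeff e c (T t) i j :=
    fun t ht i j => (hYc t ht i j).trans (ite_not _ _ _)
  refine ⟨X, X', Y, hX, hX', hY, hXX', hXc, hYc, fun t ht => ?_⟩
  have hL := ((hX'.add (hX.multDeriv hA hI)).sub (hX.map hA)).add hY
  -- it suffices to compare matrix elements, for which the equation is `hasDerivAt_muIntegral`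
  refine hB.mult_ext (hL.exists_bound ht) (hT.exists_bound ht) fun i j => ?_
  have hder : c j (X' t fun a => e (i a)) = if Rem (cls j, fun a => cls (i a)) then
      matrixCoeff e c (T t) i j - (∑ a, ev (i a) - ev j) * matrixCoeff e c (X t) i j else 0 := by
    refine (hB.hasDerivAt_coord j (hXX' t ht (fun a => e (i a)) 0)).unique ?_
    have heq : (fun s => c j (X s fun a => e (i a))) =ᶠ[𝓝 t] fun s =>
        if Rem (cls j, fun a => cls (i a)) then
          muIntegral I (∑ a, ev (i a) - ev j) (fun τ => matrixCoeff e c (T τ) i j) s else 0 := by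
      filter_upwards [hI.mem_nhds ht] with s hs using hXc s hs i j
    refine HasDerivAt.congr_of_eventuallyEq ?_ heq
    rw [hXc t ht]
    split_ifs with hr
    · obtain ⟨σ, θ₀, θ, hσ, hθ₀, hθ, hneg⟩ := hRem _ hr
      obtain ⟨hc, hb⟩ := hB.matrixCoeff_growth hI hT i j
      refine hasDerivAt_muIntegral hI (fun h0 => ?_) hc hb ht
      have h1 := hθ₀ j rfl
      have h2 : ∑ a, -σ * RCLike.re (ev (i a)) ≤ ∑ a, θ a :=
        Finset.sum_le_sum fun a _ => hθ a (i a) rfl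
      rw [map_sub, map_sum, sub_eq_zero] at h0
      rw [← Finset.mul_sum, h0] at h2
      linarith
    · exact hasDerivAt_const t 0
  have hMD : c j (multDeriv A (X t) fun a => e (i a)) =
      (∑ a, ev (i a)) * matrixCoeff e c (X t) i j := by
    rw [multDeriv_apply, map_sum, Finset.sum_mul]
    refine Finset.sum_congr rfl fun a _ => ?_
    rw [he, MultilinearMap.map_update_smul, map_smul, smul_eq_mul]
    rw [Function.update_eq_self a fun b => e (i b)]
    rfl
  have hAX : c j (A (X t fun a => e (i a))) = ev j * matrixCoeff e c (X t) i j :=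
    hB.coord_apply_eigen hA he j _
  have hYj := hYc t ht i j
  have hXj := hXc t ht i j
  change c j (X' t (fun a => e (i a)) + multDeriv A (X t) (fun a => e (i a)) -
    A (X t fun a => e (i a)) + Y t fun a => e (i a)) = _
  rw [map_add, map_sub, map_add, hder, hMD, hAX]
  change _ + matrixCoeff e c (Y t) i j = _
  rw [hYj]
  split_ifs with hr
  · ring
  · rw [hXj, if_neg hr]
    ring

end Block

end NestedBanach

/-! ### Multi-indices -/

/-- The multi-index that counts how often each number occurs in a tuple. -/
noncomputable def tupleIndex {n : ℕ} (i : Fin n → ℕ) : ℕ →₀ ℕ := ∑ a, Finsupp.single (i a) 1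

theorem tupleIndex_apply {n : ℕ} (i : Fin n → ℕ) (j : ℕ) :
    tupleIndex i j = ∑ a, if i a = j then 1 else 0 := by
  simp [tupleIndex, Finsupp.finsetSum_apply, Finsupp.single_apply]

theorem tupleIndex_ne_zero {n : ℕ} (i : Fin n → ℕ) (j : ℕ) :
    tupleIndex i j ≠ 0 ↔ ∃ a, i a = j := by
  simp [tupleIndex_apply]

theorem tupleIndex_prod {n : ℕ} {R : Type*} [CommMonoid R] (i : Fin n → ℕ) (g : ℕ → R) :
    (tupleIndex i).prod (fun j m => g j ^ m) = ∏ a, g (i a) := by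
  rw [tupleIndex, ← Finsupp.prod_finsetSum_index (fun _ => pow_zero _) fun _ _ _ => pow_add _ _ _]
  simp

theorem degree_tupleIndex {n : ℕ} (i : Fin n → ℕ) : (tupleIndex i).degree = n := by
  simp [tupleIndex, map_sum]

theorem muExp_tupleIndex {𝕜 : Type*} [RCLike 𝕜] (ev : ℕ → 𝕜) {n : ℕ} (i : Fin n → ℕ) (j : ℕ) :
    muExp ev (tupleIndex i) j = ∑ a, ev (i a) - ev j := by
  rw [muExp, tupleIndex, ← Finsupp.sum_finsetSum_index (fun _ => by simp)
    fun _ _ _ => by push_cast; ring]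
  simp

theorem meets_tupleIndex {n : ℕ} (i : Fin n → ℕ) (J : Set ℕ) :
    Meets (tupleIndex i) J ↔ ∃ a, i a ∈ J := by
  simp only [Meets, tupleIndex_ne_zero]
  exact ⟨fun ⟨j, hj, a, ha⟩ => ⟨a, ha ▸ hj⟩, fun ⟨a, ha⟩ => ⟨i a, ha, a, rfl⟩⟩

theorem exists_tupleIndex {n : ℕ} (q : ℕ →₀ ℕ) (hq : q.degree = n) :
    ∃ i : Fin n → ℕ, tupleIndex i = q := by
  induction n generalizing q with
  | zero =>
    have : q = 0 := (Finsupp.degree_eq_zero_iff q).1 hq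
    exact ⟨Fin.elim0, by simp [tupleIndex, this]⟩
  | succ n ih =>
    obtain ⟨j, hj⟩ : ∃ j, q j ≠ 0 := by
      by_contra! h
      have : q = 0 := Finsupp.ext h
      simp [this] at hq
    have hle : Finsupp.single j 1 ≤ q := by
      rw [Finsupp.single_le_iff]
      omega
    have h1 := tsub_add_cancel_of_le hle
    obtain ⟨i, hi⟩ := ih (q - Finsupp.single j 1) (by
      have := congrArg Finsupp.degree h1
      rw [map_add, Finsupp.degree_single, hq] at this
      omega)
    refine ⟨Fin.cons j i, ?_⟩
    rw [tupleIndex, Fin.sum_univ_succ]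
    simp only [Fin.cons_zero, Fin.cons_succ]
    rw [add_comm, ← h1, ← hi]
    rfl

/-- The tuples of length `n` with multi-index `q`. -/
noncomputable def tuples (n : ℕ) (q : ℕ →₀ ℕ) : Finset (Fin n → ℕ) :=
  open Classical in {i ∈ Fintype.piFinset fun _ : Fin n => q.support | tupleIndex i = q}

theorem mem_tuples {n : ℕ} {q : ℕ →₀ ℕ} {i : Fin n → ℕ} : i ∈ tuples n q ↔ tupleIndex i = q := by
  rw [tuples, Finset.mem_filter, and_iff_right_iff_imp]
  rintro rfl
  rw [Fintype.mem_piFinset]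
  exact fun a => Finsupp.mem_support_iff.2 ((tupleIndex_ne_zero i _).2 ⟨a, rfl⟩)

/-- Tuples of numbers less than `N` are grouped by their multi-indices. -/
theorem sum_piFinset_range_eq {E : Type*} [AddCommMonoid E] (n N : ℕ) (g : (Fin n → ℕ) → E) :
    ∑ i ∈ Fintype.piFinset fun _ : Fin n => Finset.range N, g i =
      ∑ q ∈ (Finset.range N).finsuppAntidiag n, ∑ i ∈ tuples n q, g i := by
  classical
  have h : ∀ i : Fin n → ℕ, tupleIndex i ∈ (Finset.range N).finsuppAntidiag n ↔
      i ∈ Fintype.piFinset fun _ : Fin n => Finset.range N := by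
    intro i
    rw [Finset.mem_finsuppAntidiag', Fintype.mem_piFinset]
    have h1 : ((tupleIndex i).sum fun _ x => x) = n := degree_tupleIndex i
    rw [and_iff_right h1]
    refine ⟨fun h a => h (Finsupp.mem_support_iff.2 ((tupleIndex_ne_zero i _).2 ⟨a, rfl⟩)),
      fun h j hj => ?_⟩
    obtain ⟨a, rfl⟩ := (tupleIndex_ne_zero i j).1 (Finsupp.mem_support_iff.1 hj)
    exact h a
  rw [← Finset.sum_fiberwise_of_maps_to (fun i hi => (h i).2 hi)]
  refine Finset.sum_congr rfl fun q hq => Finset.sum_congr ?_ fun _ _ => rfl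
  ext i
  rw [Finset.mem_filter, mem_tuples, and_iff_right_iff_imp]
  rintro rfl
  exact (h i).1 hq

namespace NestedBanach

variable {𝕜 : Type u} [RCLike 𝕜] {V : NestedBanach.{u, w} 𝕜} {I : Set ℝ}
  {e : ℕ → V.Limit} {c : ℕ → V.Limit →ₗ[𝕜] 𝕜}

section Coordinates

variable {H : Type w} [NormedAddCommGroup H] [InnerProductSpace 𝕜 H] (iso : V.X 0 ≃ₗᵢ[𝕜] H)

theorem monomial_tupleIndex {n : ℕ} (i : Fin n → ℕ) (v : V.Limit) :
    V.monomial iso e (tupleIndex i) v = ∏ a, coord iso e (i a) v :=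
  tupleIndex_prod i fun j => coord iso e j v

/-- The coefficient of a monomial is the sum of the matrix elements over all its tuples. -/
theorem coeffPartialSum_eq {n : ℕ} {a : (ℕ →₀ ℕ) → ℕ → ℝ → 𝕜} {m : (Fin n → ℕ) → ℕ → 𝕜} {t : ℝ}
    (h : ∀ q : ℕ →₀ ℕ, q.degree = n → ∀ j, a q j t = ∑ i ∈ tuples n q, m i j) (N : ℕ)
    (v : V.Limit) :
    V.coeffPartialSum iso e n a N t v = multSum e (coord iso e) N m fun _ => v := by
  rw [coeffPartialSum, multSum_apply, sum_piFinset_range_eq]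
  refine Finset.sum_congr rfl fun q hq => ?_
  rw [Finset.sum_comm]
  refine Finset.sum_congr rfl fun j _ => ?_
  rw [h q (Finset.mem_finsuppAntidiag'.1 hq).1, ← Finset.sum_smul, Finset.sum_mul]
  refine congrArg (· • e j) (Finset.sum_congr rfl fun i hi => ?_)
  rw [← mem_tuples.1 hi, monomial_tupleIndex]

/-- A multilinear map at a truncated vector, as a sum over multi-indices. -/
theorem mult_trunc_eq_sum {n : ℕ} (M : V.Mult n) (N : ℕ) (v : V.Limit) :
    (M fun _ => trunc e (coord iso e) N v) = ∑ q ∈ (Finset.range N).finsuppAntidiag n,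
      V.monomial iso e q v • ∑ i ∈ tuples n q, M fun a => e (i a) := by
  classical
  simp only [trunc, diagOp_apply, Pi.one_apply, one_mul]
  rw [MultilinearMap.map_sum_finset, sum_piFinset_range_eq]
  refine Finset.sum_congr rfl fun q _ => ?_
  rw [Finset.smul_sum]
  refine Finset.sum_congr rfl fun i hi => ?_
  rw [MultilinearMap.map_smul_univ, ← mem_tuples.1 hi, monomial_tupleIndex]

end Coordinates

theorem PolTendsto.congr (hI : IsOpen I) {S S' : ℕ → ℝ → V.Limit → V.Limit}
    {F F' : ℝ → V.Limit → V.Limit} (h : V.PolTendsto I S F)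
    (hS : ∀ N, ∀ t ∈ I, ∀ v, S' N t v = S N t v) (hF : ∀ t ∈ I, ∀ v, F' t v = F t v) :
    V.PolTendsto I S' F' := by
  obtain ⟨h1, h2, h3⟩ := h
  refine ⟨fun N v k => (h1 N v k).congr fun t ht => congrArg _ (hS N t ht v),
    fun v k => (h2 v k).congr fun t ht => congrArg _ (hF t ht v), fun m l => ?_⟩
  obtain ⟨k, hk⟩ := h3 m l
  refine ⟨k, fun K hK hKc ε hε => ?_⟩
  obtain ⟨N₀, hN₀⟩ := hk K hK hKc ε hε
  refine ⟨N₀, fun N hN t ht v hv => ?_⟩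
  have heq : (fun τ => V.proj l (S' N τ v - F' τ v)) =ᶠ[𝓝 t]
      fun τ => V.proj l (S N τ v - F τ v) := by
    filter_upwards [hI.mem_nhds (hK ht)] with τ hτ
    rw [hS N τ hτ, hF τ hτ]
  rw [heq.iteratedDeriv_eq]
  exact hN₀ N hN t ht v hv

/-- Finite sums of expansions in the coordinates of the arguments, of different degrees. -/
theorem IsDiagonalBasis.polTendsto_sum_trunc (hB : V.IsDiagonalBasis e c) (hI : IsOpen I)
    (S : Finset ℕ) {M : (n : ℕ) → ℝ → V.Mult n} (hM : ∀ n ∈ S, V.TameMult I (M n)) :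
    V.PolTendsto I (fun N t v => ∑ n ∈ S, M n t fun _ => trunc e c N v)
      fun t v => ∑ n ∈ S, M n t fun _ => v := by
  have smooth : ∀ v, V.SmoothCurve I fun t => ∑ n ∈ S, M n t fun _ => v := fun v =>
    (TameCurve.sum S fun n hn => (hM n hn).tameCurve hI fun _ => tameCurve_const v).smoothCurve hI
  refine ⟨fun N v => smooth _, smooth, fun m l => ?_⟩
  have h : ∀ n ∈ S, ∃ k r : ℕ, ∀ ε : ℝ, 0 < ε → ∃ N₀, ∀ N ≥ N₀, ∀ t ∈ I, ∀ v,
      ‖iteratedDeriv m (fun τ => V.proj l ((M n τ fun _ => trunc e c N v) - M n τ fun _ => v)) t‖ ≤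
        ε * (1 + |t|) ^ r * ‖V.proj k v‖ ^ n := by
    intro n hn
    obtain ⟨D, hD, h⟩ := (hM n hn).exists_iteratedDeriv hI m
    have h0 : V.TameBound I (fun k (y : Unit × (Fin n → V.Limit)) => ∏ a, ‖V.proj k (y.2 a)‖)
        fun y t => D t y.2 := TameBound.reindex (hD 0) Prod.snd fun k => ⟨k, 1, by simp⟩
    obtain ⟨k, r, h1⟩ := hB.exists_mult_trunc_sub_le (M := fun _ => D) h0 l
    refine ⟨k, r, fun ε hε => ?_⟩
    obtain ⟨N₀, hN₀⟩ := h1 ε hε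
    refine ⟨N₀, fun N hN t ht v => ?_⟩
    rw [h (fun M => (M fun _ => trunc e c N v) - M fun _ => v) (fun M M' t ht hMM' l => by
      simp only [map_sub]
      exact (hMM' _ l).sub (hMM' _ l)) t ht l]
    simpa using hN₀ N hN () t ht fun _ => v
  choose! k r h using h
  have hle : ∀ n ∈ S, k n ≤ S.sup k := fun n hn => Finset.le_sup hn
  have hC : ∀ n ∈ S, ∃ C : ℝ, 1 ≤ C ∧ ∀ v, ‖V.proj (k n) v‖ ≤ C * ‖V.proj (S.sup k) v‖ :=
    fun n hn => V.exists_norm_proj_le (hle n hn)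
  choose! C hC1 hC using hC
  refine ⟨S.sup k, fun K hK hKc ε hε => ?_⟩
  have hN : ∀ n ∈ S, ∃ N₀, ∀ N ≥ N₀, ∀ t ∈ K, ∀ v, ‖V.proj (S.sup k) v‖ ≤ 1 →
      ‖iteratedDeriv m (fun τ => V.proj l ((M n τ fun _ => trunc e c N v) - M n τ fun _ => v)) t‖ ≤
        ε / (S.card + 1) := by
    intro n hn
    obtain ⟨B, hB0, hBK⟩ := exists_one_add_abs_pow_le hKc (r n)
    have hC0 : 0 < C n := zero_lt_one.trans_le (hC1 n hn)
    obtain ⟨N₀, hN₀⟩ := h n hn (ε / (S.card + 1) / B / C n ^ n) (by positivity)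
    refine ⟨N₀, fun N hN t ht v hv => (hN₀ N hN t (hK ht) v).trans ?_⟩
    calc _ ≤ ε / (S.card + 1) / B / C n ^ n * B * (C n * 1) ^ n := by
          gcongr
          · exact hBK t ht
          · exact (hC n hn v).trans (by gcongr)
      _ = _ := by field_simp
  choose! N₀ hN₀ using hN
  refine ⟨S.sup N₀, fun N hN t ht v hv => ?_⟩
  have heq : (fun τ => V.proj l ((∑ n ∈ S, M n τ fun _ => trunc e c N v) -
      ∑ n ∈ S, M n τ fun _ => v)) = fun τ => ∑ n ∈ S,
        V.proj l ((M n τ fun _ => trunc e c N v) - M n τ fun _ => v) := by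
    funext τ
    rw [← Finset.sum_sub_distrib, map_sum]
  rw [heq, iteratedDeriv_fun_sum]
  · calc _ ≤ ∑ n ∈ S, ε / (S.card + 1) := norm_sum_le_of_le _ fun n hn =>
          hN₀ n hn N ((Finset.le_sup hn).trans hN) t ht v hv
      _ = S.card * ε / (S.card + 1) := by rw [Finset.sum_const, nsmul_eq_mul, mul_div_assoc]
      _ ≤ ε := by
          rw [div_le_iff₀ (by positivity)]
          nlinarith
  · intro n hn
    have h1 : ∀ v, ContDiffOn ℝ ∞ (fun τ => V.proj l (M n τ fun _ => v)) I :=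
      fun v => (hM n hn).smoothCurve hI _ l
    simp only [map_sub]
    exact (((h1 _).sub (h1 _)).contDiffAt (hI.mem_nhds (hK ht))).of_le (mod_cast le_top)

end NestedBanach

/-! ### Spectral classes -/

/-- The blocks to be removed from the normal form, where the classes `0`, `1`, `2` stand for
central, stable and unstable indices. -/
def RemovedBlock {n : ℕ} (κ : Fin 3 × (Fin n → Fin 3)) : Prop :=
  (κ.1 = 0 ∧ ((¬ (∃ a, κ.2 a = 1) ∧ ∃ a, κ.2 a = 2) ∨ (¬ (∃ a, κ.2 a = 2) ∧ ∃ a, κ.2 a = 1))) ∨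
  (κ.1 = 1 ∧ ¬ ∃ a, κ.2 a = 1) ∨ (κ.1 = 2 ∧ ¬ ∃ a, κ.2 a = 2)

instance {n : ℕ} : DecidablePred (RemovedBlock (n := n)) := fun κ => by
  unfold RemovedBlock
  infer_instance

/-- `cls` assigns its spectral class to each index, with real bounds `b` and `g` in place of the
possibly infinite edges `β` and `γ` of the spectral gap. -/
structure IsSpectralClass {𝕜 : Type*} [RCLike 𝕜] (ev : ℕ → 𝕜) (α : ℝ) (β γ : EReal)
    (cls : ℕ → Fin 3) (b g : ℝ) : Prop where
  central : ∀ j, j ∈ centralIdx ev α ↔ cls j = 0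
  stable : ∀ j, j ∈ stableIdx ev β ↔ cls j = 1
  unstable : ∀ j, j ∈ unstableIdx ev γ ↔ cls j = 2
  abs_re_le : ∀ j, cls j = 0 → |RCLike.re (ev j)| ≤ α
  re_le : ∀ j, cls j = 1 → RCLike.re (ev j) ≤ -b
  le_re : ∀ j, cls j = 2 → g ≤ RCLike.re (ev j)

/-- A real number between `x + y` and the possibly infinite `β`. -/
theorem exists_real_lt_of_lt_sub {x y : ℝ} {β : EReal} (h : (x : EReal) < β - (y : EReal)) :
    ∃ b : ℝ, x + y < b ∧ (b : EReal) ≤ β := by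
  induction β with
  | bot => simp at h
  | top => exact ⟨x + y + 1, by linarith, le_top⟩
  | coe b =>
    refine ⟨b, ?_, le_rfl⟩
    rw [← EReal.coe_sub, EReal.coe_lt_coe_iff] at h
    linarith

/-- By the gap condition, the three spectral classes form a partition. -/
theorem exists_isSpectralClass {𝕜 : Type*} [RCLike 𝕜] {ev : ℕ → 𝕜} {α μt : ℝ} {β γ : EReal}
    (hα : 0 ≤ α) (hαμ : α < μt)
    (hgap : ∀ j, ¬ (-β < ((RCLike.re (ev j) : ℝ) : EReal) ∧ RCLike.re (ev j) < -α) ∧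
      ¬ (α < RCLike.re (ev j) ∧ ((RCLike.re (ev j) : ℝ) : EReal) < γ))
    {p : ℕ} (hβ : (μt : EReal) < β - (((p + 1 : ℝ) * α : ℝ) : EReal))
    (hγ : (μt : EReal) < γ - (((p + 1 : ℝ) * α : ℝ) : EReal)) :
    ∃ (cls : ℕ → Fin 3) (b g : ℝ), μt + (p + 1) * α < b ∧ μt + (p + 1) * α < g ∧
      IsSpectralClass ev α β γ cls b g := by
  classical
  obtain ⟨b, hb, hbβ⟩ := exists_real_lt_of_lt_sub hβ
  obtain ⟨g, hg, hgγ⟩ := exists_real_lt_of_lt_sub hγ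
  have hs : ∀ j ∈ stableIdx ev β, RCLike.re (ev j) ≤ -b := fun j hj => by
    have h : ((RCLike.re (ev j) : ℝ) : EReal) ≤ -(b : EReal) :=
      le_trans hj (EReal.neg_le_neg_iff.2 hbβ)
    rwa [← EReal.coe_neg, EReal.coe_le_coe_iff] at h
  have hu : ∀ j ∈ unstableIdx ev γ, g ≤ RCLike.re (ev j) := fun j hj =>
    EReal.coe_le_coe_iff.1 (hgγ.trans hj)
  have hp : (0 : ℝ) ≤ (p + 1) * α := by positivity
  have hcs : ∀ j ∈ centralIdx ev α, j ∉ stableIdx ev β := fun j hj h => by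
    have h1 := (abs_le.1 (show |RCLike.re (ev j)| ≤ α from hj)).1
    linarith [hs j h]
  have hcu : ∀ j ∈ centralIdx ev α, j ∉ unstableIdx ev γ := fun j hj h => by
    have h1 := (abs_le.1 (show |RCLike.re (ev j)| ≤ α from hj)).2
    linarith [hu j h]
  have hsu : ∀ j ∈ stableIdx ev β, j ∉ unstableIdx ev γ := fun j hj h => by
    linarith [hu j h, hs j hj]
  have hall : ∀ j, j ∉ stableIdx ev β → j ∉ unstableIdx ev γ → j ∈ centralIdx ev α := by
    intro j h1 h2
    obtain ⟨h3, h4⟩ := hgap j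
    change |RCLike.re (ev j)| ≤ α
    refine abs_le.2 ⟨?_, ?_⟩
    · by_contra! h
      exact h3 ⟨not_le.1 h1, h⟩
    · by_contra! h
      exact h4 ⟨h, not_le.1 h2⟩
  have hc : ∀ j, j ∈ centralIdx ev α ↔ (if j ∈ stableIdx ev β then (1 : Fin 3) else
      if j ∈ unstableIdx ev γ then 2 else 0) = 0 := by
    intro j
    split_ifs with h1 h2
    · simpa using fun h => hcs j h h1
    · simpa using fun h => hcu j h h2
    · simpa using hall j h1 h2
  have hs' : ∀ j, j ∈ stableIdx ev β ↔ (if j ∈ stableIdx ev β then (1 : Fin 3) else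
      if j ∈ unstableIdx ev γ then 2 else 0) = 1 := by
    intro j
    split_ifs with h1 h2 <;> simp [h1]
  have hu' : ∀ j, j ∈ unstableIdx ev γ ↔ (if j ∈ stableIdx ev β then (1 : Fin 3) else
      if j ∈ unstableIdx ev γ then 2 else 0) = 2 := by
    intro j
    split_ifs with h1 h2
    · simpa using hsu j h1
    · simp [h2]
    · simp [h2]
  exact ⟨_, b, g, hb, hg, hc, hs', hu', fun j hj => (hc j).2 hj, fun j hj => hs j ((hs' j).2 hj),
    fun j hj => hu j ((hu' j).2 hj)⟩

namespace IsSpectralClass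

variable {𝕜 : Type*} [RCLike 𝕜] {ev : ℕ → 𝕜} {α μt : ℝ} {β γ : EReal}
  {cls : ℕ → Fin 3} {b g : ℝ}

theorem mem_removedIdx (h : IsSpectralClass ev α β γ cls b g) {n : ℕ} (i : Fin n → ℕ) (j : ℕ) :
    j ∈ removedIdx ev α β γ (tupleIndex i) ↔ RemovedBlock (cls j, fun a => cls (i a)) := by
  simp only [removedIdx, RemovedBlock, mem_ofPred_eq, meets_tupleIndex, h.central, h.stable,
    h.unstable]

/-- For a block to be removed, the exponents are bounded away from `0`, by bounds that are sums of
bounds for the single eigenvalues. The sign of their real parts is `σ`: it is `1` if the value is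
stable and no argument is, or if the value is central, some argument is unstable and none is stable;
and it is `-1` in the two cases with stable and unstable interchanged. -/
theorem exists_exponents (h : IsSpectralClass ev α β γ cls b g) (hα : 0 ≤ α) (hμ : 0 < μt) {p : ℕ}
    (hb : μt + (p + 1) * α < b) (hg : μt + (p + 1) * α < g) {n : ℕ} (hn : n ≤ p)
    {κ : Fin 3 × (Fin n → Fin 3)} (hκ : RemovedBlock κ) :
    ∃ σ θ₀ : ℝ, ∃ θ : Fin n → ℝ, (σ = 1 ∨ σ = -1) ∧
      (∀ j, cls j = κ.1 → σ * RCLike.re (ev j) ≤ θ₀) ∧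
      (∀ a i, cls i = κ.2 a → -σ * RCLike.re (ev i) ≤ θ a) ∧ θ₀ + ∑ a, θ a < -μt := by
  have hp : (0 : ℝ) ≤ (p + 1) * α := by positivity
  have hnp : (n : ℝ) * α ≤ p * α := by gcongr
  have habs : ∀ j, cls j = 0 → RCLike.re (ev j) ≤ α ∧ -RCLike.re (ev j) ≤ α := fun j hj =>
    ⟨(abs_le.1 (h.abs_re_le j hj)).2, by linarith [(abs_le.1 (h.abs_re_le j hj)).1]⟩
  have hs : ∀ j, cls j = 1 → RCLike.re (ev j) ≤ α := fun j hj => by linarith [h.re_le j hj]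
  have hu : ∀ j, cls j = 2 → -RCLike.re (ev j) ≤ α := fun j hj => by linarith [h.le_re j hj]
  have hcases : ∀ x : Fin 3, x = 0 ∨ x = 1 ∨ x = 2 := by decide
  -- one argument in the class `x` contributes `-d`, the others at most `α`
  have hsum : ∀ (d : ℝ) (x : Fin 3), 0 ≤ d → (∃ a, κ.2 a = x) →
      ∑ a, (if κ.2 a = x then -d else α) ≤ n * α - d := by
    intro d x hd ⟨a, ha⟩
    have h1 : ∀ a' ∈ Finset.univ, (if κ.2 a' = x then -d else α) ≤
        α + if a' = a then -d - α else 0 := by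
      intro a' _
      split_ifs <;> subst_vars <;> first | linarith | simp_all
    refine (Finset.sum_le_sum h1).trans ?_
    rw [Finset.sum_add_distrib, Finset.sum_ite_eq' Finset.univ a]
    simp
    linarith
  rcases hκ with ⟨h0, ⟨hx, hy⟩ | ⟨hx, hy⟩⟩ | ⟨h0, hx⟩ | ⟨h0, hx⟩
  · refine ⟨1, α, fun a => if κ.2 a = 2 then -g else α, Or.inl rfl, fun j hj => ?_,
      fun a i hi => ?_, ?_⟩
    · linarith [(habs j (hj.trans h0)).1]
    · beta_reduce
      split_ifs with h2
      · linarith [h.le_re i (hi.trans h2)]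
      · rcases hcases (κ.2 a) with h3 | h3 | h3
        · linarith [(habs i (hi.trans h3)).2]
        · exact absurd ⟨a, h3⟩ hx
        · exact absurd h3 h2
    · linarith [hsum g 2 (by linarith) hy]
  · refine ⟨-1, α, fun a => if κ.2 a = 1 then -b else α, Or.inr rfl, fun j hj => ?_,
      fun a i hi => ?_, ?_⟩
    · linarith [(habs j (hj.trans h0)).2]
    · beta_reduce
      split_ifs with h2
      · linarith [h.re_le i (hi.trans h2)]
      · rcases hcases (κ.2 a) with h3 | h3 | h3
        · linarith [(habs i (hi.trans h3)).1]
        · exact absurd h3 h2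
        · exact absurd ⟨a, h3⟩ hx
    · linarith [hsum b 1 (by linarith) hy]
  · refine ⟨1, -b, fun _ => α, Or.inl rfl, fun j hj => ?_, fun a i hi => ?_, ?_⟩
    · linarith [h.re_le j (hj.trans h0)]
    · rcases hcases (κ.2 a) with h3 | h3 | h3
      · linarith [(habs i (hi.trans h3)).2]
      · exact absurd ⟨a, h3⟩ hx
      · linarith [hu i (hi.trans h3)]
    · simp
      linarith
  · refine ⟨-1, -g, fun _ => α, Or.inr rfl, fun j hj => ?_, fun a i hi => ?_, ?_⟩
    · linarith [h.le_re j (hj.trans h0)]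
    · rcases hcases (κ.2 a) with h3 | h3 | h3
      · linarith [(habs i (hi.trans h3)).1]
      · linarith [hs i (hi.trans h3)]
      · exact absurd ⟨a, h3⟩ hx
    · simp
      linarith

/-- The integrals that remove a term have decay rates larger than `μt`. -/
theorem lt_abs_re_muExp (h : IsSpectralClass ev α β γ cls b g) (hα : 0 ≤ α) (hμ : 0 < μt) {p : ℕ}
    (hb : μt + (p + 1) * α < b) (hg : μt + (p + 1) * α < g) {q : ℕ →₀ ℕ} (hq : q.degree ≤ p)
    {j : ℕ} (hj : j ∈ removedIdx ev α β γ q) : μt < |RCLike.re (muExp ev q j)| := by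
  obtain ⟨i, hi⟩ := exists_tupleIndex q rfl
  rw [← hi, h.mem_removedIdx] at hj
  obtain ⟨σ, θ₀, θ, hσ, hθ₀, hθ, hneg⟩ := h.exists_exponents hα hμ hb hg hq hj
  have h1 := hθ₀ j rfl
  have h2 : ∑ a, -σ * RCLike.re (ev (i a)) ≤ ∑ a, θ a :=
    Finset.sum_le_sum fun a _ => hθ a (i a) rfl
  rw [← Finset.mul_sum] at h2
  rw [← hi, muExp_tupleIndex, map_sub, map_sum, lt_abs]
  rcases hσ with rfl | rfl
  · left; linarith
  · right; linarith

end IsSpectralClass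

/-! ### Compact polynomials and series of components -/

/-- Precomposition with a compact operator makes a bounded multilinear map compact: as a map of its
first argument with values in multilinear maps, it factors through the compact operator. -/
theorem isCompactMultilinear_compContinuousLinearMap {𝕜 : Type u} [RCLike 𝕜] {E E' F : Type w}
    [NormedAddCommGroup E] [NormedSpace 𝕜 E] [NormedAddCommGroup E'] [NormedSpace 𝕜 E']
    [NormedAddCommGroup F] [NormedSpace 𝕜 F] {j : E →L[𝕜] E'} (hj : IsCompactOperator j) :
    ∀ {n : ℕ} (lam : ContinuousMultilinearMap 𝕜 (fun _ : Fin n => E') F),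
      IsCompactMultilinear n (lam.compContinuousLinearMap fun _ => j)
  | 0, _ => trivial
  | n + 1, lam => by
    have h : ∀ x : E, (lam.compContinuousLinearMap fun _ => j).curryLeft x =
        (lam.curryLeft (j x)).compContinuousLinearMap fun _ => j := by
      intro x
      ext y
      simp only [ContinuousMultilinearMap.curryLeft_apply,
        ContinuousMultilinearMap.compContinuousLinearMap_apply]
      congr 1
      funext a
      refine Fin.cases ?_ (fun b => ?_) a <;> simp
    refine ⟨?_, fun x => ?_⟩
    · have h1 := hj.clm_comp ((ContinuousMultilinearMap.compContinuousLinearMapL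
        (𝕜 := 𝕜) (F := F) fun _ : Fin n => j).comp lam.curryLeft)
      refine (congrArg IsCompactOperator (funext fun x => ?_)).mpr h1
      exact h x
    · rw [h]
      exact isCompactMultilinear_compContinuousLinearMap hj _

namespace NestedBanach

variable {𝕜 : Type u} [RCLike 𝕜] {V : NestedBanach.{u, w} 𝕜} {I : Set ℝ}
  {e : ℕ → V.Limit} {c : ℕ → V.Limit →ₗ[𝕜] 𝕜}

/-- Bounded polynomials are compact, because they factor through a compact inclusion. -/
theorem CompactlyNested.isCompactHomPoly (hV : V.CompactlyNested) {n : ℕ} {M : V.Mult n}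
    (hM : ∀ l, ∃ k, ∃ C : ℝ, 0 ≤ C ∧ ∀ x, ‖V.proj l (M x)‖ ≤ C * ∏ a, ‖V.proj k (x a)‖) :
    V.IsCompactHomPoly n fun v => M fun _ => v := by
  intro l
  obtain ⟨k, C, hC, h⟩ := hM l
  obtain ⟨lam, hlam, -⟩ := V.exists_extension k ((V.proj l).compMultilinearMap M) hC h
  obtain ⟨m, hm⟩ := hV k
  refine ⟨k + m, lam.compContinuousLinearMap fun _ => V.inclAdd k m,
    isCompactMultilinear_compContinuousLinearMap hm lam, fun v => ?_⟩
  rw [ContinuousMultilinearMap.compContinuousLinearMap_apply]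
  simp only [V.inclAdd_proj]
  exact hlam fun _ => v

theorem CompactlyNested.isCompactPoly (hV : V.CompactlyNested) {p : ℕ}
    {M : (n : ℕ) → V.Mult n} (hM : ∀ n ∈ Finset.Ico 2 p, ∀ l, ∃ k, ∃ C : ℝ, 0 ≤ C ∧
      ∀ x, ‖V.proj l (M n x)‖ ≤ C * ∏ a, ‖V.proj k (x a)‖) :
    V.IsCompactPoly (p - 1) fun v => ∑ n ∈ Finset.Ico 2 p, M n fun _ => v := by
  refine ⟨fun n v => if n ∈ Finset.Ico 2 p then M n fun _ => v else 0, fun n _ => ?_, fun v => ?_⟩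
  · by_cases h : n ∈ Finset.Ico 2 p
    · simp only [if_pos h]
      exact hV.isCompactHomPoly (hM n h)
    · simp only [if_neg h]
      exact hV.isCompactHomPoly (M := (0 : V.Mult n)) fun l => ⟨0, 0, le_rfl, by simp⟩
  · rw [← Finset.sum_filter]
    refine Finset.sum_congr ?_ fun _ _ => rfl
    ext n
    simp only [Finset.mem_filter, Finset.mem_Ico, Finset.mem_Icc]
    omega

/-- A smooth polynomial without constant term, and with the identity as its linear part, is a
near-identity. The derivative of an extension is computed along lines in `V_∞`, and is then known by
density. -/
theorem SmoothMap.isNearIdentity {ξ : ℝ → V.Limit → V.Limit} (hξ : V.SmoothMap I ξ) {t : ℝ}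
    (ht : t ∈ I) {S : Finset ℕ} (hS : ∀ n ∈ S, 2 ≤ n) {M : (n : ℕ) → V.Mult n}
    (h : ∀ v, ξ t v = v + ∑ n ∈ S, M n fun _ => v) : V.IsNearIdentity (ξ t) := by
  intro l
  obtain ⟨k₀, h₀⟩ := hξ.exists_of_le 1 l
  obtain ⟨g, hg, -, hg1⟩ := h₀ (l + k₀) (by omega)
  replace hg := hg t ht
  replace hg1 := hg1 t ht
  have hd : fderiv 𝕜 (g t) 0 = V.inclAdd l k₀ := by
    refine ContinuousLinearMap.coeFn_injective ((V.dense (l + k₀)).equalizer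
      (fderiv 𝕜 (g t) 0).continuous (V.inclAdd l k₀).continuous (funext fun v => ?_))
    rw [Function.comp_apply, Function.comp_apply, V.inclAdd_proj]
    have h1 : HasDerivAt (fun s : 𝕜 => g t (s • V.proj (l + k₀) v))
        (fderiv 𝕜 (g t) 0 (V.proj (l + k₀) v)) 0 := by
      have h2 : HasFDerivAt (g t) (fderiv 𝕜 (g t) 0) ((0 : 𝕜) • V.proj (l + k₀) v) := by
        rw [zero_smul]
        exact (hg1.differentiable (by simp)).differentiableAt.hasFDerivAt
      have h3 := h2.comp_hasDerivAt (0 : 𝕜) ((hasDerivAt_id (0 : 𝕜)).smul_const (V.proj (l + k₀) v))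
      simpa using! h3
    have h2 : HasDerivAt (fun s : 𝕜 => g t (s • V.proj (l + k₀) v)) (V.proj l v) 0 := by
      have h3 : (fun s : 𝕜 => g t (s • V.proj (l + k₀) v)) = fun s : 𝕜 =>
          s • V.proj l v + ∑ n ∈ S, s ^ n • V.proj l (M n fun _ => v) := by
        funext s
        rw [← map_smul, hg, h, map_add, map_smul, map_sum]
        refine congrArg _ (Finset.sum_congr rfl fun n _ => ?_)
        rw [← map_smul]
        congr 1
        simpa using (M n).map_smul_univ (fun _ => s) fun _ => v
      rw [h3]
      have h4 : HasDerivAt (fun s : 𝕜 => s • V.proj l v + ∑ n ∈ S, s ^ n • V.proj l (M n fun _ => v))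
          ((1 : 𝕜) • V.proj l v + ∑ n ∈ S, ((n : 𝕜) * 0 ^ (n - 1)) • V.proj l (M n fun _ => v)) 0 :=
        ((hasDerivAt_id (0 : 𝕜)).smul_const _).add
          (HasDerivAt.fun_sum fun n _ => (hasDerivAt_pow n (0 : 𝕜)).smul_const _)
      refine h4.congr_deriv ?_
      rw [one_smul, Finset.sum_eq_zero, add_zero]
      intro n hn
      have := hS n hn
      rw [zero_pow (by omega), mul_zero, zero_smul]
    exact h1.unique h2
  refine ⟨k₀, g t, hg, ⟨univ, univ_mem, fun x _ => (hg1.differentiable (by simp)).differentiableAt,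
    (hg1.continuous_fderiv (by simp)).continuousOn⟩, ?_⟩
  simp only [hd, sub_self]
  exact Asymptotics.isLittleO_zero _ _

theorem IsDiagonalBasis.tendsto_multSum (hB : V.IsDiagonalBasis e c) {n : ℕ} {M : ℝ → V.Mult n}
    (hM : V.TameMult I M) {t : ℝ} (ht : t ∈ I) (x : Fin n → V.Limit) (l : ℕ) :
    Tendsto (fun N => V.proj l (multSum e c N (matrixCoeff e c (M t)) x)) atTop
      (𝓝 (V.proj l (M t x))) := by
  have h0 : V.TameBound I (fun k (y : Unit × (Fin n → V.Limit)) => ∏ a, ‖V.proj k (y.2 a)‖)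
      fun y t => M t y.2 := TameBound.reindex (hM 0) Prod.snd fun k => ⟨k, 1, by simp⟩
  obtain ⟨k, r, h1⟩ := hB.exists_trunc_mult_trunc_sub_le (M := fun _ => M) h0 l
  rw [Metric.tendsto_atTop]
  intro ε hε
  obtain ⟨N₀, hN₀⟩ := h1 (ε / (1 + (1 + |t|) ^ r * ∏ a, ‖V.proj k (x a)‖)) (by positivity)
  refine ⟨N₀, fun N hN => ?_⟩
  have hx0 : 0 ≤ (1 + |t|) ^ r * ∏ a, ‖V.proj k (x a)‖ := by positivity
  rw [dist_eq_norm, ← map_sub, ← trunc_mult_trunc]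
  refine (hN₀ N hN () t ht x).trans_lt ?_
  rw [mul_assoc, div_mul_eq_mul_div, div_lt_iff₀ (by positivity)]
  nlinarith

/-- A sum of multilinear maps is a component series, if the conditions on the indices hold
for all nonzero matrix elements. -/
theorem IsDiagonalBasis.isComponentSeries (hI : IsOpen I) {H : Type w} [NormedAddCommGroup H]
    [InnerProductSpace 𝕜 H] {iso : V.X 0 ≃ₗᵢ[𝕜] H} (hB : V.IsDiagonalBasis e (coord iso e)) {p : ℕ}
    {M : (n : ℕ) → ℝ → V.Mult n} (hM : ∀ n ∈ Finset.Ico 2 p, V.TameMult I (M n)) {J : Set ℕ}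
    {cond : (ℕ →₀ ℕ) → Prop} (h : ∀ n ∈ Finset.Ico 2 p, ∀ t ∈ I, ∀ i j,
      matrixCoeff e (coord iso e) (M n t) i j ≠ 0 → j ∈ J ∧ cond (tupleIndex i)) :
    V.IsComponentSeries iso e I p J cond fun t v => ∑ n ∈ Finset.Ico 2 p, M n t fun _ => v := by
  classical
  -- the coefficient of a monomial is a sum over its tuples of basis vectors
  refine ⟨fun t ht v => ?_, fun q t => if q.degree ∈ Finset.Ico 2 p then
    ∑ i ∈ tuples q.degree q, M q.degree t fun a => e (i a) else 0, fun q => ?_, ?_⟩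
  · rw [map_sum]
    refine Submodule.sum_mem _ fun n hn => ?_
    refine (Submodule.isClosed_topologicalClosure _).mem_of_tendsto
      (hB.tendsto_multSum (hM n hn) ht (fun _ => v) 0) (Eventually.of_forall fun N => ?_)
    refine Submodule.le_topologicalClosure _ ?_
    rw [multSum_apply]
    simp only [map_sum, map_smul]
    refine Submodule.sum_mem _ fun i _ => Submodule.sum_mem _ fun j _ => ?_
    by_cases h0 : matrixCoeff e (coord iso e) (M n t) i j = 0
    · rw [h0, zero_mul, zero_smul]
      exact Submodule.zero_mem _
    · exact Submodule.smul_mem _ _ (Submodule.subset_span ⟨j, (h n hn t ht i j h0).1, rfl⟩)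
  · by_cases hq : q.degree ∈ Finset.Ico 2 p
    · simp only [if_pos hq]
      exact (TameCurve.sum _ fun i _ =>
        (hM _ hq).tameCurve hI fun a => tameCurve_const _).smoothCurve hI
    · simp only [if_neg hq]
      exact (tameCurve_const 0).smoothCurve hI
  · refine (hB.polTendsto_sum_trunc hI (Finset.Ico 2 p) hM).congr hI (fun N t ht v => ?_)
      fun _ _ _ => rfl
    have hsub : Finset.Ico 2 p ⊆ Finset.range (p + 1) := fun n hn => by
      rw [Finset.mem_Ico] at hn
      rw [Finset.mem_range]
      omega
    rw [← Finset.sum_subset hsub]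
    · refine Finset.sum_congr rfl fun n hn => ?_
      rw [mult_trunc_eq_sum]
      have hdeg : ∀ q ∈ (Finset.range N).finsuppAntidiag n, q.degree = n := fun q hq =>
        (Finset.mem_finsuppAntidiag'.1 hq).1
      have h1 : ∀ q ∈ (Finset.range N).finsuppAntidiag n,
          (if q.degree ∈ Finset.Ico 2 p then
            ∑ i ∈ tuples q.degree q, M q.degree t fun a => e (i a) else 0) =
          ∑ i ∈ tuples n q, M n t fun a => e (i a) := by
        intro q hq
        obtain rfl := hdeg q hq
        rw [if_pos hn]
      rw [Finset.sum_filter_of_ne]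
      · exact Finset.sum_congr rfl fun q hq => congrArg _ (h1 q hq)
      · intro q hq hne
        by_contra hcond
        refine hne ?_
        beta_reduce
        rw [h1 q hq, Finset.sum_eq_zero, smul_zero]
        intro i hi
        refine hB.ext_coord _ fun j => ?_
        by_contra h0
        exact hcond (mem_tuples.1 hi ▸ (h n hn t ht i j h0).2)
    · intro n _ hn
      refine Finset.sum_eq_zero fun q hq => ?_
      have hdeg : q.degree = n := (Finset.mem_finsuppAntidiag'.1 (Finset.mem_filter.1 hq).1).1
      rw [← hdeg] at hn
      beta_reduce
      rw [if_neg hn, smul_zero]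

end NestedBanach

/-! ### The residual of a polynomial coordinate transform -/

namespace NestedBanach

variable {𝕜 : Type u} [RCLike 𝕜] {V : NestedBanach.{u, w} 𝕜} {I : Set ℝ}

/-- The derivative of the homogeneous polynomial of `M` at `v` in the direction `w`. -/
def dirDeriv {n : ℕ} (M : V.Mult n) (v w : V.Limit) : V.Limit :=
  ∑ a, M (Function.update (fun _ => v) a w)

theorem dirDeriv_add {n : ℕ} (M : V.Mult n) (v w w' : V.Limit) :
    dirDeriv M v (w + w') = dirDeriv M v w + dirDeriv M v w' := by
  simp only [dirDeriv, MultilinearMap.map_update_add, Finset.sum_add_distrib]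

/-- The sum of the homogeneous polynomials of `X n`, for `2 ≤ n < N`. -/
def polySum (X : (n : ℕ) → ℝ → V.Mult n) (N : ℕ) (t : ℝ) (v : V.Limit) : V.Limit :=
  ∑ n ∈ Finset.Ico 2 N, X n t fun _ => v

theorem polySum_succ (X : (n : ℕ) → ℝ → V.Mult n) {N : ℕ} (hN : 2 ≤ N) (t : ℝ) (v : V.Limit) :
    polySum X (N + 1) t v = polySum X N t v + X N t fun _ => v :=
  Finset.sum_Ico_succ_top hN _

theorem polySum_congr {X Z : (n : ℕ) → ℝ → V.Mult n} {N : ℕ} (h : ∀ n < N, X n = Z n) :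
    polySum X N = polySum Z N := by
  funext t v
  exact Finset.sum_congr rfl fun n hn => by rw [h n (Finset.mem_Ico.1 hn).2]

section Closure

variable {n : ℕ} {M : ℝ → V.Mult n}

theorem TameMult.smoothMap_dirDeriv (hI : IsOpen I) (hM : V.TameMult I M)
    {φ : ℝ → V.Limit → V.Limit} (hφ : V.SmoothMap I φ) :
    V.SmoothMap I fun t v => dirDeriv (M t) v (φ t v) := by
  refine SmoothMap.sum _ fun a _ => hM.smoothMap hI
    (φ := fun b t v => Function.update (fun _ => v) a (φ t v) b) fun b => ?_
  rcases eq_or_ne b a with rfl | h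
  · simpa using hφ
  · simpa [h] using smoothMap_id

theorem TameMult.tamePoly_dirDeriv (hI : IsOpen I) (hM : V.TameMult I M)
    {φ : ℝ → V.Limit → V.Limit} (hφ : V.TamePoly I φ) :
    V.TamePoly I fun t v => dirDeriv (M t) v (φ t v) := by
  refine TamePoly.sum _ fun a _ => hM.tamePoly hI
    (φ := fun b t v => Function.update (fun _ => v) a (φ t v) b) fun b => ?_
  rcases eq_or_ne b a with rfl | h
  · simpa using hφ
  · simpa [h] using tamePoly_id

theorem TameMult.isOrder_dirDeriv (hM : V.TameMult I M)
    {φ : ℝ → V.Limit → V.Limit} {r m : ℕ} (hφ : V.IsOrder I r φ) (hm : m + 1 ≤ n + r) :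
    V.IsOrder I m fun t v => dirDeriv (M t) v (φ t v) := by
  refine IsOrder.sum _ fun a _ => ?_
  have h := hM.isOrder (n := fun b => if b = a then r else 1)
    (φ := fun b t v => Function.update (fun _ => v) a (φ t v) b) fun b => by
      rcases eq_or_ne b a with rfl | h
      · simpa using hφ
      · simpa [h] using isOrder_id
  refine h.mono ?_
  have h1 : ∑ b, (if b = a then r else 1) + 1 = n + r := by
    rw [← Finset.add_sum_erase _ _ (Finset.mem_univ a), if_pos rfl,
      Finset.sum_congr rfl fun b hb => if_neg (Finset.ne_of_mem_erase hb)]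
    have := a.pos
    simp
    omega
  omega

theorem TameMult.isOrder_diag (hM : V.TameMult I M) : V.IsOrder I n fun t v => M t fun _ => v := by
  simpa using hM.isOrder (n := fun _ => 1) fun _ => isOrder_id

variable {X : (n : ℕ) → ℝ → V.Mult n} {N : ℕ}

theorem smoothMap_polySum (hI : IsOpen I) (hX : ∀ n ∈ Finset.Ico 2 N, V.TameMult I (X n)) :
    V.SmoothMap I (polySum X N) :=
  SmoothMap.sum _ fun n hn => (hX n hn).smoothMap hI fun _ => smoothMap_id

theorem tamePoly_polySum (hI : IsOpen I) (hX : ∀ n ∈ Finset.Ico 2 N, V.TameMult I (X n)) :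
    V.TamePoly I (polySum X N) :=
  TamePoly.sum _ fun n hn => (hX n hn).tamePoly hI fun _ => tamePoly_id

theorem isOrder_polySum (hX : ∀ n ∈ Finset.Ico 2 N, V.TameMult I (X n)) :
    V.IsOrder I 2 (polySum X N) :=
  IsOrder.sum _ fun n hn => (hX n hn).isOrder_diag.mono (Finset.mem_Ico.1 hn).1

end Closure

/-- The residual of the coordinate transform `id + polySum X N` and the normal form `polySum Y N`,
where `X'` is the time derivative of `X`. -/
def residual (A : V.Limit →ₗ[𝕜] V.Limit) (f : ℝ → V.Limit → V.Limit)
    (X X' Y : (n : ℕ) → ℝ → V.Mult n) (N : ℕ) (t : ℝ) (v : V.Limit) : V.Limit :=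
  polySum X' N t v + (A v + polySum Y N t v) +
    ∑ n ∈ Finset.Ico 2 N, dirDeriv (X n t) v (A v + polySum Y N t v) -
    A (v + polySum X N t v) - f t (v + polySum X N t v)

section Residual

variable {A : V.Limit →ₗ[𝕜] V.Limit} {f : ℝ → V.Limit → V.Limit}
  {X X' Y : (n : ℕ) → ℝ → V.Mult n} {N : ℕ}

theorem residual_congr {Z Z' W : (n : ℕ) → ℝ → V.Mult n} (hX : ∀ n < N, X n = Z n)
    (hX' : ∀ n < N, X' n = Z' n) (hY : ∀ n < N, Y n = W n) :
    residual A f X X' Y N = residual A f Z Z' W N := by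
  funext t v
  unfold residual
  rw [polySum_congr hX, polySum_congr hX', polySum_congr hY,
    Finset.sum_congr rfl fun n hn => by rw [hX n (Finset.mem_Ico.1 hn).2]]

theorem smoothMap_residual (hI : IsOpen I) (hA : V.IsBoundedOp A) (hf : V.SmoothMap I f)
    (hX : ∀ n ∈ Finset.Ico 2 N, V.TameMult I (X n))
    (hX' : ∀ n ∈ Finset.Ico 2 N, V.TameMult I (X' n))
    (hY : ∀ n ∈ Finset.Ico 2 N, V.TameMult I (Y n)) :
    V.SmoothMap I (residual A f X X' Y N) := by
  have h1 := (smoothMap_linear (I := I) hA).add (smoothMap_polySum hI hY)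
  have h2 := smoothMap_id.add (smoothMap_polySum hI hX)
  exact ((((smoothMap_polySum hI hX').add h1).add (SmoothMap.sum _ fun n hn =>
    (hX n hn).smoothMap_dirDeriv hI h1)).sub (SmoothMap.map hA h2)).sub (hf.comp h2)

theorem isOrder_one_id_add_polySum (hX : ∀ n ∈ Finset.Ico 2 N, V.TameMult I (X n)) :
    V.IsOrder I 1 fun t v => v + polySum X N t v :=
  isOrder_id.add ((isOrder_polySum hX).mono one_le_two)

/-- Up to any order, the residual is a polynomial with tame coefficients. -/
theorem exists_tamePoly_residual (hI : IsOpen I) (hIc : I.OrdConnected) (hA : V.IsBoundedOp A)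
    (hf : V.SmoothMap I f) (hg : V.HasPolynomialGrowth I f)
    (hX : ∀ n ∈ Finset.Ico 2 N, V.TameMult I (X n))
    (hX' : ∀ n ∈ Finset.Ico 2 N, V.TameMult I (X' n))
    (hY : ∀ n ∈ Finset.Ico 2 N, V.TameMult I (Y n)) (m : ℕ) :
    ∃ ψ : ℝ → V.Limit → V.Limit, V.TamePoly I ψ ∧
      V.IsOrder I (m + 1) fun t v => residual A f X X' Y N t v - ψ t v := by
  have h1 := (tamePoly_id.map (I := I) hA).add (tamePoly_polySum hI hY)
  have h2 := tamePoly_id.add (tamePoly_polySum hI hX)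
  have h3 := (((tamePoly_polySum hI hX').add h1).add (TamePoly.sum _ fun n hn =>
    (hX n hn).tamePoly_dirDeriv hI h1)).sub (h2.map hA)
  obtain ⟨ψ, hψ, hfψ⟩ := exists_tamePoly_comp hI hIc hf hg h2 (isOrder_one_id_add_polySum hX) m
  refine ⟨_, h3.sub hψ, ((isOrder_zero (m + 1)).sub hfψ).congr fun t _ v => ?_⟩
  simp only [residual]
  abel

theorem residual_two (t : ℝ) (v : V.Limit) : residual A f X X' Y 2 t v = -f t v := by
  simp [residual, polySum]

/-- The step of the construction raises the order of the residual, if the new terms solve the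
homological equation with right hand side `T`. -/
theorem residual_succ (hN : 2 ≤ N) {T : V.Mult N} {t : ℝ}
    (h : X' N t + multDeriv A (X N t) - A.compMultilinearMap (X N t) + Y N t = T) (v : V.Limit) :
    residual A f X X' Y (N + 1) t v = residual A f X X' Y N t v + (T fun _ => v) +
      dirDeriv (X N t) v (polySum Y (N + 1) t v) +
      ∑ n ∈ Finset.Ico 2 N, dirDeriv (X n t) v (Y N t fun _ => v) -
      (f t (v + polySum X (N + 1) t v) - f t (v + polySum X N t v)) := by
  have hT : (T fun _ => v) = (X' N t fun _ => v) + dirDeriv (X N t) v (A v) -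
      A (X N t fun _ => v) + Y N t fun _ => v := by
    rw [← h, dirDeriv, ← multDeriv_apply A (X N t) fun _ => v]
    rfl
  rw [hT]
  simp only [residual, Finset.sum_Ico_succ_top hN, dirDeriv_add, Finset.sum_add_distrib,
    polySum_succ _ hN, map_add]
  abel

/-- If `-T` is the leading part of the residual, and the new terms solve the homological equation
with right hand side `T`, then the order of the residual rises by one. -/
theorem isOrder_residual_succ (hf' : V.DerivIsOrderOne I f) (hN : 2 ≤ N)
    (hX : ∀ n ∈ Finset.Ico 2 (N + 1), V.TameMult I (X n))
    (hY : ∀ n ∈ Finset.Ico 2 (N + 1), V.TameMult I (Y n)) {T : ℝ → V.Mult N}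
    (h : ∀ t ∈ I, X' N t + multDeriv A (X N t) - A.compMultilinearMap (X N t) + Y N t = T t)
    (hR : V.IsOrder I (N + 1) fun t v => residual A f X X' Y N t v + T t fun _ => v) :
    V.IsOrder I (N + 1) (residual A f X X' Y (N + 1)) := by
  have hmem : N ∈ Finset.Ico 2 (N + 1) := Finset.mem_Ico.2 ⟨hN, N.lt_succ_self⟩
  have hsub : ∀ n ∈ Finset.Ico 2 N, n ∈ Finset.Ico 2 (N + 1) := fun n hn => by
    rw [Finset.mem_Ico] at hn ⊢
    omega
  have hdiff : V.IsOrder I N fun t v => (v + polySum X (N + 1) t v) - (v + polySum X N t v) :=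
    (hX N hmem).isOrder_diag.congr fun t _ v => by
      rw [polySum_succ X hN]
      abel
  -- `f` gains one order over `X N`; a factor of order at least `2` in place of one argument of
  -- `X N` gains one order over `N`; and `X n` with `n ≥ 2` gains one over its argument `Y N`
  have h1 := hf'.isOrder_sub (isOrder_one_id_add_polySum hX)
    (isOrder_one_id_add_polySum fun n hn => hX n (hsub n hn)) hdiff
  have h2 := (hX N hmem).isOrder_dirDeriv (m := N + 1) (isOrder_polySum hY) le_rfl
  have h3 : V.IsOrder I (N + 1) fun t v => ∑ n ∈ Finset.Ico 2 N,
      dirDeriv (X n t) v (Y N t fun _ => v) :=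
    IsOrder.sum _ fun n hn => (hX n (hsub n hn)).isOrder_dirDeriv (hY N hmem).isOrder_diag (by
      have := (Finset.mem_Ico.1 hn).1
      omega)
  exact (((hR.add h2).add h3).sub h1).congr fun t ht v => (residual_succ hN (h t ht) v).symm

end Residual

end NestedBanach

/-! ### Construction of the normal form -/

namespace NestedBanach

variable {𝕜 : Type u} [RCLike 𝕜] {V : NestedBanach.{u, w} 𝕜} {I : Set ℝ}
  {e : ℕ → V.Limit} {c : ℕ → V.Limit →ₗ[𝕜] 𝕜}

/-- The homological equation with right hand side `T`, as it is solved in one step of the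
construction: `X` updates the coordinate transform, and `Y` updates the normal form. -/
structure IsStep (I : Set ℝ) (A : V.Limit →ₗ[𝕜] V.Limit) (ev : ℕ → 𝕜) (e : ℕ → V.Limit)
    (c : ℕ → V.Limit →ₗ[𝕜] 𝕜) (cls : ℕ → Fin 3) {n : ℕ} (T X X' Y : ℝ → V.Mult n) : Prop where
  tame_rhs : V.TameMult I T
  tame_transform : V.TameMult I X
  tame_deriv : V.TameMult I X'
  tame_form : V.TameMult I Y
  hasDerivAt : ∀ t ∈ I, ∀ x l, HasDerivAt (fun s => V.proj l (X s x)) (V.proj l (X' t x)) t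
  coeff_transform : ∀ t ∈ I, ∀ i j, matrixCoeff e c (X t) i j =
    if RemovedBlock (cls j, fun a => cls (i a)) then
      muIntegral I (∑ a, ev (i a) - ev j) (fun τ => matrixCoeff e c (T τ) i j) t else 0
  coeff_form : ∀ t ∈ I, ∀ i j, matrixCoeff e c (Y t) i j =
    if RemovedBlock (cls j, fun a => cls (i a)) then 0 else matrixCoeff e c (T t) i j
  homological : ∀ t ∈ I, X' t + multDeriv A (X t) - A.compMultilinearMap (X t) + Y t = T t

/-- The right hand side of the `n`-th homological equation: minus the part of degree `n` of the
residual. -/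
noncomputable def stepTerm (I : Set ℝ) (A : V.Limit →ₗ[𝕜] V.Limit) (f : ℝ → V.Limit → V.Limit)
    (X X' Y : (n : ℕ) → ℝ → V.Mult n) (n : ℕ) (t : ℝ) : V.Mult n :=
  -taylorMult I (residual A f X X' Y n) n t

section Construction

variable {A : V.Limit →ₗ[𝕜] V.Limit} {f : ℝ → V.Limit → V.Limit} {ev : ℕ → 𝕜} {cls : ℕ → Fin 3}
  {X X' Y : (n : ℕ) → ℝ → V.Mult n}

/-- The term of lowest degree of the residual is its Taylor coefficient, which `stepTerm` cancels. -/
theorem isOrder_residual_add_stepTerm (hI : IsOpen I) (hA : V.IsBoundedOp A)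
    (hf : V.SmoothMap I f) {N : ℕ}
    (hs : ∀ n ∈ Finset.Ico 2 N, IsStep I A ev e c cls (stepTerm I A f X X' Y n) (X n) (X' n) (Y n))
    (hR : V.IsOrder I N (residual A f X X' Y N)) :
    V.IsOrder I (N + 1) fun t v =>
      residual A f X X' Y N t v + stepTerm I A f X X' Y N t fun _ => v :=
  ((smoothMap_residual hI hA hf (fun n hn => (hs n hn).tame_transform)
    (fun n hn => (hs n hn).tame_deriv)
    fun n hn => (hs n hn).tame_form).isOrder_sub_taylorMult_of_isOrder hI hR).congr
      fun _ _ _ => sub_eq_add_neg _ _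

/-- After the steps below `N`, the residual is of order `N`. -/
theorem isOrder_residual (hI : IsOpen I) (hA : V.IsBoundedOp A)
    (hf : V.SmoothMap I f) (hf2 : V.IsOrder I 2 f) (hf' : V.DerivIsOrderOne I f) {N : ℕ}
    (hN : 2 ≤ N) (hs : ∀ n ∈ Finset.Ico 2 N,
      IsStep I A ev e c cls (stepTerm I A f X X' Y n) (X n) (X' n) (Y n)) :
    V.IsOrder I N (residual A f X X' Y N) := by
  induction N, hN using Nat.le_induction with
  | base =>
    refine ((isOrder_zero 2).sub hf2).congr fun t _ v => ?_
    rw [residual_two, zero_sub]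
  | succ N hN ih =>
    have hs' : ∀ n ∈ Finset.Ico 2 N,
        IsStep I A ev e c cls (stepTerm I A f X X' Y n) (X n) (X' n) (Y n) := fun n hn =>
      hs n (Finset.Ico_subset_Ico_right N.le_succ hn)
    exact isOrder_residual_succ hf' hN (fun n hn => (hs n hn).tame_transform)
      (fun n hn => (hs n hn).tame_form)
      (hs N (Finset.mem_Ico.2 ⟨hN, N.lt_succ_self⟩)).homological
      (isOrder_residual_add_stepTerm hI hA hf hs' (ih hs'))

/-- The steps can be carried out one after the other: the residual of the earlier steps is smooth and
has tame Taylor coefficients, so the next homological equation can be solved. -/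
theorem IsDiagonalBasis.exists_isStep (hB : V.IsDiagonalBasis e c) (hI : IsOpen I)
    (hIc : I.OrdConnected) (hA : V.IsBoundedOp A) (he : ∀ j, A (e j) = ev j • e j)
    (hf : V.SmoothMap I f) (hf2 : V.IsOrder I 2 f) (hf' : V.DerivIsOrderOne I f)
    (hg : V.HasPolynomialGrowth I f) (N : ℕ)
    (hcls : ∀ n < N, ∀ κ : Fin 3 × (Fin n → Fin 3), RemovedBlock κ →
      ∃ σ θ₀ : ℝ, ∃ θ : Fin n → ℝ, (σ = 1 ∨ σ = -1) ∧
        (∀ j, cls j = κ.1 → σ * RCLike.re (ev j) ≤ θ₀) ∧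
        (∀ a i, cls i = κ.2 a → -σ * RCLike.re (ev i) ≤ θ a) ∧ θ₀ + ∑ a, θ a < 0) :
    ∃ X X' Y : (n : ℕ) → ℝ → V.Mult n, ∀ n ∈ Finset.Ico 2 N,
      IsStep I A ev e c cls (stepTerm I A f X X' Y n) (X n) (X' n) (Y n) := by
  induction N with
  | zero => exact ⟨fun _ _ => 0, fun _ _ => 0, fun _ _ => 0, by simp⟩
  | succ N ih =>
    obtain ⟨X, X', Y, hs⟩ := ih fun n hn => hcls n (hn.trans N.lt_succ_self)
    rcases lt_or_ge N 2 with hN | hN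
    · refine ⟨X, X', Y, fun n hn => ?_⟩
      rw [Finset.mem_Ico] at hn
      omega
    have hR := isOrder_residual hI hA hf hf2 hf' hN hs
    have hX := fun n hn => (hs n hn).tame_transform
    have hX' := fun n hn => (hs n hn).tame_deriv
    have hY := fun n hn => (hs n hn).tame_form
    obtain ⟨ψ, hψ, hψR⟩ := exists_tamePoly_residual hI hIc hA hf hg hX hX' hY N
    have hT : V.TameMult I (stepTerm I A f X X' Y N) :=
      ((smoothMap_residual hI hA hf hX hX' hY).tameMult_taylorMult hI hIc hψR hψ).neg hI
    obtain ⟨Z, Z', W, hZ, hZ', hW, hder, hZc, hWc, heq⟩ :=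
      hB.exists_homological hI hA he hT RemovedBlock (hcls N N.lt_succ_self)
    have hup : ∀ (X : (n : ℕ) → ℝ → V.Mult n) (Z : ℝ → V.Mult N), ∀ n < N,
        Function.update X N Z n = X n := fun X Z n hn => Function.update_of_ne hn.ne _ _
    -- the right hand sides up to the `N`-th depend only on the earlier terms
    have hterm : ∀ n ≤ N, stepTerm I A f (Function.update X N Z) (Function.update X' N Z')
        (Function.update Y N W) n = stepTerm I A f X X' Y n := by
      intro n hn
      funext t
      rw [stepTerm, stepTerm, residual_congr (fun m hm => hup X Z m (hm.trans_le hn))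
        (fun m hm => hup X' Z' m (hm.trans_le hn)) (fun m hm => hup Y W m (hm.trans_le hn))]
    refine ⟨Function.update X N Z, Function.update X' N Z', Function.update Y N W,
      fun n hn => ?_⟩
    rw [Finset.mem_Ico] at hn
    rcases (Nat.lt_succ_iff.1 hn.2).lt_or_eq with h | rfl
    · rw [hterm n h.le, hup _ _ n h, hup _ _ n h, hup _ _ n h]
      exact hs n (Finset.mem_Ico.2 ⟨hn.1, h⟩)
    · rw [hterm n le_rfl, Function.update_self, Function.update_self, Function.update_self]
      exact ⟨hT, hZ, hZ', hW, hder, hZc, hWc, heq⟩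

/-- The derivative of the coordinate transform along a curve. -/
theorem hasDerivAt_id_add_polySum (hI : IsOpen I) {N : ℕ}
    (hX : ∀ n ∈ Finset.Ico 2 N, V.TameMult I (X n))
    (hXX' : ∀ n ∈ Finset.Ico 2 N, ∀ t ∈ I, ∀ x l,
      HasDerivAt (fun s => V.proj l (X n s x)) (V.proj l (X' n t x)) t)
    {t₀ s₀ : ℝ} (ht : t₀ + s₀ ∈ I) {x : ℝ → V.Limit}
    (hx : ∀ k, HasDerivAt (fun s => V.proj k (x s))
      (V.proj k (A (x s₀) + polySum Y N (t₀ + s₀) (x s₀))) s₀) (k : ℕ) :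
    HasDerivAt (fun s => V.proj k (x s + polySum X N (t₀ + s) (x s)))
      (V.proj k (A (x s₀ + polySum X N (t₀ + s₀) (x s₀)) +
        f (t₀ + s₀) (x s₀ + polySum X N (t₀ + s₀) (x s₀)) +
        residual A f X X' Y N (t₀ + s₀) (x s₀))) s₀ := by
  have h1 := (hx k).add (HasDerivAt.fun_sum fun n hn =>
    (hX n hn).hasDerivAt hI (hXX' n hn) ht (fun _ => hx) k)
  have h2 : (fun s => V.proj k (x s + polySum X N (t₀ + s) (x s))) = fun s =>
      V.proj k (x s) + ∑ n ∈ Finset.Ico 2 N, V.proj k (X n (t₀ + s) fun _ => x s) := by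
    funext s
    rw [polySum, map_add, map_sum]
  rw [h2]
  refine h1.congr_deriv ?_
  rw [← map_sum, ← map_add]
  refine congrArg _ ?_
  rw [Finset.sum_add_distrib]
  simp only [residual]
  unfold polySum dirDeriv
  abel

end Construction

/-- A smooth multilinear map splits into the parts with values in the spectral subspaces. -/
theorem IsDiagonalBasis.exists_spectral_parts (hB : V.IsDiagonalBasis e c) (hI : IsOpen I)
    (cls : ℕ → Fin 3) {n : ℕ} {M : ℝ → V.Mult n} (hM : V.TameMult I M) :
    ∃ P : Fin 3 → ℝ → V.Mult n, (∀ x, V.TameMult I (P x)) ∧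
      (∀ x, ∀ t ∈ I, ∀ i j, matrixCoeff e c (P x t) i j =
        if cls j = x then matrixCoeff e c (M t) i j else 0) ∧
      ∀ t ∈ I, M t = P 0 t + P 1 t + P 2 t := by
  choose P hP hPc using fun x : Fin 3 => hB.exists_tameMult_mask hI cls hM fun κ => κ.1 = x
  refine ⟨P, hP, hPc, fun t ht => hB.mult_ext (hM.exists_bound ht)
    ((((hP 0).add (hP 1)).add (hP 2)).exists_bound ht) fun i j => ?_⟩
  have h : matrixCoeff e c (P 0 t + P 1 t + P 2 t) i j = matrixCoeff e c (P 0 t) i j +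
      matrixCoeff e c (P 1 t) i j + matrixCoeff e c (P 2 t) i j := by
    simp only [matrixCoeff, add_apply, map_add]
  rw [h, hPc 0 t ht, hPc 1 t ht, hPc 2 t ht]
  have hcases : ∀ x : Fin 3, x = 0 ∨ x = 1 ∨ x = 2 := by decide
  rcases hcases (cls j) with h | h | h <;> simp [h]

end NestedBanach

namespace NestedBanach

variable {𝕜 : Type u} [RCLike 𝕜] {V : NestedBanach.{u, w} 𝕜} {I : Set ℝ}
  {e : ℕ → V.Limit}

/-- The coefficients `a^q_j` of a family of homogeneous polynomials in the monomials: the sums of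
the matrix elements of the multilinear maps over the tuples with multi-index `q`. -/
noncomputable def seriesCoeff (e : ℕ → V.Limit) (c : ℕ → V.Limit →ₗ[𝕜] 𝕜)
    (T : (n : ℕ) → ℝ → V.Mult n) (q : ℕ →₀ ℕ) (j : ℕ) (t : ℝ) : 𝕜 :=
  ∑ i ∈ tuples q.degree q, matrixCoeff e c (T q.degree t) i j

theorem seriesCoeff_eq {c : ℕ → V.Limit →ₗ[𝕜] 𝕜} {T : (n : ℕ) → ℝ → V.Mult n} {q : ℕ →₀ ℕ} {n : ℕ}
    (hq : q.degree = n) (j : ℕ) (t : ℝ) :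
    seriesCoeff e c T q j t = ∑ i ∈ tuples n q, matrixCoeff e c (T n t) i j := by
  subst hq
  rfl

theorem IsDiagonalBasis.seriesCoeff_regular {c : ℕ → V.Limit →ₗ[𝕜] 𝕜}
    (hB : V.IsDiagonalBasis e c) (hI : IsOpen I) {T : (n : ℕ) → ℝ → V.Mult n} {q : ℕ →₀ ℕ}
    (hT : V.TameMult I (T q.degree)) (j : ℕ) :
    ContDiffOn ℝ ∞ (seriesCoeff e c T q j) I ∧
      ∀ m, GrowsAtMostPolynomially I fun t => ‖iteratedDeriv m (seriesCoeff e c T q j) t‖ := by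
  have h1 : V.TameCurve I fun t => ∑ i ∈ tuples q.degree q, T q.degree t fun a => e (i a) :=
    TameCurve.sum _ fun i _ => hT.tameCurve hI fun a => tameCurve_const _
  have h2 : seriesCoeff e c T q j =
      fun t => c j (∑ i ∈ tuples q.degree q, T q.degree t fun a => e (i a)) := by
    funext t
    rw [map_sum]
    rfl
  obtain ⟨h3, h4⟩ := hB.coord_tameCurve hI j h1
  rw [h2]
  refine ⟨h3, fun m => ?_⟩
  obtain ⟨C, r, hC, h⟩ := h4 m
  exact growsAtMostPolynomially_of_le hC fun t ht => by simpa using h t ht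

section Coordinates

variable {H : Type w} [NormedAddCommGroup H] [InnerProductSpace 𝕜 H] {iso : V.X 0 ≃ₗᵢ[𝕜] H}

theorem IsDiagonalBasis.polTendsto_coeffPartialSum (hB : V.IsDiagonalBasis e (coord iso e))
    (hI : IsOpen I) {n : ℕ} {M : ℝ → V.Mult n} (hM : V.TameMult I M)
    {a : (ℕ →₀ ℕ) → ℕ → ℝ → 𝕜} (h : ∀ t ∈ I, ∀ q : ℕ →₀ ℕ, q.degree = n → ∀ j,
      a q j t = ∑ i ∈ tuples n q, matrixCoeff e (coord iso e) (M t) i j)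
    {F : ℝ → V.Limit → V.Limit} (hF : ∀ t ∈ I, ∀ v, F t v = M t fun _ => v) :
    V.PolTendsto I (V.coeffPartialSum iso e n a) F :=
  (hB.polTendsto_multSum hI hM).congr hI
    (fun N t ht v => coeffPartialSum_eq iso (h t ht) N v) hF

variable {A : V.Limit →ₗ[𝕜] V.Limit} {f : ℝ → V.Limit → V.Limit} {ev : ℕ → 𝕜} {cls : ℕ → Fin 3}
  {X X' Y : (n : ℕ) → ℝ → V.Mult n} {α μt b g : ℝ} {β γ : EReal}

/-- The steps of the construction use only regular integrals. -/
theorem constructedByRegularIntegrals (hB : V.IsDiagonalBasis e (coord iso e)) (hI : IsOpen I)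
    (hA : V.IsBoundedOp A) (hf : V.SmoothMap I f) (hf2 : V.IsOrder I 2 f)
    (hf' : V.DerivIsOrderOne I f) (hcls : IsSpectralClass ev α β γ cls b g) (hα : 0 ≤ α)
    (hμ : 0 < μt) {p : ℕ} (hb : μt + (p + 1) * α < b) (hg : μt + (p + 1) * α < g)
    (hs : ∀ n ∈ Finset.Ico 2 p,
      IsStep I A ev e (coord iso e) cls (stepTerm I A f X X' Y n) (X n) (X' n) (Y n)) :
    V.ConstructedByRegularIntegrals iso e ev α β γ μt I A f p
      (fun t v => v + polySum X p t v) (polySum Y p) (residual A f X X' Y p) := by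
  have hle : ∀ {N n}, N ≤ p → n ∈ Finset.Ico 2 N → n ∈ Finset.Ico 2 p := fun hN hn =>
    Finset.Ico_subset_Ico_right hN hn
  refine ⟨fun n t v => v + polySum X n t v, polySum Y, residual A f X X' Y,
    fun n t v => stepTerm I A f X X' Y n t fun _ => v,
    seriesCoeff e (coord iso e) (stepTerm I A f X X' Y), fun t _ v => ⟨by simp [polySum],
      by simp [polySum]⟩, fun t _ v => ⟨rfl, rfl, rfl⟩, fun n _ hnp t ht v k => ?_,
      fun n hn2 hnp => ?_⟩
  -- the derivative in space, along the line `s ↦ v + s • (A v + F v)`, and in time come together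
  · have h1 : t + 0 ∈ I := by rwa [add_zero]
    have h2 : ∀ k, HasDerivAt (fun s : ℝ => V.proj k (v + (s : 𝕜) • (A v + polySum Y n t v)))
        (V.proj k (A v + polySum Y n t v)) 0 := by
      intro k
      simp only [map_add, map_smul]
      have h3 : HasDerivAt (fun s : ℝ => (s : 𝕜)) 1 0 := by
        simpa using! (RCLike.ofRealCLM (K := 𝕜)).hasDerivAt (x := (0 : ℝ))
      have h4 := (h3.smul_const (V.proj k (A v) + V.proj k (polySum Y n t v))).const_add
        (V.proj k v)
      simpa using! h4
    have h3 := hasDerivAt_id_add_polySum (A := A) (f := f) (X' := X') (Y := Y) hI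
      (fun m hm => (hs m (hle hnp hm)).tame_transform)
      (fun m hm => (hs m (hle hnp hm)).hasDerivAt) h1
      (x := fun s : ℝ => v + (s : 𝕜) • (A v + polySum Y n t v)) (by simpa using h2) k
    simpa using h3
  · have hn := hs n (Finset.mem_Ico.2 ⟨hn2, hnp⟩)
    have hmem : ∀ {q : ℕ →₀ ℕ}, q.degree = n → ∀ i ∈ tuples n q, ∀ j,
        RemovedBlock (cls j, fun a => cls (i a)) ↔ j ∈ removedIdx ev α β γ q := by
      intro q _ i hi j
      rw [← mem_tuples.1 hi, hcls.mem_removedIdx]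
    have hexp : ∀ {q : ℕ →₀ ℕ}, q.degree = n → ∀ {j}, j ∈ removedIdx ev α β γ q →
        μt < |RCLike.re (muExp ev q j)| := fun hq j hj =>
      hcls.lt_abs_re_muExp hα hμ hb hg (hq.trans_le hnp.le) hj
    refine ⟨?_, ?_, fun q hq j => ?_, ?_, ?_⟩
    · exact hB.polTendsto_coeffPartialSum hI hn.tame_rhs
        (fun t _ q hq j => seriesCoeff_eq hq j t) fun t _ v => rfl
    · exact isOrder_residual_add_stepTerm hI hA hf (fun m hm => hs m (hle hnp.le hm))
        (isOrder_residual hI hA hf hf2 hf' hn2 fun m hm => hs m (hle hnp.le hm))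
    · subst hq
      obtain ⟨h1, h2⟩ := hB.seriesCoeff_regular hI hn.tame_rhs j
      exact ⟨h1, h2, fun hj => ⟨hexp rfl hj, by simpa using h2 0⟩⟩
    · refine hB.polTendsto_coeffPartialSum hI hn.tame_transform (fun t ht q hq j => ?_)
        fun t _ v => ?_
      · rw [xiCoeff]
        split_ifs with hj
        · have h1 : seriesCoeff e (coord iso e) (stepTerm I A f X X' Y) q j = fun τ =>
              ∑ i ∈ tuples n q, matrixCoeff e (coord iso e) (stepTerm I A f X X' Y n τ) i j :=
            funext fun τ => seriesCoeff_eq hq j τ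
          have h0 : RCLike.re (muExp ev q j) ≠ 0 := fun h => by
            have := hexp hq hj
            rw [h, abs_zero] at this
            linarith
          rw [h1, muIntegral_sum hI h0 _ (fun i _ => (hB.matrixCoeff_growth hI hn.tame_rhs i j).1)
            fun i _ => (hB.matrixCoeff_growth hI hn.tame_rhs i j).2]
          refine Finset.sum_congr rfl fun i hi => ?_
          rw [hn.coeff_transform t ht, if_pos ((hmem hq i hi j).2 hj), ← mem_tuples.1 hi,
            muExp_tupleIndex]
        · refine (Finset.sum_eq_zero fun i hi => ?_).symm
          rw [hn.coeff_transform t ht, if_neg fun h => hj ((hmem hq i hi j).1 h)]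
      · beta_reduce
        rw [polySum_succ X hn2]
        abel
    · refine hB.polTendsto_coeffPartialSum hI hn.tame_form (fun t ht q hq j => ?_)
        fun t _ v => ?_
      · rw [formCoeff]
        split_ifs with hj
        · refine (Finset.sum_eq_zero fun i hi => ?_).symm
          rw [hn.coeff_form t ht, if_pos ((hmem hq i hi j).2 hj)]
        · rw [seriesCoeff_eq hq]
          refine Finset.sum_congr rfl fun i hi => ?_
          rw [hn.coeff_form t ht, if_neg fun h => hj ((hmem hq i hi j).1 h)]
      · rw [polySum_succ Y hn2]
        abel

/-- The terms that are kept in the normal form preserve the spectral subspaces. -/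
theorem separatesInvariantSubspaces (hB : V.IsDiagonalBasis e (coord iso e)) (hI : IsOpen I)
    (hcls : IsSpectralClass ev α β γ cls b g) {p : ℕ} {T : (n : ℕ) → ℝ → V.Mult n}
    (hs : ∀ n ∈ Finset.Ico 2 p,
      IsStep I A ev e (coord iso e) cls (T n) (X n) (X' n) (Y n)) :
    V.SeparatesInvariantSubspaces iso e ev α β γ I p (polySum Y p) := by
  have hex : ∀ n, ∃ P : Fin 3 → ℝ → V.Mult n, n ∈ Finset.Ico 2 p →
      (∀ x, V.TameMult I (P x)) ∧
      (∀ x, ∀ t ∈ I, ∀ i j, matrixCoeff e (coord iso e) (P x t) i j =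
        if cls j = x then matrixCoeff e (coord iso e) (Y n t) i j else 0) ∧
      ∀ t ∈ I, Y n t = P 0 t + P 1 t + P 2 t := by
    intro n
    by_cases hn : n ∈ Finset.Ico 2 p
    · obtain ⟨P, hP⟩ := hB.exists_spectral_parts hI cls (hs n hn).tame_form
      exact ⟨P, fun _ => hP⟩
    · exact ⟨fun _ _ => 0, fun h => absurd h hn⟩
  choose P hP using hex
  have hne : ∀ (x : Fin 3), ∀ n ∈ Finset.Ico 2 p, ∀ t ∈ I, ∀ i j,
      matrixCoeff e (coord iso e) (P n x t) i j ≠ 0 →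
        cls j = x ∧ j ∉ removedIdx ev α β γ (tupleIndex i) := by
    intro x n hn t ht i j h
    rw [(hP n hn).2.1 x t ht, (hs n hn).coeff_form t ht] at h
    rw [hcls.mem_removedIdx]
    split_ifs at h with h1 h2
    · exact absurd rfl h
    · exact ⟨h1, h2⟩
    · exact absurd rfl h
  refine ⟨fun t v => ∑ n ∈ Finset.Ico 2 p, P n 0 t fun _ => v,
    fun t v => ∑ n ∈ Finset.Ico 2 p, P n 1 t fun _ => v,
    fun t v => ∑ n ∈ Finset.Ico 2 p, P n 2 t fun _ => v, fun t ht v => ?_, ?_, ?_, ?_⟩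
  · rw [← Finset.sum_add_distrib, ← Finset.sum_add_distrib]
    refine Finset.sum_congr rfl fun n hn => ?_
    rw [(hP n hn).2.2 t ht]
    rfl
  · refine hB.isComponentSeries hI (fun n hn => (hP n hn).1 0) fun n hn t ht i j h => ?_
    obtain ⟨h1, h2⟩ := hne 0 n hn t ht i j h
    have h3 := (hcls.central j).2 h1
    refine ⟨h3, ?_⟩
    by_contra hcon
    refine h2 (Or.inl ⟨h3, ?_⟩)
    tauto
  · refine hB.isComponentSeries hI (fun n hn => (hP n hn).1 1) fun n hn t ht i j h => ?_
    obtain ⟨h1, h2⟩ := hne 1 n hn t ht i j h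
    have h3 := (hcls.stable j).2 h1
    exact ⟨h3, by_contra fun hcon => h2 (Or.inr (Or.inl ⟨h3, hcon⟩))⟩
  · refine hB.isComponentSeries hI (fun n hn => (hP n hn).1 2) fun n hn t ht i j h => ?_
    obtain ⟨h1, h2⟩ := hne 2 n hn t ht i j h
    have h3 := (hcls.unstable j).2 h1
    exact ⟨h3, by_contra fun hcon => h2 (Or.inr (Or.inr ⟨h3, hcon⟩))⟩

end Coordinates

end NestedBanach

theorem mainTheorem1 {𝕜 : Type u} [RCLike 𝕜]
    -- a compactly nested sequence of Banach spaces whose first member is a Hilbert space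
    (V : NestedBanach.{u, w} 𝕜) (hV : V.CompactlyNested)
    {H : Type w} [NormedAddCommGroup H] [InnerProductSpace 𝕜 H] (iso : V.X 0 ≃ₗᵢ[𝕜] H)
    -- the linear operator, with a Hilbert basis of eigenvectors
    (A : V.Limit →ₗ[𝕜] V.Limit) (hA : V.IsBoundedOp A)
    (e : ℕ → V.Limit) (ev : ℕ → 𝕜) (he : ∀ j, A (e j) = ev j • e j)
    (horth : Orthonormal 𝕜 fun j => iso (V.proj 0 (e j)))
    (hspan : (Submodule.span 𝕜 (range fun j => V.proj 0 (e j))).topologicalClosure = ⊤)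
    -- a comparable nested sequence of Hilbert spaces in which the eigenvectors are orthogonal
    (W : NestedBanach.{u, w} 𝕜) {G : ℕ → Type w} [∀ k, NormedAddCommGroup (G k)]
    [∀ k, InnerProductSpace 𝕜 (G k)] (isoW : ∀ k, W.X k ≃ₗᵢ[𝕜] G k)
    (Φ : V.Limit ≃ₗ[𝕜] W.Limit) (hcomp : NestedBanach.Comparable V W Φ)
    (hWorth : ∀ k, Pairwise fun i j =>
      inner 𝕜 (isoW k (W.proj k (Φ (e i)))) (isoW k (W.proj k (Φ (e j)))) = 0)
    (hWspan : ∀ k,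
      (Submodule.span 𝕜 (range fun j => W.proj k (Φ (e j)))).topologicalClosure = ⊤)
    -- the time interval and the nonlinearity
    (I : Set ℝ) (hIopen : IsOpen I) (hIconn : I.OrdConnected) (hI0 : (0 : ℝ) ∈ I)
    (f : ℝ → V.Limit → V.Limit) (hf : V.SmoothMap I f) (hf2 : V.IsOrder I 2 f)
    (hf' : V.DerivIsOrderOne I f) (hfgrowth : V.HasPolynomialGrowth I f)
    -- the spectral gap
    (α μt : ℝ) (β γ : EReal) (hα : 0 ≤ α) (hαμ : α < μt)
    (hμβ : (μt : EReal) < β) (hμγ : (μt : EReal) < γ)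
    (hgap : ∀ j, ¬ (-β < ((RCLike.re (ev j) : ℝ) : EReal) ∧ RCLike.re (ev j) < -α) ∧
      ¬ (α < RCLike.re (ev j) ∧ ((RCLike.re (ev j) : ℝ) : EReal) < γ))
    (p : ℕ) (hp : 2 ≤ p)
    (hβ : (μt : EReal) < β - (((p + 1 : ℝ) * α : ℝ) : EReal))
    (hγ : (μt : EReal) < γ - (((p + 1 : ℝ) * α : ℝ) : EReal)) :
    ∃ F ξ R : ℝ → V.Limit → V.Limit,
      V.SmoothMap I F ∧ V.SmoothMap I ξ ∧ V.SmoothMap I R ∧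
      V.IsOrder I p R ∧
      V.IsOrder I 2 F ∧
      V.SeparatesInvariantSubspaces iso e ev α β γ I p F ∧
      (∀ t ∈ I, V.IsCompactPoly (p - 1) (F t)) ∧
      (∀ t ∈ I, V.IsNearIdentity (ξ t)) ∧
      (∀ t ∈ I, V.IsCompactPoly (p - 1) fun v => ξ t v - v) ∧
      (∀ X x : ℝ → V.Limit, V.IsSolution I A (fun t => F t (X t)) X →
        (∀ t ∈ I, x t = ξ t (X t)) →
        V.IsSolution I A (fun t => f t (x t) + R t (X t)) x) ∧
      V.ConstructedByRegularIntegrals iso e ev α β γ μt I A f p ξ F R := by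
  have hμ : 0 < μt := hα.trans_lt hαμ
  have hB := NestedBanach.isDiagonalBasis hV iso horth hspan W isoW Φ hcomp hWorth hWspan
  obtain ⟨cls, b, g, hb, hg, hcls⟩ := exists_isSpectralClass hα hαμ hgap hβ hγ
  obtain ⟨X, X', Y, hs⟩ := hB.exists_isStep hIopen hIconn hA he hf hf2 hf' hfgrowth p
    (cls := cls) fun n hn κ hκ => by
      obtain ⟨σ, θ₀, θ, hσ, hθ₀, hθ, hneg⟩ := hcls.exists_exponents hα hμ hb hg hn.le hκ
      exact ⟨σ, θ₀, θ, hσ, hθ₀, hθ, by linarith⟩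
  have hX := fun n hn => (hs n hn).tame_transform
  have hX' := fun n hn => (hs n hn).tame_deriv
  have hY := fun n hn => (hs n hn).tame_form
  have hξ : V.SmoothMap I fun t v => v + NestedBanach.polySum X p t v :=
    NestedBanach.smoothMap_id.add (NestedBanach.smoothMap_polySum hIopen hX)
  refine ⟨NestedBanach.polySum Y p, fun t v => v + NestedBanach.polySum X p t v, NestedBanach.residual A f X X' Y p,
    NestedBanach.smoothMap_polySum hIopen hY, hξ, NestedBanach.smoothMap_residual hIopen hA hf hX hX' hY,
    NestedBanach.isOrder_residual hIopen hA hf hf2 hf' hp hs, NestedBanach.isOrder_polySum hY,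
    NestedBanach.separatesInvariantSubspaces hB hIopen hcls hs,
    fun t ht => hV.isCompactPoly fun n hn => (hY n hn).exists_bound ht,
    fun t ht => hξ.isNearIdentity ht (fun n hn => (Finset.mem_Ico.1 hn).1)
      (M := fun n => X n t) fun v => rfl, fun t ht => ?_, fun Z x hZ hx => ?_,
    NestedBanach.constructedByRegularIntegrals hB hIopen hA hf hf2 hf' hcls hα hμ hb hg hs⟩
  · have h := hV.isCompactPoly (M := fun n => X n t) fun n hn => (hX n hn).exists_bound ht
    simp only [add_sub_cancel_left]
    exact h
  · refine ⟨fun k => (hξ.smoothCurve hZ.1 k).congr fun t ht => congrArg _ (hx t ht),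
      fun t ht k => ?_⟩
    have h0 : 0 + t ∈ I := by rwa [zero_add]
    have h1 := NestedBanach.hasDerivAt_id_add_polySum (A := A) (f := f) (X' := X') (Y := Y) hIopen hX
      (fun n hn => (hs n hn).hasDerivAt) h0 (x := Z) (by simpa using hZ.2 t ht) k
    simp only [zero_add, add_assoc] at h1
    beta_reduce
    rw [hx t ht]
    refine h1.congr_of_eventuallyEq ?_
    filter_upwards [hIopen.mem_nhds ht] with s hs
    rw [hx s hs]
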